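/- **Setting.** Let $W^{B}_d$ be the group of permutations $g$ of $[\pm d]=\{-d,\dots,d\}$ with $g(-i)=-g(i)$ and $W^{A}_{d-1}$ its subgroup of those $g$ with $g(k)>0$ for $1\le k\le d$. Write $W$ for $W^A_{d-1}$ (type $\Phi=A$) or $W^B_d$ (type $\Phi=B$), with simple reflections $s_i=(i,i+1)(-i,-i-1)$ for $1\le i\le d-1$ and, in type $B$, also $s_0=(-1,1)$. Let $\ell$ be the length function and $\le$ the Bruhat order. The Hecke algebra $\mathcal H$ over $\mathbb C[q,q^{-1}]$ has generators $H_w$ ($w\in W$) and relations $H_e=1$, $H_wH_x=H_{wx}$ if $\ell(wx)=\ell(w)+\ell(x)$, and $H_s^2=(q^{-1}-q)H_s+H_e$ for simple $s$. For a set $J$ of indices of simple reflections, let $W_J$ be the parabolic subgroup, $\mathcal D_J=\{g\in W:\ell(wg)=\ell(w)+\ell(g)\ \forall w\in W_J\}$, and $M^J=\mathbb C[q,q^{-1}]\otimes_{\mathcal H_J}\mathcal H$ the induced trivial module ($H_j$, $j\in J$, acts on $\mathbb C[q,q^{-1}]$ by $q^{-1}$), with standard basis $M_w=1\otimes H_w$,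 $w\in\mathcal D_J$. The bar involution $q\mapsto q^{-1}$, $H_w\mapsto H_{w^{-1}}^{-1}$ of $\mathcal H$ induces one on $M^J$. For $v\in\{q,q^{-1}\}$, the parabolic Kazhdan–Lusztig basis $\{\underline M_w\}_{w\in\mathcal D_J}$ of $M^J$ normalised by $v$ is the family of bar-invariant elements with $\underline M_w\in M_w+\sum_{x\in\mathcal D_J}v\,\mathbb Z[v]\,M_x$. **Tableaux.** Diagrams are drawn in matrix coordinates (row, column). In type $A$ let $\lambda=(\lambda_1,\dots,\lambda_r)$ be a composition of $d$ into positive parts and $[\lambda]=\{(i,j):1\le i\le r,\,1\le j\le\lambda_i\}$. In type $B$ let $\lambda_0=2m+1$ be odd and $\lambda_1,\dots,\lambda_r>0$ with $m+\lambda_1+\dots+\lambda_r=d$, and let either $[\lambda]=\{(0,j):-m\le j\le m\}\cup\{\pm(i,j):1\le i\le r,\,0\le j\le\lambda_i-1\}$ (odd number $2r+1$ of parts) or, if $\lambda_0=1$, $[\lambda]=\{\pm(i,j):1\le i\le r,\,1\le j\le\lambda_i\}$ (even number $2r$ of parts). A $\lambda$-tableau is a bijection $T$ from $[\lambda]$ to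 $[d]=\{1,\dots,d\}$ (type $A$), to $[\pm d]$ (type $B$, odd) or to $[\pm d]\setminus\{0\}$ (type $B$, even), with $T(-b)=-T(b)$ in type $B$. It is row standard if entries increase from left to right in rows, and standard if moreover entries increase from top to bottom in columns. $W$ acts on tableaux on the right by $(T\cdot w)(b)=w^{-1}(T(b))$. Boxes are read row by row, rows from bottom to top and each row from left to right. Let $T_0$ be the tableau whose entries increase in reading order, and let $w_T\in W$ be defined by $T_0\cdot w_T=T$ (so $w_T^{-1}$ is the row-reading word of $T$). Let $J$ consist of the indices $i$ of the simple reflections which are not of the form $\lambda_r+\lambda_{r-1}+\dots+\lambda_{r-k+1}$ (type $A$), respectively $m+\lambda_1+\dots+\lambda_k$ (type $B$), with $0\le k\le r$; every $J$ arises in this way. The tabloid $\{T\}$ is the row equivalence class of $T$; it contains exactly one row standard tableau. The Specht vector is $$v_T=\sum_{w\in\mathrm{col}(T)}(-1)^{\ell(w)}\{T\cdot w\},$$ where $\mathrm{col}(T)\subset W$ is the set of elements which permute the letters within each column of $T$. Embed the span of the tabloids into $M^J$ by $\{R\}\mapsto M_{w_R}$ for $R$ row standard (here $w_R\in\mathcal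 D_J$). **Theorem.** Let $\Phi\in\{A,B\}$, $d\ge0$, $\lambda$ and $J$ as above and $v\in\{q,q^{-1}\}$. The Kazhdan–Lusztig basis $\{\underline M_x\}_{x\in\mathcal D_J}$ exists, is unique, and is a $\mathbb C[q,q^{-1}]$-basis of $M^J$. For standard tableaux $T$ write $v_T=\sum_{x\in\mathcal D_J}a_{x,T}\,\underline M_x$. Then: 1. $a_{w_T,T}=1$ for all standard $T$, and $a_{x,T}=0$ if $x\not\le w_T$ in the Bruhat order. 2. For all total orders $\le_{\mathcal D}$ on $\mathcal D_J$ and $\le_r$ on the set of row standard $\lambda$-tableaux such that $x\le y\Rightarrow x\le_{\mathcal D}y$ and $w_R\le w_T\Rightarrow R\le_rT$, the matrix $(a_{x,T})$ is upper unitriangular: $a_{w_T,T}=1$, $a_{x,T}=0$ if $x\not\le_{\mathcal D}w_T$, and $a_{w_R,T}=0$ if $R\not\le_rT$. The same holds after specialisation at $q=1$, for the coefficients of $1\otimes v_T$ with respect to the basis $\{1\otimes\underline M_x\}$ of $\mathbb C\otimes_{\mathbb C[q,q^{-1}]}M^J$. -/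

import Mathlib

open scoped LaurentPolynomial Polynomial TensorProduct

noncomputable section

namespace ParabolicKL

/-- The two types of Weyl groups. -/
inductive CType
  | A
  | B

/-! ### Weyl groups as groups of signed permutations -/

/-- The Weyl group of type `Φ` acting on `[±d] = {-d, …, d}`. A permutation of `[±d]` is regarded as
a permutation of `ℤ` that is the identity outside `[±d]`. Type `B`: all `g` with `g (-i) = -g i`
(this is `W(B_d)`). Type `A`: those which in addition have no negative entry among
`g 1, …, g d` (this is `W(A_{d-1})`, the symmetric group on `d` letters). -/
def Weyl (Φ : CType) (d : ℕ) : Subgroup (Equiv.Perm ℤ) where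
  carrier := {g | (∀ i, g (-i) = -g i) ∧ (∀ i, (d : ℤ) < |i| → g i = i) ∧
    (Φ = CType.A → ∀ k, 1 ≤ k → k ≤ (d : ℤ) → 0 < g k)}
  one_mem' := ⟨fun _ => rfl, fun _ _ => rfl, fun _ k hk _ => by
    change 0 < k
    omega⟩
  mul_mem' := by
    rintro g h ⟨g1, g2, g3⟩ ⟨h1, h2, h3⟩
    refine ⟨fun i => by simp [h1, g1], fun i hi => by simp [h2 i hi, g2 i hi], fun hΦ k hk hkd => ?_⟩
    have hpos := h3 hΦ k hk hkd
    rw [Equiv.Perm.mul_apply]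
    by_cases hle : h k ≤ d
    · exact g3 hΦ _ hpos hle
    · rw [g2 _ (by rw [abs_of_pos hpos]; omega)]
      exact hpos
  inv_mem' := by
    rintro g ⟨g1, g2, g3⟩
    have i1 : ∀ i, g⁻¹ (-i) = -g⁻¹ i := fun i => by
      rw [Equiv.Perm.inv_eq_iff_eq, g1]
      exact congrArg Neg.neg (g.apply_symm_apply i).symm
    refine ⟨i1, fun i hi => by rw [Equiv.Perm.inv_eq_iff_eq, g2 i hi], fun hΦ k hk hkd => ?_⟩
    by_contra hneg
    have hk' : g (g⁻¹ k) = k := g.apply_symm_apply k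
    have h0 : g 0 = 0 := by have := g1 0; simp at this; omega
    rcases lt_or_eq_of_le (not_lt.1 hneg) with h | h
    · have e : g (-(g⁻¹ k)) = -k := by rw [g1, hk']
      by_cases hle : -(g⁻¹ k) ≤ d
      · have := g3 hΦ _ (by omega) hle
        omega
      · have := g2 (-(g⁻¹ k)) (by rw [abs_of_pos (by omega)]; omega)
        omega
    · rw [h, h0] at hk'
      omega

theorem Weyl.apply_neg {Φ : CType} {d : ℕ} (w : Weyl Φ d) (i : ℤ) :
    (w : Equiv.Perm ℤ) (-i) = -(w : Equiv.Perm ℤ) i := w.2.1 i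

theorem Weyl.apply_zero {Φ : CType} {d : ℕ} (w : Weyl Φ d) : (w : Equiv.Perm ℤ) 0 = 0 := by
  have := Weyl.apply_neg w 0
  simp only [neg_zero] at this
  omega

theorem Weyl.apply_of_lt {Φ : CType} {d : ℕ} (w : Weyl Φ d) {i : ℤ} (hi : (d : ℤ) < |i|) :
    (w : Equiv.Perm ℤ) i = i := w.2.2.1 i hi

theorem Weyl.abs_le {Φ : CType} {d : ℕ} (w : Weyl Φ d) {i : ℤ} (hi : |i| ≤ d) :
    |(w : Equiv.Perm ℤ) i| ≤ d := by
  by_contra h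
  have := Weyl.apply_of_lt w (not_le.1 h)
  have := (w : Equiv.Perm ℤ).injective this
  rw [this] at h
  exact h hi

instance (Φ : CType) (d : ℕ) : Finite (Weyl Φ d) := by
  let f : Weyl Φ d → (Set.Icc (-(d : ℤ)) d → Set.Icc (-(d : ℤ)) d) := fun w x =>
    ⟨(w : Equiv.Perm ℤ) x, abs_le.1 (Weyl.abs_le w (abs_le.2 x.2))⟩
  refine Finite.of_injective f fun v w h => Subtype.ext (Equiv.ext fun i => ?_)
  by_cases hi : |i| ≤ d
  · have := congrFun h ⟨i, _root_.abs_le.1 hi⟩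
    exact congrArg Subtype.val this
  · rw [Weyl.apply_of_lt v (not_le.1 hi), Weyl.apply_of_lt w (not_le.1 hi)]

instance (Φ : CType) (d : ℕ) : Fintype (Weyl Φ d) := Fintype.ofFinite _

/-- The index set of the simple reflections: `{1, …, d-1}` in type `A`, `{0, …, d-1}` in
type `B`. -/
def Idx (Φ : CType) (d : ℕ) : Set ℕ := {i | i < d ∧ (Φ = CType.A → 1 ≤ i)}

/-- `s_0 = (-1, 1)` and `s_i = (i, i+1)(-i, -i-1)` for `i ≥ 1`, as permutations of `ℤ`. -/
def simplePerm (i : ℕ) : Equiv.Perm ℤ :=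
  if i = 0 then Equiv.swap (-1) 1
  else Equiv.swap (i : ℤ) (i + 1) * Equiv.swap (-(i : ℤ)) (-(i : ℤ) - 1)

theorem simplePerm_apply (i : ℕ) (k : ℤ) : simplePerm i k =
    if i = 0 then (if k = 1 then -1 else if k = -1 then 1 else k)
    else if k = i then i + 1 else if k = i + 1 then i
    else if k = -(i : ℤ) then -(i : ℤ) - 1 else if k = -(i : ℤ) - 1 then -(i : ℤ) else k := by
  unfold simplePerm
  by_cases hi : i = 0
  · simp only [hi, if_true, Equiv.swap_apply_def]
    split_ifs <;> omega
  · simp only [hi, if_false, Equiv.Perm.mul_apply, Equiv.swap_apply_def]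
    split_ifs <;> omega

theorem simplePerm_mem {Φ : CType} {d : ℕ} (i : Idx Φ d) : simplePerm i ∈ Weyl Φ d := by
  obtain ⟨i, hi, hA⟩ := i
  refine ⟨fun k => ?_, fun k hk => ?_, fun hΦ k hk hkd => ?_⟩
  · simp only [simplePerm_apply]
    split_ifs <;> omega
  · simp only [simplePerm_apply]
    rcases abs_cases k with h | h <;> split_ifs <;> omega
  · have := hA hΦ
    simp only [simplePerm_apply]
    split_ifs <;> omega

/-- The simple reflections (Coxeter generators) of the Weyl group. -/
def simple {Φ : CType} {d : ℕ} (i : Idx Φ d) : Weyl Φ d := ⟨simplePerm i, simplePerm_mem i⟩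

theorem simple_mul_self {Φ : CType} {d : ℕ} (i : Idx Φ d) : simple i * simple i = 1 := by
  refine Subtype.ext (Equiv.ext fun k => ?_)
  change simplePerm i (simplePerm i k) = k
  rw [simplePerm_apply i k]
  split_ifs <;> rw [simplePerm_apply] <;> split_ifs <;> first | omega | contradiction

theorem simple_inv {Φ : CType} {d : ℕ} (i : Idx Φ d) : (simple i)⁻¹ = simple i :=
  inv_eq_of_mul_eq_one_right (simple_mul_self i)

/-- The length function: the least number of factors in an expression as a product of simple
reflections. -/
def len {Φ : CType} {d : ℕ} (w : Weyl Φ d) : ℕ :=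
  sInf {n | ∃ l : List (Idx Φ d), l.length = n ∧ (l.map simple).prod = w}

theorem eq_one_of_increasing {Φ : CType} {d : ℕ} (w : Weyl Φ d)
    (h1 : 1 ≤ d → 0 < (w : Equiv.Perm ℤ) 1)
    (h2 : ∀ i : ℕ, 1 ≤ i → i < d → (w : Equiv.Perm ℤ) i < (w : Equiv.Perm ℤ) (i + 1)) :
    w = 1 := by
  have lower : ∀ k : ℕ, 1 ≤ k → k ≤ d → (k : ℤ) ≤ (w : Equiv.Perm ℤ) k := by
    intro k hk
    induction k, hk using Nat.le_induction with
    | base => intro hd; have := h1 hd; push_cast; omega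
    | succ k hk ih =>
      intro hd
      have a := ih (by omega)
      have b := h2 k hk (by omega)
      push_cast
      omega
  have upper : ∀ j : ℕ, j < d → (w : Equiv.Perm ℤ) ((d - j : ℕ) : ℤ) ≤ ((d - j : ℕ) : ℤ) := by
    intro j
    induction j with
    | zero =>
      intro hd
      exact (abs_le.1 (Weyl.abs_le w (i := ((d - 0 : ℕ) : ℤ)) (by simp))).2
    | succ j ih =>
      intro hd
      have a := ih (by omega)
      have b := h2 (d - (j + 1)) (by omega) (by omega)
      have e : (((d - (j + 1) : ℕ) : ℤ) + 1) = ((d - j : ℕ) : ℤ) := by omega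
      rw [e] at b
      omega
  have pos : ∀ k : ℕ, 1 ≤ k → k ≤ d → (w : Equiv.Perm ℤ) k = k := by
    intro k hk hd
    have a := upper (d - k) (by omega)
    rw [show d - (d - k) = k by omega] at a
    exact le_antisymm a (lower k hk hd)
  refine Subtype.ext (Equiv.ext fun k => ?_)
  change (w : Equiv.Perm ℤ) k = k
  by_cases hk : |k| ≤ d
  · rcases lt_trichotomy k 0 with h | h | h
    · have a := pos (-k).toNat (by omega) (by rw [abs_of_neg h] at hk; omega)
      rw [show (((-k).toNat : ℕ) : ℤ) = -k by omega, Weyl.apply_neg] at a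
      omega
    · rw [h]; exact Weyl.apply_zero w
    · have a := pos k.toNat (by omega) (by rw [abs_of_pos h] at hk; omega)
      rwa [show ((k.toNat : ℕ) : ℤ) = k by omega] at a
  · exact Weyl.apply_of_lt w (not_le.1 hk)

/-- Every element of the Weyl group is a product of simple reflections. -/
theorem exists_word {Φ : CType} {d : ℕ} (w : Weyl Φ d) :
    ∃ l : List (Idx Φ d), (l.map simple).prod = w := by
  let f : Weyl Φ d → ℤ := fun w => ∑ k ∈ Finset.Icc 1 d, (k : ℤ) * (w : Equiv.Perm ℤ) k
  have key : ∀ i : Idx Φ d, ∀ w : Weyl Φ d,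
      (∃ l : List (Idx Φ d), (l.map simple).prod = w * simple i) →
      ∃ l : List (Idx Φ d), (l.map simple).prod = w := by
    rintro i w ⟨l, hl⟩
    refine ⟨l ++ [i], ?_⟩
    simp [hl, mul_assoc, simple_mul_self]
  by_contra hw
  obtain ⟨v, hv, hmax⟩ := Set.exists_max_image
    {w : Weyl Φ d | ¬ ∃ l : List (Idx Φ d), (l.map simple).prod = w} f (Set.toFinite _) ⟨w, hw⟩
  have hne : v ≠ 1 := fun h => hv ⟨[], by simp [h]⟩
  apply hne
  have step : ∀ i : Idx Φ d, f (v * simple i) ≤ f v := fun i =>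
    hmax _ fun h => hv (key i v h)
  apply eq_one_of_increasing
  · intro hd
    by_contra hneg
    have h1 : (v : Equiv.Perm ℤ) 1 ≠ 0 := fun h => by
      have := (v : Equiv.Perm ℤ).injective (h.trans (Weyl.apply_zero v).symm)
      omega
    have hΦ : Φ ≠ CType.A := fun h => hneg (v.2.2.2 h 1 le_rfl (by omega))
    have := step ⟨0, by omega, fun h => absurd h hΦ⟩
    have e : f v - f (v * simple ⟨0, by omega, fun h => absurd h hΦ⟩) =
        2 * (v : Equiv.Perm ℤ) 1 := by
      simp only [f]
      rw [← Finset.sum_sub_distrib, Finset.sum_eq_single 1]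
      · change (1 : ℕ) * _ - (1 : ℕ) * (v : Equiv.Perm ℤ) (simplePerm 0 (1 : ℕ)) = _
        simp [simplePerm_apply, Weyl.apply_neg]
        ring
      · intro k hk hk1
        change (k : ℤ) * _ - k * (v : Equiv.Perm ℤ) (simplePerm 0 k) = _
        have : simplePerm 0 (k : ℤ) = k := by
          simp only [Finset.mem_Icc] at hk
          rw [simplePerm_apply, if_pos rfl, if_neg (by omega), if_neg (by omega)]
        rw [this, sub_self]
      · intro h; simp at h; omega
    omega
  · intro i hi hid
    by_contra hlt
    have hne' : (v : Equiv.Perm ℤ) i ≠ (v : Equiv.Perm ℤ) (i + 1) := fun h => by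
      have := (v : Equiv.Perm ℤ).injective h
      omega
    have := step ⟨i, hid, fun _ => hi⟩
    have e : f v - f (v * simple ⟨i, hid, fun _ => hi⟩) =
        (v : Equiv.Perm ℤ) (i + 1) - (v : Equiv.Perm ℤ) i := by
      simp only [f]
      rw [← Finset.sum_sub_distrib, ← Finset.sum_subset (s₁ := {i, i + 1})]
      · rw [Finset.sum_pair (by omega)]
        change (i : ℤ) * _ - i * (v : Equiv.Perm ℤ) (simplePerm i i) +
          (((i + 1 : ℕ) : ℤ) * _ - ((i + 1 : ℕ) : ℤ) *
            (v : Equiv.Perm ℤ) (simplePerm i ((i + 1 : ℕ) : ℤ))) = _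
        have a : simplePerm i (i : ℤ) = i + 1 := by
          simp only [simplePerm_apply]
          split_ifs <;> omega
        have b : simplePerm i ((i + 1 : ℕ) : ℤ) = i := by
          simp only [simplePerm_apply]
          split_ifs <;> omega
        rw [a, b]
        push_cast
        ring
      · intro k hk
        simp only [Finset.mem_insert, Finset.mem_singleton] at hk
        simp only [Finset.mem_Icc]
        omega
      · intro k hk hk1
        simp only [Finset.mem_insert, Finset.mem_singleton, not_or] at hk1
        change (k : ℤ) * _ - k * (v : Equiv.Perm ℤ) (simplePerm i k) = _
        have : simplePerm i (k : ℤ) = k := by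
          simp only [simplePerm_apply]
          simp only [Finset.mem_Icc] at hk
          split_ifs <;> omega
        rw [this, sub_self]
    omega

theorem exists_reduced_word {Φ : CType} {d : ℕ} (w : Weyl Φ d) :
    ∃ l : List (Idx Φ d), l.length = len w ∧ (l.map simple).prod = w :=
  Nat.sInf_mem (s := {n | ∃ l : List (Idx Φ d), l.length = n ∧ (l.map simple).prod = w})
    (let ⟨l, hl⟩ := exists_word w; ⟨l.length, l, rfl, hl⟩)

theorem len_prod_le {Φ : CType} {d : ℕ} (l : List (Idx Φ d)) :
    len (l.map simple).prod ≤ l.length := Nat.sInf_le ⟨l, rfl, rfl⟩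

theorem len_inv_le {Φ : CType} {d : ℕ} (w : Weyl Φ d) : len w⁻¹ ≤ len w := by
  obtain ⟨l, hl, hw⟩ := exists_reduced_word w
  have : (l.reverse.map simple).prod = w⁻¹ := by
    rw [← hw, List.prod_inv_reverse, List.map_reverse]
    congr 2
    simp [Function.comp_def, simple_inv]
  rw [← hl, ← this, ← List.length_reverse]
  exact len_prod_le _

theorem len_inv {Φ : CType} {d : ℕ} (w : Weyl Φ d) : len w⁻¹ = len w :=
  le_antisymm (len_inv_le w) (by simpa using len_inv_le w⁻¹)

/-- A reflection is a conjugate of a simple reflection. -/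
def IsReflection {Φ : CType} {d : ℕ} (t : Weyl Φ d) : Prop :=
  ∃ (w : Weyl Φ d) (i : Idx Φ d), t = w * simple i * w⁻¹

/-- The Bruhat order: the reflexive and transitive closure of the relation
`u → u * t`, `t` a reflection with `len u < len (u * t)`. -/
def BruhatLE {Φ : CType} {d : ℕ} : Weyl Φ d → Weyl Φ d → Prop :=
  Relation.ReflTransGen fun u v => ∃ t, IsReflection t ∧ v = u * t ∧ len u < len v

/-- The parabolic subgroup `W_J`. -/
def parabolic {Φ : CType} {d : ℕ} (J : Set (Idx Φ d)) : Subgroup (Weyl Φ d) :=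
  Subgroup.closure (simple '' J)

/-- The shortest representatives of the right cosets `W_J \ W`. -/
def minReps {Φ : CType} {d : ℕ} (J : Set (Idx Φ d)) : Set (Weyl Φ d) :=
  {g | ∀ w ∈ parabolic J, len (w * g) = len w + len g}

instance {Φ : CType} {d : ℕ} (J : Set (Idx Φ d)) : Fintype (minReps J) := Fintype.ofFinite _

/-! ### The Hecke algebra and its bar involution -/

/-- The ring `ℂ[q, q⁻¹]`. -/
abbrev LR : Type := ℂ[T;T⁻¹]

/-- The indeterminate `q`. -/
def q : LR := LaurentPolynomial.T 1

/-- The inverse `q⁻¹` of the indeterminate. -/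
def qInv : LR := LaurentPolynomial.T (-1)

theorem q_mul_qInv : q * qInv = 1 := by
  rw [q, qInv, ← LaurentPolynomial.T_add, add_neg_cancel, LaurentPolynomial.T_zero]

/-- The defining relations of the Hecke algebra on generators `H_w`, `w ∈ W`: `H_e = 1`,
`H_w H_x = H_{wx}` if the lengths add up, and `H_s² = (q⁻¹ - q) H_s + H_e`. -/
inductive HeckeRel (Φ : CType) (d : ℕ) :
    FreeAlgebra LR (Weyl Φ d) → FreeAlgebra LR (Weyl Φ d) → Prop
  | one : HeckeRel Φ d (FreeAlgebra.ι LR 1) 1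
  | mul (w x : Weyl Φ d) (h : len (w * x) = len w + len x) :
      HeckeRel Φ d (FreeAlgebra.ι LR w * FreeAlgebra.ι LR x) (FreeAlgebra.ι LR (w * x))
  | quad (i : Idx Φ d) :
      HeckeRel Φ d (FreeAlgebra.ι LR (simple i) * FreeAlgebra.ι LR (simple i))
        ((qInv - q) • FreeAlgebra.ι LR (simple i) + FreeAlgebra.ι LR 1)

/-- The Hecke algebra of `W` over `ℂ[q, q⁻¹]`. -/
def Hecke (Φ : CType) (d : ℕ) : Type := RingQuot (HeckeRel Φ d)

instance (Φ : CType) (d : ℕ) : Ring (Hecke Φ d) := inferInstanceAs (Ring (RingQuot (HeckeRel Φ d)))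

instance (Φ : CType) (d : ℕ) : Algebra LR (Hecke Φ d) :=
  inferInstanceAs (Algebra LR (RingQuot (HeckeRel Φ d)))

/-- The element `H_w` of the Hecke algebra. -/
def H {Φ : CType} {d : ℕ} (w : Weyl Φ d) : Hecke Φ d :=
  RingQuot.mkAlgHom LR (HeckeRel Φ d) (FreeAlgebra.ι LR w)

section

variable {Φ : CType} {d : ℕ}

theorem H_one : H (1 : Weyl Φ d) = 1 :=
  (RingQuot.mkAlgHom_rel LR (HeckeRel.one (Φ := Φ) (d := d))).trans (map_one _)

theorem H_mul (w x : Weyl Φ d) (h : len (w * x) = len w + len x) : H w * H x = H (w * x) :=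
  (map_mul (RingQuot.mkAlgHom LR (HeckeRel Φ d)) _ _).symm.trans
    (RingQuot.mkAlgHom_rel LR (HeckeRel.mul w x h))

theorem H_quad (i : Idx Φ d) :
    H (simple i) * H (simple i) = (qInv - q) • H (simple i) + 1 := by
  have h1 := (map_mul (RingQuot.mkAlgHom LR (HeckeRel Φ d)) _ _).symm.trans
    (RingQuot.mkAlgHom_rel LR (HeckeRel.quad i))
  rw [map_add, map_smul] at h1
  rw [← H_one]
  exact h1

theorem H_simple_mul (i : Idx Φ d) : H (simple i) * (H (simple i) + (q - qInv) • 1) = 1 := by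
  rw [mul_add, H_quad, mul_smul_comm, mul_one, ← neg_sub q qInv, neg_smul]
  abel

theorem H_mul_simple (i : Idx Φ d) : (H (simple i) + (q - qInv) • 1) * H (simple i) = 1 := by
  rw [add_mul, H_quad, smul_mul_assoc, one_mul, ← neg_sub q qInv, neg_smul]
  abel

theorem isUnit_H_simple (i : Idx Φ d) : IsUnit (H (simple i)) :=
  ⟨⟨_, _, H_simple_mul i, H_mul_simple i⟩, rfl⟩

theorem isUnit_H (w : Weyl Φ d) : IsUnit (H w) := by
  obtain ⟨l, hl, hw⟩ := exists_reduced_word w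
  induction l generalizing w with
  | nil =>
    simp only [List.map_nil, List.prod_nil] at hw
    rw [← hw, H_one]
    exact isUnit_one
  | cons i l ih =>
    simp only [List.map_cons, List.prod_cons, List.length_cons] at hw hl
    have hlen : len (l.map simple).prod = l.length := by
      refine le_antisymm (len_prod_le l) ?_
      obtain ⟨l', hl', hw'⟩ := exists_reduced_word (l.map simple).prod
      have := len_prod_le (i :: l')
      simp only [List.map_cons, List.prod_cons, List.length_cons, hw', hw] at this
      omega
    have h1 : len (simple i) ≤ 1 := by simpa using len_prod_le [i]
    have hle : len (simple i) = 1 := by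
      refine le_antisymm h1 ?_
      by_contra h0
      obtain ⟨l', hl', hw'⟩ := exists_reduced_word (simple i)
      have hnil : l' = [] := List.length_eq_zero_iff.1 (by omega)
      rw [hnil] at hw'
      simp only [List.map_nil, List.prod_nil] at hw'
      rw [← hw', one_mul] at hw
      rw [hw] at hlen
      omega
    rw [← hw, ← H_mul _ _ (by rw [hw, hlen, hle]; omega)]
    exact (isUnit_H_simple i).mul (ih _ hlen.symm rfl)

/-- The involution `q ↦ q⁻¹` of `ℂ[q, q⁻¹]`. -/
def barLR : LR →+* LR := (LaurentPolynomial.invert (R := ℂ)).toAlgHom.toRingHom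

theorem barLR_q : barLR q = qInv := LaurentPolynomial.invert_T 1

theorem barLR_qInv : barLR qInv = q := (LaurentPolynomial.invert_T (-1)).trans (by simp [q])

/-- The Hecke algebra with scalars acting through `q ↦ q⁻¹`. -/
abbrev barAlgebra (Φ : CType) (d : ℕ) : Algebra LR (Hecke Φ d) :=
  Algebra.compHom (Hecke Φ d) barLR

/-- The `q ↦ q⁻¹` semilinear ring homomorphism from the free algebra
with `w ↦ (H_{w⁻¹})⁻¹`. -/
def barFree (Φ : CType) (d : ℕ) : FreeAlgebra LR (Weyl Φ d) →+* Hecke Φ d :=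
  letI := barAlgebra Φ d
  (FreeAlgebra.lift LR fun w : Weyl Φ d => Ring.inverse (H w⁻¹)).toRingHom

theorem barFree_ι (w : Weyl Φ d) : barFree Φ d (FreeAlgebra.ι LR w) = Ring.inverse (H w⁻¹) :=
  letI := barAlgebra Φ d
  FreeAlgebra.lift_ι_apply (R := LR) (fun w : Weyl Φ d => Ring.inverse (H w⁻¹)) w

theorem barFree_algebraMap (r : LR) :
    barFree Φ d (algebraMap LR _ r) = algebraMap LR (Hecke Φ d) (barLR r) :=
  letI := barAlgebra Φ d
  (FreeAlgebra.lift LR fun w : Weyl Φ d => Ring.inverse (H w⁻¹)).commutes r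

theorem ringInverse_H_simple (i : Idx Φ d) :
    Ring.inverse (H (simple i)) = H (simple i) + (q - qInv) • 1 := by
  have : IsUnit (H (simple i)) := isUnit_H_simple i
  exact this.mul_left_cancel (by rw [Ring.mul_inverse_cancel _ this, H_simple_mul])

theorem barFree_rel {a b : FreeAlgebra LR (Weyl Φ d)} (h : HeckeRel Φ d a b) :
    barFree Φ d a = barFree Φ d b := by
  cases h with
  | one => rw [barFree_ι, inv_one, H_one, Ring.inverse_one, map_one]
  | mul w x h =>
    rw [map_mul, barFree_ι, barFree_ι, barFree_ι, mul_inv_rev, ← H_mul]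
    · obtain ⟨u, hu⟩ := isUnit_H w⁻¹
      obtain ⟨v, hv⟩ := isUnit_H x⁻¹
      rw [← hu, ← hv, ← Units.val_mul, Ring.inverse_unit, Ring.inverse_unit, Ring.inverse_unit,
        mul_inv_rev, Units.val_mul]
    · rw [← mul_inv_rev, len_inv, len_inv, len_inv, h, add_comm]
  | quad i =>
    rw [map_mul, map_add, Algebra.smul_def, map_mul, barFree_algebraMap, barFree_ι, barFree_ι,
      inv_one, H_one, Ring.inverse_one, simple_inv, ringInverse_H_simple, map_sub, barLR_q,
      barLR_qInv, ← Algebra.smul_def]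
    rw [mul_add (H (simple i) + (q - qInv) • 1), H_mul_simple, mul_smul_comm, mul_one, add_comm]

/-- The bar involution of the Hecke algebra: the ring homomorphism with `q ↦ q⁻¹` and
`H_w ↦ (H_{w⁻¹})⁻¹`. -/
def bar (Φ : CType) (d : ℕ) : Hecke Φ d →+* Hecke Φ d :=
  RingQuot.lift ⟨barFree Φ d, fun _ _ h => barFree_rel h⟩

theorem bar_H (w : Weyl Φ d) : bar Φ d (H w) = Ring.inverse (H w⁻¹) := by
  have : H w = RingQuot.mkRingHom (HeckeRel Φ d) (FreeAlgebra.ι LR w) := by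
    rw [← RingQuot.mkAlgHom_coe LR]
    rfl
  rw [← barFree_ι, this, bar]
  exact RingQuot.lift_mkRingHom_apply _ _ _

theorem bar_algebraMap (r : LR) :
    bar Φ d (algebraMap LR _ r) = algebraMap LR (Hecke Φ d) (barLR r) := by
  rw [← barFree_algebraMap]
  have : algebraMap LR (Hecke Φ d) r =
      RingQuot.mkRingHom (HeckeRel Φ d) (algebraMap LR _ r) := by
    rw [← RingQuot.mkAlgHom_coe LR]
    exact ((RingQuot.mkAlgHom LR (HeckeRel Φ d)).commutes r).symm
  rw [this, bar]
  exact RingQuot.lift_mkRingHom_apply _ _ _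

/-! ### The induced trivial module and its Kazhdan–Lusztig basis -/

/-- The right ideal of the Hecke algebra generated by `H_j - q⁻¹`, `j ∈ J`. -/
def trivialIdeal (J : Set (Idx Φ d)) : Submodule (Hecke Φ d)ᵐᵒᵖ (Hecke Φ d) :=
  Submodule.span _ {h | ∃ j ∈ J, h = H (simple j) - qInv • 1}

/-- The induced trivial module `M^J = ℂ[q,q⁻¹] ⊗_{H_J} H`, a right module over the Hecke algebra
`H`. Here `ℂ[q,q⁻¹]` is the right `H_J`-module on which each `H_j` acts as `q⁻¹`; it is the quotient
of `H_J` by the right ideal generated by the `H_j - q⁻¹`, so that `M^J` is the quotient of `H` by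
the right ideal generated by the `H_j - q⁻¹`. -/
abbrev Ind (J : Set (Idx Φ d)) : Type := Hecke Φ d ⧸ trivialIdeal J

/-- `M_w = 1 ⊗ H_w`, the class of `H_w`. For `w` a shortest coset representative this is a
standard basis element. -/
def stdElt (J : Set (Idx Φ d)) (w : Weyl Φ d) : Ind J := Submodule.Quotient.mk (H w)

/-- The bar involution of the Hecke algebra as a semilinear map of right modules. -/
def barSemilinear (Φ : CType) (d : ℕ) : Hecke Φ d →ₛₗ[RingHom.op (bar Φ d)] Hecke Φ d where
  toFun := bar Φ d
  map_add' := map_add _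
  map_smul' r h := by
    change bar Φ d (h * r.unop) = bar Φ d h * bar Φ d r.unop
    exact map_mul _ _ _

theorem trivialIdeal_le_comap (J : Set (Idx Φ d)) :
    trivialIdeal J ≤ (trivialIdeal J).comap (barSemilinear Φ d) := by
  refine Submodule.span_le.2 ?_
  rintro _ ⟨j, hj, rfl⟩
  refine Submodule.subset_span ⟨j, hj, ?_⟩
  change bar Φ d (H (simple j) - qInv • 1) = _
  rw [map_sub, bar_H, simple_inv, ringInverse_H_simple, Algebra.smul_def qInv, mul_one,
    bar_algebraMap, barLR_qInv, sub_smul, Algebra.smul_def, Algebra.smul_def, mul_one, mul_one]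
  abel

/-- The bar involution of the induced trivial module, `1 ⊗ h ↦ 1 ⊗ bar h`. -/
def barInd (J : Set (Idx Φ d)) : Ind J →ₛₗ[RingHom.op (bar Φ d)] Ind J :=
  Submodule.mapQ _ _ (barSemilinear Φ d) (trivialIdeal_le_comap J)

/-- `m` is the parabolic Kazhdan–Lusztig basis of `M^J` normalised by `v`, where `v` is `q` or
`q⁻¹`: every `m w` is bar invariant and lies in `M_w + ∑_x v ℤ[v] M_x`. -/
def IsKLBasis (J : Set (Idx Φ d)) (v : LR) (m : minReps J → Ind J) : Prop :=
  ∀ w, barInd J (m w) = m w ∧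
    ∃ p : minReps J → ℤ[X],
      m w = stdElt J w + ∑ x, Polynomial.aeval v (Polynomial.X * p x) • stdElt J (x : Weyl Φ d)

end

/-! ### Compositions, Young diagrams and tableaux -/

/-- The (signed) compositions of classical type. `parts` lists `λ_1, …, λ_r`.
Type `A`: `λ = (λ_1, …, λ_r)` with sum `d`.
Type `B`, odd number of parts: `λ = (λ_r, …, λ_1, λ_0, λ_1, …, λ_r)` with `λ_0 = 2 m + 1` and total
sum `2 d + 1`. Type `B`, even number of parts: the same with `λ_0 = 1`, where `λ_0` is not
counted as a part. -/
inductive Shape (d : ℕ) : CType → Type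
  | a (parts : List ℕ) (pos : ∀ p ∈ parts, 0 < p) (sum : parts.sum = d) : Shape d CType.A
  | bOdd (m : ℕ) (parts : List ℕ) (pos : ∀ p ∈ parts, 0 < p) (sum : m + parts.sum = d) :
      Shape d CType.B
  | bEven (parts : List ℕ) (pos : ∀ p ∈ parts, 0 < p) (sum : parts.sum = d) : Shape d CType.B

/-- The boxes `(i, j)` with `1 ≤ i` and `c ≤ j < c + λ_i`. -/
def rowsFrom (c : ℤ) (parts : List ℕ) : Set (ℤ × ℤ) :=
  {b | ∃ (k : ℕ) (hk : k < parts.length), b.1 = (k : ℤ) + 1 ∧ c ≤ b.2 ∧ b.2 < c + (parts[k] : ℤ)}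

/-- The Young diagram `[λ]`, in matrix coordinates (row, column): row `i + 1` is drawn below
row `i`, column `j + 1` to the right of column `j`. In type `B` it is invariant under `b ↦ -b`. -/
def diagram {d : ℕ} : {Φ : CType} → Shape d Φ → Set (ℤ × ℤ)
  | _, Shape.a parts _ _ => rowsFrom 1 parts
  | _, Shape.bOdd m parts _ _ =>
      {b | b.1 = 0 ∧ |b.2| ≤ (m : ℤ)} ∪ {b | b ∈ rowsFrom 0 parts ∨ -b ∈ rowsFrom 0 parts}
  | _, Shape.bEven parts _ _ => {b | b ∈ rowsFrom 1 parts ∨ -b ∈ rowsFrom 1 parts}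

/-- The letters of a tableau: `[d]` in type `A`, `[±d]` or `[±d] \ {0}` in type `B`. -/
def letters {d : ℕ} : {Φ : CType} → Shape d Φ → Set ℤ
  | _, Shape.a _ _ _ => Set.Icc 1 d
  | _, Shape.bOdd _ _ _ _ => Set.Icc (-d) d
  | _, Shape.bEven _ _ _ => Set.Icc (-d) d \ {0}

/-- The set `J` of simple reflections belonging to `λ`. When the rows of the diagram are read from
bottom to top, their lengths are `λ_r, …, λ_1` in type `A` and `λ_r, …, λ_1, λ_0, λ_1, …, λ_r` in
type `B`, and `W_J` is the subgroup of those permutations of the positions which preserve the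
rows. -/
def shapeJ {d : ℕ} : {Φ : CType} → Shape d Φ → Set (Idx Φ d)
  | _, Shape.a parts _ _ => {i | ∀ k, (i : ℕ) ≠ (parts.reverse.take k).sum}
  | _, Shape.bOdd m parts _ _ => {i | ∀ k, (i : ℕ) ≠ m + (parts.take k).sum}
  | _, Shape.bEven parts _ _ => {i | ∀ k, (i : ℕ) ≠ (parts.take k).sum}

/-- A `λ`-tableau: a bijection from the boxes to the letters, centro-symmetric in type `B`. -/
structure Tableau {d : ℕ} {Φ : CType} (lam : Shape d Φ) where
  /-- the entry in a box -/
  entry : diagram lam → ℤ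
  injective : Function.Injective entry
  range_eq : Set.range entry = letters lam
  symmetric : Φ = CType.B → ∀ b b' : diagram lam, (b' : ℤ × ℤ) = -(b : ℤ × ℤ) →
    entry b' = -entry b

section

variable {Φ : CType} {d : ℕ} {lam : Shape d Φ}

theorem apply_mem_letters (w : Weyl Φ d) {x : ℤ} (hx : x ∈ letters lam) :
    (w : Equiv.Perm ℤ) x ∈ letters lam := by
  cases lam with
  | a parts pos sum =>
    obtain ⟨h1, h2⟩ := hx
    exact ⟨w.2.2.2 rfl x h1 h2, (abs_le.1 (Weyl.abs_le w (abs_le.2 ⟨by omega, h2⟩))).2⟩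
  | bOdd m parts pos sum => exact abs_le.1 (Weyl.abs_le w (abs_le.2 hx))
  | bEven parts pos sum =>
    refine ⟨abs_le.1 (Weyl.abs_le w (abs_le.2 hx.1)), fun h => hx.2 ?_⟩
    exact (w : Equiv.Perm ℤ).injective (h.trans (Weyl.apply_zero w).symm)

/-- The right action of `W` on tableaux by permuting the letters, `(T · w)(b) = w⁻¹ (T b)`. -/
def Tableau.act (T : Tableau lam) (w : Weyl Φ d) : Tableau lam where
  entry b := (w⁻¹ : Weyl Φ d).1 (T.entry b)
  injective := (w⁻¹ : Weyl Φ d).1.injective.comp T.injective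
  range_eq := by
    ext x
    constructor
    · rintro ⟨b, rfl⟩
      exact apply_mem_letters _ (T.range_eq ▸ Set.mem_range_self b)
    · intro hx
      have h : (w : Equiv.Perm ℤ) x ∈ Set.range T.entry := T.range_eq ▸ apply_mem_letters w hx
      obtain ⟨b, hb⟩ := h
      refine ⟨b, ?_⟩
      simp only [hb]
      exact (w : Equiv.Perm ℤ).symm_apply_apply x
  symmetric hΦ b b' h := by rw [T.symmetric hΦ b b' h, Weyl.apply_neg]

/-- The entries of every row increase from left to right. -/
def Tableau.IsRowStd (T : Tableau lam) : Prop :=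
  ∀ b b' : diagram lam, b.1.1 = b'.1.1 → b.1.2 < b'.1.2 → T.entry b < T.entry b'

/-- The entries of every row increase from left to right, those of every column from top to
bottom. -/
def Tableau.IsStd (T : Tableau lam) : Prop :=
  T.IsRowStd ∧
    ∀ b b' : diagram lam, b.1.2 = b'.1.2 → b.1.1 < b'.1.1 → T.entry b < T.entry b'

/-- The order in which the boxes are read: rows from bottom to top, each row from left to
right. -/
def ReadBefore (b b' : ℤ × ℤ) : Prop := b'.1 < b.1 ∨ (b.1 = b'.1 ∧ b.2 < b'.2)

theorem letters_symm (hΦ : Φ = CType.B) (x : ℤ) (hx : x ∈ letters lam) : -x ∈ letters lam := by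
  cases lam with
  | a parts pos sum => cases hΦ
  | bOdd m parts pos sum =>
    obtain ⟨h1, h2⟩ := hx
    exact ⟨by omega, by omega⟩
  | bEven parts pos sum =>
    obtain ⟨⟨h1, h2⟩, h3⟩ := hx
    exact ⟨⟨by omega, by omega⟩, fun h => h3 (neg_eq_zero.1 h)⟩

theorem letters_abs_le (x : ℤ) (hx : x ∈ letters lam) : |x| ≤ d := by
  cases lam with
  | a parts pos sum =>
    obtain ⟨h1, h2⟩ := hx
    exact abs_le.2 ⟨by omega, by omega⟩
  | bOdd m parts pos sum => exact abs_le.2 hx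
  | bEven parts pos sum => exact abs_le.2 hx.1

theorem letters_pos (hΦ : Φ = CType.A) (x : ℤ) : x ∈ letters lam ↔ 1 ≤ x ∧ x ≤ d := by
  cases lam with
  | a parts pos sum => exact Iff.rfl
  | bOdd m parts pos sum => cases hΦ
  | bEven parts pos sum => cases hΦ

theorem diagram_symm (hΦ : Φ = CType.B) (b : ℤ × ℤ) (hb : b ∈ diagram lam) :
    -b ∈ diagram lam := by
  cases lam with
  | a parts pos sum => cases hΦ
  | bOdd m parts pos sum =>
    rcases hb with ⟨h1, h2⟩ | h
    · exact Or.inl ⟨by simp [h1], by simpa using h2⟩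
    · exact Or.inr (h.symm.imp id fun h => by simpa using h)
  | bEven parts pos sum => exact (Or.symm hb).imp id fun h => by simpa using h

/-- A permutation of the letters, odd in type `B`, extends to an element of `W`. -/
theorem exists_weyl (g : Equiv.Perm (letters lam))
    (hg : Φ = CType.B → ∀ x y : letters lam, (y : ℤ) = -x → (g y : ℤ) = -(g x : ℤ)) :
    ∃ w : Weyl Φ d, ∀ x : letters lam, (w : Equiv.Perm ℤ) x = g x := by
  classical
  let F : Equiv.Perm (letters lam) → ℤ → ℤ := fun g x =>
    if h : x ∈ letters lam then g ⟨x, h⟩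
    else if h : -x ∈ letters lam then -(g ⟨-x, h⟩ : ℤ) else x
  have hF1 : ∀ (g : Equiv.Perm (letters lam)) (x : letters lam), F g x = g x := fun g x => by
    simp [F]
  have hAB : Φ = CType.A ∨ Φ = CType.B := by cases Φ <;> simp
  have hcanc : ∀ (g : Equiv.Perm (letters lam)) (x : ℤ), F g⁻¹ (F g x) = x := by
    intro g x
    by_cases h : x ∈ letters lam
    · have e := hF1 g ⟨x, h⟩
      simp only at e
      rw [e, hF1]
      exact congrArg Subtype.val (g.symm_apply_apply _)
    · by_cases h' : -x ∈ letters lam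
      · have e : F g x = -(g ⟨-x, h'⟩ : ℤ) := by simp [F, h, h']
        have hA : Φ = CType.A := hAB.resolve_right fun hB => h (by
          simpa using letters_symm hB _ h')
        have hn : -(g ⟨-x, h'⟩ : ℤ) ∉ letters lam := fun hm => by
          have a1 := (letters_pos hA _).1 hm
          have a2 := (letters_pos hA _).1 (g ⟨-x, h'⟩).2
          omega
        rw [e]
        simp only [F, hn, dif_neg, not_false_eq_true, neg_neg, Subtype.coe_prop, dif_pos,
          Subtype.coe_eta]
        have := congrArg Subtype.val (g.symm_apply_apply ⟨-x, h'⟩)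
        change -((g.symm (g ⟨-x, h'⟩) : letters lam) : ℤ) = x
        rw [this, neg_neg]
      · simp [F, h, h']
  let w : Equiv.Perm ℤ := ⟨F g, F g⁻¹, hcanc g, fun x => by simpa using hcanc g⁻¹ x⟩
  refine ⟨⟨w, fun x => ?_, fun x hx => ?_, fun hA k h1 h2 => ?_⟩, hF1 g⟩
  · change F g (-x) = -F g x
    by_cases h : x ∈ letters lam
    · by_cases h' : -x ∈ letters lam
      · have hB : Φ = CType.B := hAB.resolve_left fun hA => by
          have a1 := (letters_pos hA _).1 h
          have a2 := (letters_pos hA _).1 h'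
          omega
        have := hg hB ⟨x, h⟩ ⟨-x, h'⟩ rfl
        simp [F, h, h', this]
      · simp [F, h, h']
    · by_cases h' : -x ∈ letters lam
      · simp [F, h, h']
      · simp [F, h, h']
  · change F g x = x
    have h : x ∉ letters lam := fun h => absurd (letters_abs_le x h) (not_le.2 hx)
    have h' : -x ∉ letters lam := fun h => by
      have := letters_abs_le _ h
      rw [abs_neg] at this
      omega
    simp [F, h, h']
  · change 0 < F g k
    have hk := (letters_pos (lam := lam) hA k).2 ⟨h1, h2⟩
    have e := hF1 g ⟨k, hk⟩
    simp only at e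
    rw [e]
    exact ((letters_pos hA _).1 (g ⟨k, hk⟩).2).1

theorem exists_reading_aux (T : Tableau lam) {D : Type} [LinearOrder D] (r : D ≃ diagram lam)
    (hlt : ∀ b b' : D, b < b' ↔ ReadBefore (r b) (r b')) :
    ∃ w : Weyl Φ d, ∀ b b' : diagram lam, ReadBefore b b' →
      (w : Equiv.Perm ℤ) (T.entry b) < (w : Equiv.Perm ℤ) (T.entry b') := by
  classical
  let E : D ≃ letters lam :=
    r.trans ((Equiv.ofInjective T.entry T.injective).trans (Equiv.setCongr T.range_eq))
  have hE : ∀ b, (E b : ℤ) = T.entry (r b) := fun b => rfl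
  have hfin : (letters lam).Finite :=
    (Set.finite_Icc (-(d : ℤ)) d).subset fun x hx => abs_le.1 (letters_abs_le x hx)
  let _ : Fintype (letters lam) := hfin.fintype
  let _ : Fintype D := Fintype.ofEquiv _ E.symm
  let e : D ≃o letters lam :=
    (Fintype.orderIsoFinOfCardEq _ (Fintype.card_congr E)).symm.trans
      (Fintype.orderIsoFinOfCardEq _ rfl)
  have hsymm : Φ = CType.B → ∀ b b' : D, (r b' : ℤ × ℤ) = -r b → (e b' : ℤ) = -(e b : ℤ) := by
    intro hB
    let nD : D → D := fun b => r.symm ⟨-r b, diagram_symm hB _ (r b).2⟩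
    let nL : letters lam → letters lam := fun x => ⟨-x, letters_symm hB _ x.2⟩
    have nDr : ∀ b, (r (nD b) : ℤ × ℤ) = -r b := fun b => by simp [nD]
    have nD2 : ∀ b, nD (nD b) = b := fun b => r.injective (Subtype.ext (by simp [nDr]))
    have nL2 : ∀ b, nL (nL b) = b := fun b => Subtype.ext (neg_neg _)
    have nDlt : ∀ b b', nD b < nD b' ↔ b' < b := fun b b' => by
      rw [hlt, hlt]
      simp only [ReadBefore, nDr, Prod.fst_neg, Prod.snd_neg]
      omega
    have nLlt : ∀ b b', nL b < nL b' ↔ b' < b := fun b b' => by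
      rw [← Subtype.coe_lt_coe, ← Subtype.coe_lt_coe]
      simp [nL]
    let φ : D ≃ letters lam :=
      ⟨fun b => nL (e (nD b)), fun x => nD (e.symm (nL x)), fun b => by simp [nL2, nD2],
        fun x => by simp [nL2, nD2]⟩
    have hφ : StrictMono φ := fun b b' h => by
      change nL _ < nL _
      rw [nLlt, e.lt_iff_lt, nDlt]
      exact h
    let e' : D ≃o letters lam := hφ.orderIsoOfSurjective φ φ.surjective
    have hee : e' = e := Subsingleton.elim _ _
    intro b b' hb
    have h1 : b' = nD b := r.injective (Subtype.ext (by rw [hb, nDr]))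
    have h2 : e b = nL (e (nD b)) := by
      conv_lhs => rw [← hee]
      rfl
    rw [h1, h2]
    simp [nL]
  obtain ⟨w, hw⟩ := exists_weyl (lam := lam) (E.symm.trans e.toEquiv) (by
    intro hB x y hxy
    refine hsymm hB _ _ ?_
    have hx : T.entry (r (E.symm x)) = x := by rw [← hE]; simp
    have h1 := T.symmetric hB (r (E.symm x))
      ⟨-(r (E.symm x) : ℤ × ℤ), diagram_symm hB _ (r (E.symm x)).2⟩ rfl
    have h2 : E.symm y = r.symm ⟨-(r (E.symm x) : ℤ × ℤ), diagram_symm hB _ (r (E.symm x)).2⟩ := by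
      rw [Equiv.symm_apply_eq]
      refine Subtype.ext ?_
      rw [hE, Equiv.apply_symm_apply, h1, hx, hxy]
    rw [h2, Equiv.apply_symm_apply])
  refine ⟨w, fun b b' h => ?_⟩
  have h1 : ∀ b, (w : Equiv.Perm ℤ) (T.entry (r b)) = e b := fun b => by
    rw [← hE, hw]
    simp
  rw [← r.apply_symm_apply b, ← r.apply_symm_apply b', ← hlt] at h
  rw [← r.apply_symm_apply b, ← r.apply_symm_apply b', h1, h1, Subtype.coe_lt_coe, e.lt_iff_lt]
  exact h

theorem exists_reading (T : Tableau lam) :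
    ∃ w : Weyl Φ d, ∀ b b' : diagram lam, ReadBefore b b' →
      (w : Equiv.Perm ℤ) (T.entry b) < (w : Equiv.Perm ℤ) (T.entry b') :=
  exists_reading_aux T
    (D := {x : ℤᵒᵈ ×ₗ ℤ // (OrderDual.ofDual (ofLex x).1, (ofLex x).2) ∈ diagram lam})
    ⟨fun x => ⟨_, x.2⟩, fun b => ⟨toLex (OrderDual.toDual b.1.1, b.1.2), b.2⟩,
      fun _ => rfl, fun _ => rfl⟩
    (fun x y => by
      rw [← Subtype.coe_lt_coe, Prod.Lex.lt_iff]
      rfl)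

/-- The element `w_T` given by row reading: `w_T (T b)` is the position of the box `b` when the
diagram is read row by row, rows from bottom to top and each row from left to right (positions being
numbered in increasing order by the letters). So `w_T⁻¹` lists the entries of `T` in reading order,
and `w_T` takes the tableau `T₀` with entries in reading order to `T`, that is, `T₀ · w_T = T`. -/
def Tableau.word (T : Tableau lam) : Weyl Φ d := (exists_reading T).choose

/-! ### Tabloids and Specht vectors -/

/-- Two tableaux are row equivalent if corresponding rows contain the same letters. -/
instance rowSetoid (lam : Shape d Φ) : Setoid (Tableau lam) where
  r T T' := ∀ b b' : diagram lam, T.entry b = T'.entry b' → b.1.1 = b'.1.1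
  iseqv := {
    refl := fun T b b' h => by rw [T.injective h]
    symm := fun h b b' e => (h b' b e.symm).symm
    trans := fun {T T' T''} h h' b b' e => by
      have hb : T.entry b ∈ Set.range T'.entry := by
        rw [T'.range_eq, ← T.range_eq]
        exact Set.mem_range_self b
      obtain ⟨c, hc⟩ := hb
      exact (h b c hc.symm).trans (h' c b' (hc.trans e)) }

/-- Tabloids: row equivalence classes `{T}` of tableaux. -/
abbrev Tabloid (lam : Shape d Φ) : Type := Quotient (rowSetoid lam)

/-- `col(T)`: the elements of `W` that permute the letters within each column of `T`. -/
def Tableau.col (T : Tableau lam) : Set (Weyl Φ d) :=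
  {w | ∀ b : diagram lam, ∃ b' : diagram lam, b'.1.2 = b.1.2 ∧
    (w : Equiv.Perm ℤ) (T.entry b) = T.entry b'}

open Classical in
/-- The Specht vector `v_T = ∑_{w ∈ col(T)} (-1)^{ℓ(w)} {T · w}`. -/
def Tableau.specht (T : Tableau lam) : Tabloid lam →₀ ℂ :=
  ∑ w : Weyl Φ d, if w ∈ T.col then Finsupp.single ⟦T.act w⟧ ((-1) ^ len w) else 0

/-- The embedding of the span of the tabloids into `M^J` that sends the tabloid `{R}`, `R` row
standard, to the standard basis element `M_{w_R}`. Every tabloid contains exactly one row standard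
tableau. -/
def embed (f : Tabloid lam →₀ ℂ) : Ind (shapeJ lam) :=
  ∑ᶠ R : {R : Tableau lam // R.IsRowStd},
    (LaurentPolynomial.C (f ⟦R.1⟧) : LR) • stdElt (shapeJ lam) R.1.word

/-! ### Unitriangularity -/

/-- The matrix `(a x T)`, `x` a shortest coset representative and `T` a standard tableau, is
upper unitriangular with respect to all total orders on the shortest coset representatives and on
the row standard tableaux that extend the Bruhat order, and `a x T = 0` unless `x ≤ w_T` in the
Bruhat order. -/
def IsUpperUnitriangular {S : Type} [Zero S] [One S] (lam : Shape d Φ)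
    (a : minReps (shapeJ lam) → {T : Tableau lam // T.IsStd} → S) : Prop :=
  ∃ hD : ∀ R : Tableau lam, R.IsRowStd → R.word ∈ minReps (shapeJ lam),
    (∀ (leD : minReps (shapeJ lam) → minReps (shapeJ lam) → Prop)
      (leR : {R : Tableau lam // R.IsRowStd} → {R : Tableau lam // R.IsRowStd} → Prop),
      IsLinearOrder _ leD → IsLinearOrder _ leR →
      (∀ x y, BruhatLE x.1 y.1 → leD x y) →
      (∀ R T, BruhatLE R.1.word T.1.word → leR R T) →
      (∀ T, a ⟨T.1.word, hD _ T.2.1⟩ T = 1) ∧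
      (∀ x T, ¬ leD x ⟨T.1.word, hD _ T.2.1⟩ → a x T = 0) ∧
      (∀ R T, ¬ leR R ⟨T.1, T.2.1⟩ → a ⟨R.1.word, hD _ R.2⟩ T = 0)) ∧
    (∀ T, a ⟨T.1.word, hD _ T.2.1⟩ T = 1) ∧
    (∀ x T, ¬ BruhatLE x.1 T.1.word → a x T = 0)

end

/-- The specialisation `q = 1`, making `ℂ` an algebra over `ℂ[q, q⁻¹]`. -/
abbrev specOne : Algebra LR ℂ := (LaurentPolynomial.eval₂ (RingHom.id ℂ) 1).toAlgebra

end ParabolicKL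

end

/-!
The argument has an algebraic half, about the Weyl group and its Hecke algebra, and a combinatorial
half, about tableaux.

*Weyl group.* A reflection `t` exchanges letters `a < t a`, and `w` is said to invert `t` if it
reverses the order of these two letters. Inversions satisfy a cocycle rule for products
(`inverts_mul_iff_of_not`, `inverts_mul_iff_of_inverts`), a simple reflection inverts only itself,
and so one obtains the strong exchange property, `ℓ(w t) < ℓ(w)` if and only if `w` inverts `t`
(`len_mul_lt_iff`), the lifting property of the Bruhat order and the factorisation `W = W_J · D_J`.

*Hecke algebra.* The operators of left and right multiplication by the generators on the free module
with basis `W` commute, so the regular representation is well defined and the `H_w` are linearly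
independent. Multiplication by `∑_{u ∈ W_J} q^{-ℓ(u)} H_u` embeds `M^J` into the Hecke algebra, so
the `M_w`, `w ∈ D_J`, form a basis (`stdBasis`). The bar involution is unitriangular on it for the
Bruhat order, with coefficients in `ℤ[q, q⁻¹]` (`barInd_stdElt_sub_mem`), and the usual recursion gives a
unique Kazhdan–Lusztig basis, unitriangular with respect to the standard basis (`exists_isKLBasis`).

*Tableaux.* It remains to see that `v_T = M_{w_T} + ` (a combination of `M_x` with `x < w_T`) for
`T` standard. One has `w_{T · w} = w_T w` for every `w`. If `T` is standard, a reflection exchanging two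
entries of one column of `T` is inverted by `w_T`, whence `w_T w ≤ w_T` for `w ∈ col(T)`
(`Tableau.IsStd.word_mul_bruhatLE`); exchanging two entries of a row that are in the wrong order
decreases the word, whence `w_R ≤ w_T w` for the row standard tableau `R` in the tabloid of `T · w`
(`Tableau.IsRowStd.word_bruhatLE`). If `R = T` both inequalities are equalities and `w = 1`.

The specialisation `q = 1` maps the coefficients `0` and `1` to `0` and `1`.
-/

open scoped LaurentPolynomial Polynomial TensorProduct

noncomputable section

namespace ParabolicKL

section Coxeter

variable {Φ : CType} {d : ℕ}

/-! ### Reflections and inversions -/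

theorem Weyl.ext_apply {v w : Weyl Φ d} (h : ∀ k, (v : Equiv.Perm ℤ) k = (w : Equiv.Perm ℤ) k) :
    v = w := Subtype.ext (Equiv.ext h)

theorem Weyl.mul_apply (v w : Weyl Φ d) (k : ℤ) :
    ((v * w : Weyl Φ d) : Equiv.Perm ℤ) k = (v : Equiv.Perm ℤ) ((w : Equiv.Perm ℤ) k) := rfl

theorem Weyl.apply_inv_self (w : Weyl Φ d) (k : ℤ) :
    (w : Equiv.Perm ℤ) ((w⁻¹ : Weyl Φ d).1 k) = k := (w : Equiv.Perm ℤ).apply_symm_apply k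

theorem Weyl.inv_apply_self (w : Weyl Φ d) (k : ℤ) :
    (w⁻¹ : Weyl Φ d).1 ((w : Equiv.Perm ℤ) k) = k := (w : Equiv.Perm ℤ).symm_apply_apply k

theorem simple_apply (i : Idx Φ d) (k : ℤ) :
    (simple i : Equiv.Perm ℤ) k = simplePerm i k := rfl

theorem IsReflection.mul_self {t : Weyl Φ d} (ht : IsReflection t) : t * t = 1 := by
  obtain ⟨w, i, rfl⟩ := ht
  have := simple_mul_self i
  calc w * simple i * w⁻¹ * (w * simple i * w⁻¹) = w * (simple i * simple i) * w⁻¹ := by group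
    _ = 1 := by rw [this]; group

theorem IsReflection.inv_eq {t : Weyl Φ d} (ht : IsReflection t) : t⁻¹ = t :=
  inv_eq_of_mul_eq_one_right ht.mul_self

theorem IsReflection.apply_apply {t : Weyl Φ d} (ht : IsReflection t) (k : ℤ) :
    (t : Equiv.Perm ℤ) ((t : Equiv.Perm ℤ) k) = k := by
  rw [← Weyl.mul_apply, ht.mul_self]; rfl

theorem IsReflection.conj {t : Weyl Φ d} (ht : IsReflection t) (w : Weyl Φ d) :
    IsReflection (w * t * w⁻¹) := by
  obtain ⟨v, i, rfl⟩ := ht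
  exact ⟨w * v, i, by group⟩

theorem IsReflection.conj' {t : Weyl Φ d} (ht : IsReflection t) (w : Weyl Φ d) :
    IsReflection (w⁻¹ * t * w) := by
  simpa using ht.conj w⁻¹

theorem isReflection_simple (i : Idx Φ d) : IsReflection (simple i) := ⟨1, i, by simp⟩

/-- A reflection moves at most the four letters `±a`, `±t a`. -/
theorem IsReflection.moved {t : Weyl Φ d} (ht : IsReflection t) {a b : ℤ}
    (ha : (t : Equiv.Perm ℤ) a ≠ a) (hb : (t : Equiv.Perm ℤ) b ≠ b) :
    b = a ∨ b = (t : Equiv.Perm ℤ) a ∨ b = -a ∨ b = -(t : Equiv.Perm ℤ) a := by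
  obtain ⟨w, i, rfl⟩ := ht
  simp only [Weyl.mul_apply, simple_apply] at ha hb ⊢
  obtain ⟨a, rfl⟩ := (w : Equiv.Perm ℤ).surjective a
  obtain ⟨b, rfl⟩ := (w : Equiv.Perm ℤ).surjective b
  simp only [Weyl.inv_apply_self, ← Weyl.apply_neg, (w : Equiv.Perm ℤ).injective.eq_iff,
    (w : Equiv.Perm ℤ).injective.ne_iff] at ha hb ⊢
  simp only [simplePerm_apply] at ha hb ⊢
  split_ifs at * <;> omega

theorem IsReflection.eq_of_apply_eq {t t' : Weyl Φ d} (ht : IsReflection t)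
    (ht' : IsReflection t') {a : ℤ} (ha : (t : Equiv.Perm ℤ) a ≠ a)
    (h : (t : Equiv.Perm ℤ) a = (t' : Equiv.Perm ℤ) a) : t = t' := by
  have ha' : (t' : Equiv.Perm ℤ) a ≠ a := h ▸ ha
  have key : ∀ b, b = a ∨ b = (t : Equiv.Perm ℤ) a ∨ b = -a ∨ b = -(t : Equiv.Perm ℤ) a →
      (t : Equiv.Perm ℤ) b = (t' : Equiv.Perm ℤ) b := by
    have h2 : (t' : Equiv.Perm ℤ) ((t : Equiv.Perm ℤ) a) = a := by rw [h, ht'.apply_apply]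
    rintro b (rfl | rfl | rfl | rfl)
    · exact h
    · rw [ht.apply_apply, h2]
    · rw [Weyl.apply_neg, Weyl.apply_neg, h]
    · rw [Weyl.apply_neg, Weyl.apply_neg, ht.apply_apply, h2]
  refine Weyl.ext_apply fun b => ?_
  by_cases h1 : (t : Equiv.Perm ℤ) b = b
  · by_cases h2 : (t' : Equiv.Perm ℤ) b = b
    · rw [h1, h2]
    · have := ht'.moved ha' h2
      rw [← h] at this
      exact key b this
  · exact key b (ht.moved ha h1)

/-- `w` inverts `t` if `w` reverses the order of a pair of letters exchanged by `t`. For a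
reflection `t` this says that `w` maps the positive root of `t` to a negative root. -/
def Inverts (w t : Weyl Φ d) : Prop :=
  ∃ a : ℤ, a < (t : Equiv.Perm ℤ) a ∧
    (w : Equiv.Perm ℤ) ((t : Equiv.Perm ℤ) a) < (w : Equiv.Perm ℤ) a

theorem IsReflection.exists_lt {t : Weyl Φ d} (ht : IsReflection t) :
    ∃ a : ℤ, a < (t : Equiv.Perm ℤ) a := by
  have hm : ∃ a, (t : Equiv.Perm ℤ) a ≠ a := by
    obtain ⟨w, i, rfl⟩ := ht
    refine ⟨(w : Equiv.Perm ℤ) (i + 1 : ℕ), ?_⟩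
    simp only [Weyl.mul_apply, Weyl.inv_apply_self, (w : Equiv.Perm ℤ).injective.ne_iff,
      simple_apply, simplePerm_apply]
    split_ifs <;> omega
  obtain ⟨a, ha⟩ := hm
  rcases lt_or_gt_of_ne ha with h | h
  · exact ⟨(t : Equiv.Perm ℤ) a, by rwa [ht.apply_apply]⟩
  · exact ⟨a, h⟩

/-- Whether `w` inverts `t` can be tested on any pair of letters exchanged by `t`. -/
theorem IsReflection.inverts_iff {t : Weyl Φ d} (ht : IsReflection t) (w : Weyl Φ d) {a : ℤ}
    (ha : a < (t : Equiv.Perm ℤ) a) :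
    Inverts w t ↔ (w : Equiv.Perm ℤ) ((t : Equiv.Perm ℤ) a) < (w : Equiv.Perm ℤ) a := by
  refine ⟨?_, fun h => ⟨a, ha, h⟩⟩
  rintro ⟨b, hb, h⟩
  rcases ht.moved ha.ne' hb.ne' with rfl | rfl | rfl | rfl
  · exact h
  · rw [ht.apply_apply] at hb
    omega
  · rw [Weyl.apply_neg] at hb
    omega
  · rw [Weyl.apply_neg, ht.apply_apply] at h hb
    rw [Weyl.apply_neg, Weyl.apply_neg] at h
    omega

theorem not_inverts_one (t : Weyl Φ d) : ¬ Inverts 1 t := by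
  rintro ⟨a, h1, h2⟩
  exact absurd h1 (not_lt.2 (le_of_lt h2))

theorem inverts_mul_iff_of_not {t : Weyl Φ d} (ht : IsReflection t) (x y : Weyl Φ d)
    (hy : ¬ Inverts y t) : Inverts (x * y) t ↔ Inverts x (y * t * y⁻¹) := by
  obtain ⟨a, ha⟩ := ht.exists_lt
  have e : ((y * t * y⁻¹ : Weyl Φ d) : Equiv.Perm ℤ) ((y : Equiv.Perm ℤ) a) =
      (y : Equiv.Perm ℤ) ((t : Equiv.Perm ℤ) a) := by
    simp only [Weyl.mul_apply, Weyl.inv_apply_self]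
  rw [ht.inverts_iff y ha, not_lt] at hy
  have hne : (y : Equiv.Perm ℤ) a ≠ (y : Equiv.Perm ℤ) ((t : Equiv.Perm ℤ) a) :=
    (y : Equiv.Perm ℤ).injective.ne ha.ne
  rw [ht.inverts_iff _ ha, (ht.conj y).inverts_iff x (a := (y : Equiv.Perm ℤ) a)
    (by rw [e]; omega), e]
  rfl

theorem inverts_mul_iff_of_inverts {t : Weyl Φ d} (ht : IsReflection t) (x y : Weyl Φ d)
    (hy : Inverts y t) : Inverts (x * y) t ↔ ¬ Inverts x (y * t * y⁻¹) := by
  obtain ⟨a, ha⟩ := ht.exists_lt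
  have e : ((y * t * y⁻¹ : Weyl Φ d) : Equiv.Perm ℤ)
      ((y : Equiv.Perm ℤ) ((t : Equiv.Perm ℤ) a)) = (y : Equiv.Perm ℤ) a := by
    simp only [Weyl.mul_apply, Weyl.inv_apply_self, ht.apply_apply]
  rw [ht.inverts_iff y ha] at hy
  have hne : (x : Equiv.Perm ℤ) ((y : Equiv.Perm ℤ) a) ≠
      (x : Equiv.Perm ℤ) ((y : Equiv.Perm ℤ) ((t : Equiv.Perm ℤ) a)) :=
    (x : Equiv.Perm ℤ).injective.ne ((y : Equiv.Perm ℤ).injective.ne ha.ne)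
  rw [ht.inverts_iff _ ha, (ht.conj y).inverts_iff x
    (a := (y : Equiv.Perm ℤ) ((t : Equiv.Perm ℤ) a)) (by rw [e]; omega), e, Weyl.mul_apply,
    Weyl.mul_apply]
  omega

theorem inverts_simple_iff (i : Idx Φ d) {t : Weyl Φ d} (ht : IsReflection t) :
    Inverts (simple i) t ↔ t = simple i := by
  constructor
  · rintro ⟨a, h1, h2⟩
    have h0 : a ≠ 0 := fun h => by rw [h, Weyl.apply_zero] at h1; omega
    have h0' : (t : Equiv.Perm ℤ) a ≠ 0 := fun h => by
      have := ht.apply_apply a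
      rw [h, Weyl.apply_zero] at this
      exact h0 this.symm
    refine ht.eq_of_apply_eq (isReflection_simple i) h1.ne' ?_
    simp only [simple_apply, simplePerm_apply] at h2 ⊢
    split_ifs at * <;> omega
  · rintro rfl
    obtain ⟨a, ha⟩ := ht.exists_lt
    exact ⟨a, ha, by rwa [ht.apply_apply]⟩

theorem inverts_self {t : Weyl Φ d} (ht : IsReflection t) : Inverts t t := by
  obtain ⟨a, ha⟩ := ht.exists_lt
  exact ⟨a, ha, by rwa [ht.apply_apply]⟩

theorem inverts_mul_self_iff {t : Weyl Φ d} (ht : IsReflection t) (w : Weyl Φ d) :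
    Inverts (w * t) t ↔ ¬ Inverts w t := by
  rw [inverts_mul_iff_of_inverts ht w t (inverts_self ht), mul_inv_cancel_right]

/-- Strong exchange: if a (not necessarily reduced) product of simple reflections inverts `t`, then
multiplying it by `t` amounts to deleting one of the factors. -/
theorem exists_eraseIdx_of_inverts {t : Weyl Φ d} (ht : IsReflection t) (l : List (Idx Φ d))
    (h : Inverts (l.map simple).prod t) :
    ∃ k < l.length, ((l.eraseIdx k).map simple).prod = (l.map simple).prod * t := by
  induction l with
  | nil => exact absurd h (not_inverts_one t)
  | cons i l ih =>
    simp only [List.map_cons, List.prod_cons] at h ⊢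
    by_cases h1 : Inverts (l.map simple).prod t
    · obtain ⟨k, hk, e⟩ := ih h1
      exact ⟨k + 1, by simpa using hk, by simp [e, mul_assoc]⟩
    · rw [inverts_mul_iff_of_not ht _ _ h1, inverts_simple_iff i (ht.conj _)] at h
      refine ⟨0, by simp, ?_⟩
      rw [List.eraseIdx_cons_zero, ← h]
      simp only [mul_assoc, inv_mul_cancel_left]
      rw [ht.mul_self, mul_one]

theorem len_mul_lt_of_inverts {w t : Weyl Φ d} (ht : IsReflection t) (h : Inverts w t) :
    len (w * t) < len w := by
  obtain ⟨l, hl, rfl⟩ := exists_reduced_word w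
  obtain ⟨k, hk, e⟩ := exists_eraseIdx_of_inverts ht l h
  have := len_prod_le (l.eraseIdx k)
  rw [e, List.length_eraseIdx_of_lt hk] at this
  omega

/-- The length decreases under right multiplication by `t` exactly when `t` is inverted. -/
theorem len_mul_lt_iff {w t : Weyl Φ d} (ht : IsReflection t) :
    len (w * t) < len w ↔ Inverts w t := by
  refine ⟨fun h => ?_, len_mul_lt_of_inverts ht⟩
  by_contra hn
  have := len_mul_lt_of_inverts ht ((inverts_mul_self_iff ht w).2 hn)
  rw [mul_assoc, ht.mul_self, mul_one] at this
  omega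

theorem lt_len_mul_iff {w t : Weyl Φ d} (ht : IsReflection t) :
    len w < len (w * t) ↔ ¬ Inverts w t := by
  have := len_mul_lt_iff (w := w * t) ht
  rwa [mul_assoc, ht.mul_self, mul_one, inverts_mul_self_iff ht] at this

theorem len_one : len (1 : Weyl Φ d) = 0 := by
  simpa using len_prod_le (Φ := Φ) (d := d) []

theorem len_mul_le (v w : Weyl Φ d) : len (v * w) ≤ len v + len w := by
  obtain ⟨l, hl, rfl⟩ := exists_reduced_word v
  obtain ⟨l', hl', rfl⟩ := exists_reduced_word w
  rw [← hl, ← hl', ← List.prod_append, ← List.map_append, ← List.length_append]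
  exact len_prod_le _

theorem len_simple_le (i : Idx Φ d) : len (simple i) ≤ 1 := by simpa using len_prod_le [i]

theorem eq_one_of_len_eq_zero {w : Weyl Φ d} (h : len w = 0) : w = 1 := by
  obtain ⟨l, hl, rfl⟩ := exists_reduced_word w
  rw [h] at hl
  simp [List.length_eq_zero_iff.1 hl]

theorem len_mul_simple (w : Weyl Φ d) (i : Idx Φ d) :
    (Inverts w (simple i) ∧ len w = len (w * simple i) + 1) ∨
      (¬ Inverts w (simple i) ∧ len (w * simple i) = len w + 1) := by
  have h1 := len_mul_le w (simple i)
  have h2 := len_mul_le (w * simple i) (simple i)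
  have h3 := len_simple_le i
  rw [mul_assoc, simple_mul_self, mul_one] at h2
  by_cases h : Inverts w (simple i)
  · have := (len_mul_lt_iff (isReflection_simple i)).2 h
    exact Or.inl ⟨h, by omega⟩
  · have := (lt_len_mul_iff (isReflection_simple i)).2 h
    exact Or.inr ⟨h, by omega⟩

theorem len_simple (i : Idx Φ d) : len (simple i) = 1 := by
  rcases len_mul_simple 1 i with h | h
  · exact absurd h.1 (not_inverts_one _)
  · simpa [len_one] using h.2

theorem len_simple_mul (w : Weyl Φ d) (i : Idx Φ d) :
    (Inverts w⁻¹ (simple i) ∧ len w = len (simple i * w) + 1) ∨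
      (¬ Inverts w⁻¹ (simple i) ∧ len (simple i * w) = len w + 1) := by
  have := len_mul_simple w⁻¹ i
  rwa [← len_inv (w⁻¹ * simple i), mul_inv_rev, inv_inv, simple_inv, len_inv] at this

theorem exists_inverts_simple {w : Weyl Φ d} (hw : w ≠ 1) :
    ∃ i : Idx Φ d, Inverts w (simple i) := by
  by_contra! hn
  refine hw (eq_one_of_increasing w (fun hd => ?_) fun i hi hid => ?_)
  · cases Φ with
    | A => exact w.2.2.2 rfl 1 le_rfl (by omega)
    | B =>
      by_contra h
      refine hn ⟨0, by omega, fun h => by cases h⟩ ⟨-1, ?_, ?_⟩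
      · simp [simple_apply, simplePerm_apply]
      · have h1 : (w : Equiv.Perm ℤ) 1 ≠ 0 := fun h => by
          have := (w : Equiv.Perm ℤ).injective (h.trans (Weyl.apply_zero w).symm)
          omega
        rw [simple_apply, simplePerm_apply, Weyl.apply_neg w 1]
        simp
        omega
  · by_contra h
    have hne : (w : Equiv.Perm ℤ) i ≠ (w : Equiv.Perm ℤ) (i + 1) := fun h => by
      have := (w : Equiv.Perm ℤ).injective h
      omega
    refine hn ⟨i, hid, fun _ => hi⟩ ⟨i, ?_, ?_⟩
    · simp only [simple_apply, simplePerm_apply]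
      split_ifs <;> omega
    · have : simplePerm i (i : ℤ) = i + 1 := by
        simp only [simplePerm_apply]
        split_ifs <;> omega
      rw [simple_apply, this]
      omega

/-- Induction along reduced expressions, adding simple reflections on the right. -/
theorem weyl_induction_right {P : Weyl Φ d → Prop} (one : P 1)
    (mul : ∀ w i, len (w * simple i) = len w + 1 → P w → P (w * simple i))
    (w : Weyl Φ d) : P w := by
  induction h : len w using Nat.strong_induction_on generalizing w with
  | _ n ih =>
    by_cases hw : w = 1
    · rwa [hw]
    · obtain ⟨i, hi⟩ := exists_inverts_simple hw
      rcases len_mul_simple w i with ⟨_, h2⟩ | h2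
      · have := mul (w * simple i) i
        rw [mul_assoc, simple_mul_self, mul_one] at this
        exact this h2 (ih _ (by omega) _ rfl)
      · exact absurd hi h2.1

/-! ### Bruhat order -/

theorem BruhatLE.refl (w : Weyl Φ d) : BruhatLE w w := Relation.ReflTransGen.refl

theorem BruhatLE.trans {u v w : Weyl Φ d} (h : BruhatLE u v) (h' : BruhatLE v w) : BruhatLE u w :=
  Relation.ReflTransGen.trans h h'

theorem bruhatLE_mul_of_not_inverts {w t : Weyl Φ d} (ht : IsReflection t) (h : ¬ Inverts w t) :
    BruhatLE w (w * t) :=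
  Relation.ReflTransGen.single ⟨t, ht, rfl, (lt_len_mul_iff ht).2 h⟩

theorem mul_bruhatLE_of_inverts {w t : Weyl Φ d} (ht : IsReflection t) (h : Inverts w t) :
    BruhatLE (w * t) w :=
  Relation.ReflTransGen.single ⟨t, ht, by rw [mul_assoc, ht.mul_self, mul_one],
    (len_mul_lt_iff ht).2 h⟩

theorem BruhatLE.eq_or_len_lt {u v : Weyl Φ d} (h : BruhatLE u v) : u = v ∨ len u < len v := by
  induction h with
  | refl => exact Or.inl rfl
  | tail _ h ih =>
    obtain ⟨t, _, _, h⟩ := h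
    rcases ih with rfl | ih
    · exact Or.inr h
    · exact Or.inr (ih.trans h)

theorem BruhatLE.antisymm {u v : Weyl Φ d} (h : BruhatLE u v) (h' : BruhatLE v u) : u = v := by
  rcases h.eq_or_len_lt with h | h
  · exact h
  · rcases h'.eq_or_len_lt with h' | h'
    · exact h'.symm
    · omega

/-- The lifting property: if `x ≤ w` and `w < w s`, then `x s ≤ w s`. -/
theorem BruhatLE.mul_simple {x w : Weyl Φ d} (h : BruhatLE x w) (i : Idx Φ d)
    (hw : ¬ Inverts w (simple i)) : BruhatLE (x * simple i) (w * simple i) := by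
  have hs := isReflection_simple i
  -- One Bruhat step `u < u t` gives `u s < u t s` unless `t = s`, as `s` inverts no other `t`.
  have step : ∀ u v : Weyl Φ d, (∃ t, IsReflection t ∧ v = u * t ∧ len u < len v) →
      u * simple i = v ∨ BruhatLE (u * simple i) (v * simple i) := by
    rintro u _ ⟨t, ht, rfl, hlt⟩
    by_cases hts : t = simple i
    · exact Or.inl (by rw [hts])
    · right
      have hni : ¬ Inverts (simple i) (simple i * t * (simple i)⁻¹) := fun hi => by
        rw [inverts_simple_iff i (ht.conj _), simple_inv] at hi
        apply hts
        have h2 := congrArg (fun z => simple i * z * simple i) hi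
        simp only [← mul_assoc, simple_mul_self, one_mul] at h2
        rwa [mul_assoc, simple_mul_self, mul_one] at h2
      have e : u * t * simple i = u * simple i * (simple i * t * (simple i)⁻¹) := by
        rw [simple_inv]
        simp only [← mul_assoc]
        rw [mul_assoc u (simple i), simple_mul_self, mul_one]
      rw [e]
      refine bruhatLE_mul_of_not_inverts (ht.conj _) ?_
      rw [inverts_mul_iff_of_not (ht.conj _) _ _ hni]
      have e2 : simple i * (simple i * t * (simple i)⁻¹) * (simple i)⁻¹ = t := by
        rw [simple_inv]
        simp only [← mul_assoc, simple_mul_self, one_mul]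
        rw [mul_assoc, simple_mul_self, mul_one]
      rw [e2]
      exact (lt_len_mul_iff ht).1 hlt
  have hws : BruhatLE w (w * simple i) := bruhatLE_mul_of_not_inverts hs hw
  have main : BruhatLE (x * simple i) w ∨ BruhatLE (x * simple i) (w * simple i) := by
    induction h using Relation.ReflTransGen.head_induction_on with
    | refl => exact Or.inr (BruhatLE.refl _)
    | head h1 h2 ih =>
      rcases step _ _ h1 with h3 | h3
      · left
        rw [h3]
        exact h2
      · exact ih.imp h3.trans h3.trans
  exact main.elim (fun h => h.trans hws) id

/-! ### Parabolic subgroups and shortest coset representatives -/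

/-- A nontrivial element of `W_J` is shortened from the left by some `s_j` with `j ∈ J`: a shortest
word in the `s_j`, `j ∈ J`, is reduced, because the exchange property only deletes letters. -/
theorem exists_simple_mul_lt_of_mem_parabolic {J : Set (Idx Φ d)} {u : Weyl Φ d}
    (hu : u ∈ parabolic J) (hne : u ≠ 1) : ∃ j ∈ J, len (simple j * u) < len u := by
  have hw : ∃ l : List (Idx Φ d), (∀ j ∈ l, j ∈ J) ∧ (l.map simple).prod = u⁻¹ := by
    have hu' : u⁻¹ ∈ parabolic J := inv_mem hu
    refine Subgroup.closure_induction ?_ ⟨[], by simp, by simp⟩ ?_ ?_ hu'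
    · rintro _ ⟨j, hj, rfl⟩
      exact ⟨[j], by simpa using hj, by simp⟩
    · rintro _ _ _ _ ⟨l, hl, rfl⟩ ⟨l', hl', rfl⟩
      refine ⟨l ++ l', fun j hj => ?_, by simp⟩
      rcases List.mem_append.1 hj with h | h
      exacts [hl _ h, hl' _ h]
    · rintro _ _ ⟨l, hl, rfl⟩
      refine ⟨l.reverse, fun j hj => hl j (List.mem_reverse.1 hj), ?_⟩
      rw [List.prod_inv_reverse, List.map_reverse]
      congr 2
      simp [Function.comp_def, simple_inv]
  let S : Set ℕ := {n | ∃ l : List (Idx Φ d), l.length = n ∧ (∀ j ∈ l, j ∈ J) ∧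
    (l.map simple).prod = u⁻¹}
  have hS : S.Nonempty := let ⟨l, h⟩ := hw; ⟨_, l, rfl, h⟩
  obtain ⟨l, hl, hlJ, hlu⟩ := Nat.sInf_mem hS
  rcases List.eq_nil_or_concat l with rfl | ⟨l, j, rfl⟩
  · exact absurd (by simpa using hlu.symm) hne
  · have hj : j ∈ J := hlJ j (by simp)
    refine ⟨j, hj, ?_⟩
    have hprod : (l.map simple).prod = u⁻¹ * simple j := by
      rw [← hlu]
      simp [mul_assoc, simple_mul_self]
    rcases len_simple_mul u j with h | h
    · omega
    · -- Otherwise the exchange property provides a shorter word with letters in `J`.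
      exfalso
      have h1 := (inverts_mul_self_iff (isReflection_simple j) u⁻¹).2 h.1
      rw [← hprod] at h1
      obtain ⟨k, hk, e⟩ := exists_eraseIdx_of_inverts (isReflection_simple j) l h1
      rw [hprod, mul_assoc, simple_mul_self, mul_one] at e
      have := Nat.sInf_le (s := S) ⟨l.eraseIdx k, rfl, fun i hi => hlJ i
        (by simp [List.mem_of_mem_eraseIdx hi]), e⟩
      rw [← hl, List.length_eraseIdx_of_lt hk] at this
      simp at this
      omega

theorem simple_mem_parabolic {J : Set (Idx Φ d)} {j : Idx Φ d} (hj : j ∈ J) :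
    simple j ∈ parabolic J := Subgroup.subset_closure ⟨j, hj, rfl⟩

/-- Every reflection inverted by an element of `W_J` lies in `W_J`. -/
theorem mem_parabolic_of_inverts {J : Set (Idx Φ d)} {u t : Weyl Φ d} (hu : u ∈ parabolic J)
    (ht : IsReflection t) (h : Inverts u t) : t ∈ parabolic J := by
  have key : ∀ u ∈ parabolic J, ∀ t, IsReflection t → (Inverts u t ∨ Inverts u⁻¹ t) →
      t ∈ parabolic J := by
    intro u hu
    refine Subgroup.closure_induction (p := fun u _ => ∀ t, IsReflection t →
      (Inverts u t ∨ Inverts u⁻¹ t) → t ∈ parabolic J) ?_ ?_ ?_ ?_ hu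
    · rintro _ ⟨j, hj, rfl⟩ t ht h
      rw [simple_inv, or_self, inverts_simple_iff j ht] at h
      rw [h]
      exact simple_mem_parabolic hj
    · intro t ht h
      rw [inv_one, or_self] at h
      exact absurd h (not_inverts_one t)
    · have aux : ∀ x y : Weyl Φ d, y ∈ parabolic J →
          (∀ t, IsReflection t → Inverts x t → t ∈ parabolic J) →
          (∀ t, IsReflection t → Inverts y t → t ∈ parabolic J) →
          ∀ t, IsReflection t → Inverts (x * y) t → t ∈ parabolic J := by
        intro x y hy hx' hy' t ht h
        by_cases h1 : Inverts y t
        · exact hy' t ht h1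
        · rw [inverts_mul_iff_of_not ht _ _ h1] at h
          have h2 := hx' _ (ht.conj y) h
          have h3 := mul_mem (mul_mem (inv_mem hy) h2) hy
          simpa [mul_assoc] using h3
      intro x y hx hy hx' hy' t ht h
      rcases h with h | h
      · exact aux x y hy (fun t ht h => hx' t ht (Or.inl h)) (fun t ht h => hy' t ht (Or.inl h))
          t ht h
      · rw [mul_inv_rev] at h
        exact aux y⁻¹ x⁻¹ (inv_mem hx) (fun t ht h => hy' t ht (Or.inr h))
          (fun t ht h => hx' t ht (Or.inr h)) t ht h
    · intro x _ hx t ht h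
      rw [inv_inv] at h
      exact hx t ht h.symm
  exact key u hu t ht (Or.inl h)

/-- The factorisation `W = W_J · D_J`. -/
theorem exists_parabolic_mul_minRep (J : Set (Idx Φ d)) (w : Weyl Φ d) :
    ∃ u ∈ parabolic J, ∃ g ∈ minReps J, w = u * g := by
  obtain ⟨g, ⟨u, hu, hg⟩, hmin⟩ := Set.exists_min_image
    {g : Weyl Φ d | ∃ u ∈ parabolic J, w = u * g} len (Set.toFinite _)
    ⟨w, 1, one_mem _, by simp⟩
  refine ⟨u, hu, g, fun v hv => ?_, hg⟩
  -- No reflection in `W_J` is inverted by `g⁻¹`, as `g` has minimal length in its coset.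
  have hno : ∀ t ∈ parabolic J, IsReflection t → ¬ Inverts g⁻¹ t := by
    intro t htJ ht h
    have h1 := len_mul_lt_of_inverts ht h
    rw [len_inv, ← len_inv, mul_inv_rev, inv_inv, ht.inv_eq] at h1
    have := hmin (t * g) ⟨u * t⁻¹, mul_mem hu (inv_mem htJ), by rw [hg]; group⟩
    omega
  have key : ∀ v : Weyl Φ d, v ∈ parabolic J → len (g⁻¹ * v) = len v + len g := by
    intro v
    induction v using weyl_induction_right with
    | one => intro _; rw [mul_one, len_inv, len_one, zero_add]
    | mul v i hvi ih =>
      intro hv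
      have hi : Inverts (v * simple i) (simple i) := by
        rw [inverts_mul_self_iff (isReflection_simple i),
          ← lt_len_mul_iff (isReflection_simple i)]
        omega
      have hiJ := mem_parabolic_of_inverts hv (isReflection_simple i) hi
      have hvJ : v ∈ parabolic J := by
        have := mul_mem hv hiJ
        rwa [mul_assoc, simple_mul_self, mul_one] at this
      have h1 := ih hvJ
      have h2 : ¬ Inverts v (simple i) := by
        rw [← lt_len_mul_iff (isReflection_simple i)]
        omega
      have h3 : ¬ Inverts (g⁻¹ * v) (simple i) := by
        rw [inverts_mul_iff_of_not (isReflection_simple i) _ _ h2]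
        exact hno _ (mul_mem (mul_mem hvJ hiJ) (inv_mem hvJ)) ((isReflection_simple i).conj v)
      rcases len_mul_simple (g⁻¹ * v) i with h | h
      · exact absurd h.1 h3
      · rw [← mul_assoc, h.2, h1, hvi]
        omega
  have := key v⁻¹ (inv_mem hv)
  rwa [← len_inv, mul_inv_rev, inv_inv, inv_inv, len_inv] at this

/-- An element is a shortest coset representative as soon as left multiplication by `s_j`, `j ∈ J`,
increases its length. -/
theorem mem_minReps_of_forall_lt {J : Set (Idx Φ d)} {w : Weyl Φ d}
    (h : ∀ j ∈ J, len w < len (simple j * w)) : w ∈ minReps J := by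
  obtain ⟨u, hu, g, hg, rfl⟩ := exists_parabolic_mul_minRep J w
  by_cases hne : u = 1
  · rwa [hne, one_mul]
  · obtain ⟨j, hj, hlt⟩ := exists_simple_mul_lt_of_mem_parabolic hu hne
    have h1 := h j hj
    rw [← mul_assoc, hg _ hu, hg _ (mul_mem (simple_mem_parabolic hj) hu)] at h1
    omega

theorem minReps_mul_unique {J : Set (Idx Φ d)} {u x y : Weyl Φ d} (hu : u ∈ parabolic J)
    (hx : x ∈ minReps J) (hy : y ∈ minReps J) (h : u * x = y) : u = 1 ∧ x = y := by
  have h1 := hx u hu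
  have h2 := hy u⁻¹ (inv_mem hu)
  rw [← h, inv_mul_cancel_left, len_inv, h1] at h2
  have : u = 1 := eq_one_of_len_eq_zero (by omega)
  refine ⟨this, ?_⟩
  rwa [this, one_mul] at h

theorem minRep_bruhatLE {J : Set (Idx Φ d)} {u g : Weyl Φ d} (hu : u ∈ parabolic J)
    (hg : g ∈ minReps J) : BruhatLE g (u * g) := by
  induction h : len u using Nat.strong_induction_on generalizing u with
  | _ n ih =>
    by_cases hne : u = 1
    · rw [hne, one_mul]
      exact BruhatLE.refl g
    · obtain ⟨j, hj, hlt⟩ := exists_simple_mul_lt_of_mem_parabolic hu hne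
      have hju := mul_mem (simple_mem_parabolic hj) hu
      refine (ih _ (by omega) hju rfl).trans ?_
      have ht := (isReflection_simple j).conj' (u * g)
      have e : simple j * u * g = u * g * ((u * g)⁻¹ * simple j * (u * g)) := by group
      rw [e]
      refine mul_bruhatLE_of_inverts ht ((len_mul_lt_iff ht).1 ?_)
      rw [← e, hg _ hju, hg _ hu]
      omega

end Coxeter

section Hecke

variable {Φ : CType} {d : ℕ}

/-! ### The regular representation of the Hecke algebra -/

open Classical in
/-- The scalar `q⁻¹ - q` if `w` inverts `s_i`, that is, if `w s_i < w`, and `0` otherwise. -/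
def quadCoeff (w : Weyl Φ d) (i : Idx Φ d) : LR := if Inverts w (simple i) then qInv - q else 0

/-- Left multiplication by `H_{s_i}` on the free module with basis `W`. -/
def leftOp (i : Idx Φ d) : Module.End LR (Weyl Φ d →₀ LR) :=
  Finsupp.linearCombination LR fun w =>
    Finsupp.single (simple i * w) 1 + quadCoeff w⁻¹ i • Finsupp.single w 1

/-- Right multiplication by `H_{s_i}` on the free module with basis `W`. -/
def rightOp (i : Idx Φ d) : Module.End LR (Weyl Φ d →₀ LR) :=
  Finsupp.linearCombination LR fun w =>
    Finsupp.single (w * simple i) 1 + quadCoeff w i • Finsupp.single w 1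

theorem leftOp_single (i : Idx Φ d) (w : Weyl Φ d) : leftOp i (Finsupp.single w 1) =
    Finsupp.single (simple i * w) 1 + quadCoeff w⁻¹ i • Finsupp.single w 1 := by
  simp [leftOp]

theorem rightOp_single (i : Idx Φ d) (w : Weyl Φ d) : rightOp i (Finsupp.single w 1) =
    Finsupp.single (w * simple i) 1 + quadCoeff w i • Finsupp.single w 1 := by
  simp [rightOp]

/-- Right multiplication by `s_j` does not affect whether `s_i` shortens `w` from the left, unless
`s_i w = w s_j`. -/
theorem quadCoeff_inv_mul (w : Weyl Φ d) (i j : Idx Φ d) (h : simple i * w ≠ w * simple j) :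
    quadCoeff (w * simple j)⁻¹ i = quadCoeff w⁻¹ i := by
  have h1 : Inverts (w * simple j)⁻¹ (simple i) ↔ Inverts w⁻¹ (simple i) := by
    rw [mul_inv_rev, simple_inv]
    by_cases hw : Inverts w⁻¹ (simple i)
    · rw [inverts_mul_iff_of_inverts (isReflection_simple i) _ _ hw,
        inverts_simple_iff j ((isReflection_simple i).conj _)]
      refine iff_of_true (fun e => h ?_) hw
      rw [← e]; group
    · rw [inverts_mul_iff_of_not (isReflection_simple i) _ _ hw,
        inverts_simple_iff j ((isReflection_simple i).conj _)]
      refine iff_of_false (fun e => h ?_) hw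
      rw [← e]; group
  unfold quadCoeff
  split_ifs <;> first | rfl | (exfalso; tauto)

theorem quadCoeff_mul (w : Weyl Φ d) (i j : Idx Φ d) (h : simple i * w ≠ w * simple j) :
    quadCoeff (simple i * w) j = quadCoeff w j := by
  have := quadCoeff_inv_mul w⁻¹ j i (fun e => h (by
    have := congrArg (fun z => z⁻¹) e
    simpa [simple_inv] using this.symm))
  rwa [mul_inv_rev, inv_inv, simple_inv] at this

theorem quadCoeff_eq (w : Weyl Φ d) (i j : Idx Φ d) (h : simple i * w = w * simple j) :
    quadCoeff w⁻¹ i = quadCoeff w j := by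
  have h1 : Inverts w⁻¹ (simple i) ↔ Inverts w (simple j) := by
    rw [← len_mul_lt_iff (isReflection_simple i), ← len_mul_lt_iff (isReflection_simple j), ← h,
      ← len_inv, mul_inv_rev, inv_inv, simple_inv, len_inv]
  unfold quadCoeff
  split_ifs <;> first | rfl | (exfalso; tauto)

theorem leftOp_rightOp (i j : Idx Φ d) : leftOp i * rightOp j = rightOp j * leftOp i := by
  refine Finsupp.lhom_ext' fun w => LinearMap.ext_ring ?_
  simp only [LinearMap.comp_apply, Finsupp.lsingle_apply, Module.End.mul_apply, leftOp_single,
    rightOp_single, map_add, map_smul, smul_add, ← mul_assoc]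
  by_cases h : simple i * w = w * simple j
  · have e1 : quadCoeff (w * simple j)⁻¹ i = quadCoeff (simple i * w) j := by
      rw [← h]
      refine quadCoeff_eq _ i j ?_
      rw [mul_assoc, h]
    rw [e1, quadCoeff_eq w i j h, h]
  · rw [quadCoeff_inv_mul w i j h, quadCoeff_mul w i j h, smul_comm (quadCoeff w⁻¹ i)]
    abel

theorem leftOp_mul_self (i : Idx Φ d) :
    leftOp i * leftOp i = (qInv - q) • leftOp i + 1 := by
  refine Finsupp.lhom_ext' fun w => LinearMap.ext_ring ?_
  have h : quadCoeff (simple i * w)⁻¹ i + quadCoeff w⁻¹ i = qInv - q := by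
    have := inverts_mul_self_iff (isReflection_simple i) w⁻¹
    rw [mul_inv_rev, simple_inv]
    by_cases hi : Inverts w⁻¹ (simple i) <;> simp [quadCoeff, this, hi]
  have h0 : quadCoeff (simple i * w)⁻¹ i * quadCoeff w⁻¹ i = 0 := by
    have := inverts_mul_self_iff (isReflection_simple i) w⁻¹
    rw [mul_inv_rev, simple_inv]
    by_cases hi : Inverts w⁻¹ (simple i) <;> simp [quadCoeff, this, hi]
  simp only [LinearMap.comp_apply, Finsupp.lsingle_apply, Module.End.mul_apply, leftOp_single,
    map_add, map_smul, smul_add, ← mul_assoc, simple_mul_self, one_mul, LinearMap.add_apply,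
    LinearMap.smul_apply, Module.End.one_apply, ← h, add_smul, smul_smul _ (quadCoeff w⁻¹ i), h0,
    zero_smul, add_zero]
  abel

/-- Left multiplication by `H_w`, as the product of the operators `leftOp` along a reduced
expression of `w`. -/
def leftMul (w : Weyl Φ d) : Module.End LR (Weyl Φ d →₀ LR) :=
  ((exists_reduced_word w).choose.map leftOp).prod

theorem prod_leftOp_single (l : List (Idx Φ d)) (x : Weyl Φ d)
    (h : len ((l.map simple).prod * x) = l.length + len x) :
    (l.map leftOp).prod (Finsupp.single x 1) = Finsupp.single ((l.map simple).prod * x) 1 := by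
  induction l with
  | nil => simp
  | cons i l ih =>
    simp only [List.map_cons, List.prod_cons, List.length_cons, mul_assoc] at h ⊢
    have h1 := len_mul_le (l.map simple).prod x
    have h2 := len_prod_le l
    rcases len_simple_mul ((l.map simple).prod * x) i with h3 | h3
    · omega
    · rw [Module.End.mul_apply, ih (by omega), leftOp_single, quadCoeff, if_neg h3.1, zero_smul,
        add_zero]

theorem leftMul_single {w x : Weyl Φ d} (h : len (w * x) = len w + len x) :
    leftMul w (Finsupp.single x 1) = Finsupp.single (w * x) 1 := by
  obtain ⟨h1, h2⟩ := (exists_reduced_word w).choose_spec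
  have := prod_leftOp_single (exists_reduced_word w).choose x (by rw [h1, h2, h])
  rwa [h2] at this

theorem leftMul_rightOp (w : Weyl Φ d) (j : Idx Φ d) :
    leftMul w * rightOp j = rightOp j * leftMul w := by
  have : ∀ l : List (Idx Φ d), Commute ((l.map leftOp).prod) (rightOp j) := by
    intro l
    refine Commute.list_prod_left _ _ fun x hx => ?_
    obtain ⟨i, _, rfl⟩ := List.mem_map.1 hx
    exact leftOp_rightOp i j
  exact this _

/-- The basis vector at `1` generates the free module under the operators `rightOp`, so an operator
that commutes with them is determined by its value there. -/
theorem eq_of_commute_rightOp {f g : Module.End LR (Weyl Φ d →₀ LR)}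
    (hf : ∀ j, f * rightOp j = rightOp j * f) (hg : ∀ j, g * rightOp j = rightOp j * g)
    (h : f (Finsupp.single 1 1) = g (Finsupp.single 1 1)) : f = g := by
  refine Finsupp.lhom_ext' fun w => LinearMap.ext_ring ?_
  simp only [LinearMap.comp_apply, Finsupp.lsingle_apply]
  induction w using weyl_induction_right with
  | one => exact h
  | mul w i hi ih =>
    have hn : ¬ Inverts w (simple i) := by
      rw [← lt_len_mul_iff (isReflection_simple i)]
      omega
    have e : Finsupp.single (w * simple i) (1 : LR) = rightOp i (Finsupp.single w 1) := by
      rw [rightOp_single, quadCoeff, if_neg hn, zero_smul, add_zero]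
    rw [e, ← Module.End.mul_apply, ← Module.End.mul_apply, hf, hg, Module.End.mul_apply,
      Module.End.mul_apply, ih]

theorem leftMul_mul {w x : Weyl Φ d} (h : len (w * x) = len w + len x) :
    leftMul w * leftMul x = leftMul (w * x) := by
  have h1 : ∀ y : Weyl Φ d, leftMul y (Finsupp.single 1 1) = Finsupp.single y 1 := fun y => by
    rw [leftMul_single (by rw [mul_one, len_one, add_zero]), mul_one]
  refine eq_of_commute_rightOp (fun j => ?_) (leftMul_rightOp _) ?_
  · rw [mul_assoc, leftMul_rightOp, ← mul_assoc, leftMul_rightOp, mul_assoc]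
  · rw [Module.End.mul_apply, h1, h1, leftMul_single h]

theorem leftMul_one : leftMul (1 : Weyl Φ d) = 1 := by
  refine eq_of_commute_rightOp (leftMul_rightOp _) (fun j => by rw [one_mul, mul_one]) ?_
  rw [leftMul_single (by simp [len_one]), mul_one, Module.End.one_apply]

theorem leftMul_simple (i : Idx Φ d) : leftMul (simple i) = leftOp i := by
  refine eq_of_commute_rightOp (leftMul_rightOp _) (leftOp_rightOp i) ?_
  rw [leftMul_single (by simp [len_one]), leftOp_single, quadCoeff, inv_one,
    if_neg (not_inverts_one _), zero_smul, add_zero]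

/-- The regular representation of the Hecke algebra on the free module with basis `W`. -/
def regularRep (Φ : CType) (d : ℕ) : Hecke Φ d →ₐ[LR] Module.End LR (Weyl Φ d →₀ LR) :=
  RingQuot.liftAlgHom LR ⟨FreeAlgebra.lift LR leftMul, fun a b h => by
    cases h with
    | one => rw [FreeAlgebra.lift_ι_apply, leftMul_one, map_one]
    | mul w x h => simp only [map_mul, FreeAlgebra.lift_ι_apply, leftMul_mul h]
    | quad i =>
      simp only [map_mul, map_add, map_smul, FreeAlgebra.lift_ι_apply, leftMul_one,
        leftMul_simple, leftOp_mul_self]⟩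

theorem regularRep_H (w : Weyl Φ d) : regularRep Φ d (H w) = leftMul w := by
  rw [regularRep, H]
  erw [RingQuot.liftAlgHom_mkAlgHom_apply]
  exact FreeAlgebra.lift_ι_apply _ _

theorem linearIndependent_H : LinearIndependent LR (H : Weyl Φ d → Hecke Φ d) := by
  let f : Hecke Φ d →ₗ[LR] (Weyl Φ d →₀ LR) :=
    (LinearMap.applyₗ (Finsupp.single 1 1)).comp (regularRep Φ d).toLinearMap
  have hf : f ∘ H = fun w => Finsupp.single w (1 : LR) := by
    funext w
    change regularRep Φ d (H w) (Finsupp.single 1 1) = _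
    rw [regularRep_H, leftMul_single (by simp [len_one]), mul_one]
  refine LinearIndependent.of_comp f ?_
  rw [hf]
  exact Finsupp.linearIndependent_single_one LR _

/-! ### Multiplication in the Hecke algebra -/

theorem H_mul_H_simple (w : Weyl Φ d) (i : Idx Φ d) :
    H w * H (simple i) = H (w * simple i) + quadCoeff w i • H w := by
  rcases len_mul_simple w i with h | h
  · have e : w = w * simple i * simple i := by rw [mul_assoc, simple_mul_self, mul_one]
    have h1 : H w = H (w * simple i) * H (simple i) := by
      rw [H_mul _ _ (by rw [← e, len_simple]; exact h.2), ← e]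
    rw [quadCoeff, if_pos h.1]
    conv_lhs => rw [h1]
    rw [mul_assoc, H_quad, mul_add, mul_smul_comm, ← h1, mul_one, add_comm]
  · rw [quadCoeff, if_neg h.1, zero_smul, add_zero, H_mul _ _ (by rw [h.2, len_simple])]

theorem H_eq_mul {w : Weyl Φ d} {i : Idx Φ d} (h : len (w * simple i) = len w + 1) :
    H (w * simple i) = H w * H (simple i) := (H_mul _ _ (by rw [h, len_simple])).symm

theorem span_range_H : Submodule.span LR (Set.range (H : Weyl Φ d → Hecke Φ d)) = ⊤ := by
  set S := Submodule.span LR (Set.range (H : Weyl Φ d → Hecke Φ d))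
  have hs : ∀ (i : Idx Φ d), ∀ h ∈ S, h * H (simple i) ∈ S := by
    intro i h hh
    induction hh using Submodule.span_induction with
    | mem x hx =>
      obtain ⟨w, rfl⟩ := hx
      rw [H_mul_H_simple]
      exact add_mem (Submodule.subset_span ⟨_, rfl⟩)
        (Submodule.smul_mem _ _ (Submodule.subset_span ⟨_, rfl⟩))
    | zero => simp
    | add x y _ _ hx hy => rw [add_mul]; exact add_mem hx hy
    | smul a x _ hx => rw [smul_mul_assoc]; exact Submodule.smul_mem _ _ hx
  have hw : ∀ (w : Weyl Φ d), ∀ h ∈ S, h * H w ∈ S := by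
    intro w
    induction w using weyl_induction_right with
    | one => intro h hh; rwa [H_one, mul_one]
    | mul w i hi ih =>
      intro h hh
      rw [H_eq_mul hi, ← mul_assoc]
      exact hs i _ (ih h hh)
  let π : FreeAlgebra LR (Weyl Φ d) →ₐ[LR] Hecke Φ d := RingQuot.mkAlgHom LR (HeckeRel Φ d)
  have key : ∀ a : FreeAlgebra LR (Weyl Φ d), ∀ h ∈ S, h * π a ∈ S := by
    intro a
    induction a using FreeAlgebra.induction with
    | grade0 r =>
      intro h hh
      rw [AlgHom.commutes, ← Algebra.commutes, ← Algebra.smul_def]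
      exact Submodule.smul_mem _ _ hh
    | grade1 w => exact hw w
    | mul a b ha hb =>
      intro h hh
      rw [map_mul, ← mul_assoc]
      exact hb _ (ha _ hh)
    | add a b ha hb =>
      intro h hh
      rw [map_add, mul_add]
      exact add_mem (ha _ hh) (hb _ hh)
  rw [eq_top_iff]
  intro h _
  obtain ⟨a, rfl⟩ := RingQuot.mkAlgHom_surjective LR (HeckeRel Φ d) h
  have h1 : (1 : Hecke Φ d) ∈ S := Submodule.subset_span ⟨1, H_one⟩
  have h2 := key a 1 h1
  rwa [one_mul] at h2

/-! ### The standard basis of the induced trivial module -/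

/-- `1 ⊗ H_j h = q⁻¹ (1 ⊗ h)` for `j ∈ J`. -/
theorem quot_H_simple_mul {J : Set (Idx Φ d)} {j : Idx Φ d} (hj : j ∈ J) (h : Hecke Φ d) :
    (Submodule.Quotient.mk (H (simple j) * h) : Ind J) = qInv • Submodule.Quotient.mk h := by
  rw [← Submodule.Quotient.mk_smul, Submodule.Quotient.eq]
  have := (trivialIdeal J).smul_mem (MulOpposite.op h) (Submodule.subset_span ⟨j, hj, rfl⟩)
  rw [MulOpposite.smul_eq_mul_unop, MulOpposite.unop_op, sub_mul, smul_mul_assoc, one_mul] at this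
  exact this

theorem qInv_pow_stdElt {J : Set (Idx Φ d)} {u g : Weyl Φ d} (hu : u ∈ parabolic J)
    (hg : g ∈ minReps J) : stdElt J (u * g) = qInv ^ len u • stdElt J g := by
  induction h : len u using Nat.strong_induction_on generalizing u with
  | _ n ih =>
    by_cases hne : u = 1
    · subst hne
      rw [len_one] at h
      rw [one_mul, ← h, pow_zero, one_smul]
    · obtain ⟨j, hj, hlt⟩ := exists_simple_mul_lt_of_mem_parabolic hu hne
      have hju := mul_mem (simple_mem_parabolic hj) hu
      have h2 : len u = len (simple j * u) + 1 := by
        rcases len_simple_mul u j with h | h <;> omega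
      have h3 := ih _ (by omega) hju rfl
      have e : u * g = simple j * (simple j * u * g) := by
        rw [← mul_assoc, ← mul_assoc, simple_mul_self, one_mul]
      rw [e, stdElt, ← H_mul _ _ (by rw [← e, hg _ hu, hg _ hju, len_simple]; omega),
        quot_H_simple_mul hj]
      change qInv • stdElt J (simple j * u * g) = _
      rw [h3, smul_smul, ← pow_succ', ← h, h2]

theorem span_range_stdElt (J : Set (Idx Φ d)) :
    Submodule.span LR (Set.range fun w : minReps J => stdElt J (w : Weyl Φ d)) = ⊤ := by
  rw [eq_top_iff]
  intro m _
  obtain ⟨h, rfl⟩ := Submodule.Quotient.mk_surjective _ m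
  have hh : h ∈ Submodule.span LR (Set.range (H : Weyl Φ d → Hecke Φ d)) := by
    rw [span_range_H]; trivial
  induction hh using Submodule.span_induction with
  | mem x hx =>
    obtain ⟨w, rfl⟩ := hx
    obtain ⟨u, hu, g, hg, rfl⟩ := exists_parabolic_mul_minRep J w
    change stdElt J (u * g) ∈ _
    rw [qInv_pow_stdElt hu hg]
    exact Submodule.smul_mem _ _ (Submodule.subset_span ⟨⟨g, hg⟩, rfl⟩)
  | zero => rw [Submodule.Quotient.mk_zero]; exact zero_mem _
  | add x y _ _ hx hy =>
    rw [Submodule.Quotient.mk_add]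
    exact add_mem (hx trivial) (hy trivial)
  | smul a x _ hx =>
    rw [Submodule.Quotient.mk_smul]
    exact Submodule.smul_mem _ _ (hx trivial)

open Classical in
/-- The element `x_J = ∑_{u ∈ W_J} q^{-ℓ(u)} H_u`. -/
def symmetrizer (J : Set (Idx Φ d)) : Hecke Φ d :=
  ∑ u : Weyl Φ d, if u ∈ parabolic J then qInv ^ len u • H u else 0

theorem qInv_mul_q : qInv * q = 1 := by rw [mul_comm, q_mul_qInv]

theorem symmetrizer_mul_simple {J : Set (Idx Φ d)} {j : Idx Φ d} (hj : j ∈ J) :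
    symmetrizer J * H (simple j) = qInv • symmetrizer J := by
  classical
  have hmem : ∀ u : Weyl Φ d, u * simple j ∈ parabolic J ↔ u ∈ parabolic J := fun u =>
    Subgroup.mul_mem_cancel_right _ (simple_mem_parabolic hj)
  have h1 : symmetrizer J * H (simple j) =
      (∑ u : Weyl Φ d, if u ∈ parabolic J then qInv ^ len u • H (u * simple j) else 0) +
      ∑ u : Weyl Φ d, if u ∈ parabolic J then (quadCoeff u j * qInv ^ len u) • H u else 0 := by
    rw [symmetrizer, Finset.sum_mul, ← Finset.sum_add_distrib]
    refine Finset.sum_congr rfl fun u _ => ?_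
    split_ifs with h
    · rw [smul_mul_assoc, H_mul_H_simple, smul_add, smul_smul, mul_comm]
    · simp
  have h2 : (∑ u : Weyl Φ d, if u ∈ parabolic J then qInv ^ len u • H (u * simple j) else 0) =
      ∑ u : Weyl Φ d, if u ∈ parabolic J then qInv ^ len (u * simple j) • H u else 0 := by
    refine Fintype.sum_equiv (Equiv.mulRight (simple j)) _ _ fun u => ?_
    simp only [Equiv.coe_mulRight, hmem]
    rw [mul_assoc, simple_mul_self, mul_one]
  rw [h1, h2, symmetrizer, Finset.smul_sum, ← Finset.sum_add_distrib]
  refine Finset.sum_congr rfl fun u _ => ?_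
  split_ifs with h
  · rw [← add_smul, smul_smul]
    congr 1
    rcases len_mul_simple u j with h3 | h3
    · rw [quadCoeff, if_pos h3.1, h3.2, pow_succ]
      linear_combination (-(qInv ^ len (u * simple j)) : LR) * qInv_mul_q
    · rw [quadCoeff, if_neg h3.1, h3.2, pow_succ]
      ring
  · simp

theorem symmetrizer_mul_eq_zero {J : Set (Idx Φ d)} {h : Hecke Φ d} (hh : h ∈ trivialIdeal J) :
    symmetrizer J * h = 0 := by
  induction hh using Submodule.span_induction with
  | mem x hx =>
    obtain ⟨j, hj, rfl⟩ := hx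
    rw [mul_sub, symmetrizer_mul_simple hj, mul_smul_comm, mul_one, sub_self]
  | zero => exact mul_zero _
  | add x y _ _ hx hy => rw [mul_add, hx, hy, add_zero]
  | smul a x _ hx =>
    rw [MulOpposite.smul_eq_mul_unop, ← mul_assoc, hx, zero_mul]

theorem linearIndependent_stdElt (J : Set (Idx Φ d)) :
    LinearIndependent LR fun w : minReps J => stdElt J (w : Weyl Φ d) := by
  classical
  rw [Fintype.linearIndependent_iff]
  intro a ha y
  have h1 : ∑ x : minReps J, a x • H (x : Weyl Φ d) ∈ trivialIdeal J := by
    rw [← Submodule.Quotient.mk_eq_zero, ← ha]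
    exact map_sum ((trivialIdeal J).mkQ.restrictScalars LR) _ _
  have h2 := symmetrizer_mul_eq_zero h1
  rw [symmetrizer, Finset.sum_mul] at h2
  have h3 : ∑ u : Weyl Φ d, ∑ x : minReps J,
      (if u ∈ parabolic J then qInv ^ len u * a x else 0) • H (u * (x : Weyl Φ d)) = 0 := by
    rw [← h2]
    refine Finset.sum_congr rfl fun u _ => ?_
    rw [Finset.mul_sum]
    refine Finset.sum_congr rfl fun x _ => ?_
    split_ifs with h
    · rw [smul_mul_assoc, mul_smul_comm, H_mul _ _ (x.2 u h), smul_smul]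
    · rw [zero_smul, zero_mul]
  -- The coefficient of `H_y` in this relation is `a y`, as `u x = y` only for `u = 1`, `x = y`.
  let f : (Weyl Φ d →₀ LR) := ∑ u : Weyl Φ d, ∑ x : minReps J,
    Finsupp.single (u * (x : Weyl Φ d)) (if u ∈ parabolic J then qInv ^ len u * a x else 0)
  have h4 : Finsupp.linearCombination LR (H : Weyl Φ d → Hecke Φ d) f = 0 := by
    rw [← h3]
    simp only [f, map_sum, Finsupp.linearCombination_single]
  have h5 : f = 0 := (linearIndependent_iff.1 linearIndependent_H) f h4
  have h6 : f (y : Weyl Φ d) = a y := by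
    simp only [f, Finsupp.finsetSum_apply]
    rw [Finset.sum_eq_single 1, Finset.sum_eq_single y]
    · rw [one_mul, Finsupp.single_eq_same, if_pos (one_mem _), len_one, pow_zero, one_mul]
    · intro x _ hx
      rw [one_mul, Finsupp.single_eq_of_ne]
      exact fun h => hx (Subtype.ext h.symm)
    · simp
    · intro u _ hu
      refine Finset.sum_eq_zero fun x _ => ?_
      split_ifs with h
      · rw [Finsupp.single_eq_of_ne]
        exact fun e => hu (minReps_mul_unique h x.2 y.2 e.symm).1
      · simp
    · simp
  rw [← h6, h5]
  rfl

/-- The standard basis `M_w`, `w ∈ D_J`, of `M^J`. -/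
def stdBasis (J : Set (Idx Φ d)) : Module.Basis (minReps J) LR (Ind J) :=
  Module.Basis.mk (linearIndependent_stdElt J) (span_range_stdElt J).ge

theorem stdBasis_apply (J : Set (Idx Φ d)) (w : minReps J) : stdBasis J w = stdElt J w := by
  rw [stdBasis, Module.Basis.mk_apply]

/-! ### Triangularity of the bar involution -/

theorem barLR_barLR (r : LR) : barLR (barLR r) = r := by
  exact LaurentPolynomial.involutive_invert r

theorem bar_smul (r : LR) (h : Hecke Φ d) : bar Φ d (r • h) = barLR r • bar Φ d h := by
  rw [Algebra.smul_def, map_mul, bar_algebraMap, ← Algebra.smul_def]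

theorem bar_H_simple (i : Idx Φ d) :
    bar Φ d (H (simple i)) = H (simple i) + (q - qInv) • 1 := by
  rw [bar_H, simple_inv, ringInverse_H_simple]

theorem bar_bar (h : Hecke Φ d) : bar Φ d (bar Φ d h) = h := by
  have hh : h ∈ Submodule.span LR (Set.range (H : Weyl Φ d → Hecke Φ d)) := by
    rw [span_range_H]; trivial
  induction hh using Submodule.span_induction with
  | mem x hx =>
    obtain ⟨w, rfl⟩ := hx
    induction w using weyl_induction_right with
    | one => rw [H_one, map_one, map_one]
    | mul w i hi ih =>
      rw [H_eq_mul hi, map_mul, map_mul, ih, bar_H_simple, map_add, bar_smul, map_one,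
        bar_H_simple, map_sub, barLR_q, barLR_qInv, add_assoc, ← add_smul]
      simp
  | zero => simp
  | add x y _ _ hx hy => rw [map_add, map_add, hx, hy]
  | smul a x _ hx => rw [bar_smul, bar_smul, barLR_barLR, hx]

/-- The subring `ℤ[q, q⁻¹]` of `ℂ[q, q⁻¹]`: the Laurent polynomials with integer coefficients. -/
def intLR : Subring LR := Subring.closure {q, qInv}

theorem q_mem_intLR : q ∈ intLR := Subring.subset_closure (by simp)

theorem qInv_mem_intLR : qInv ∈ intLR := Subring.subset_closure (by simp)

theorem quadCoeff_mem (w : Weyl Φ d) (i : Idx Φ d) : quadCoeff w i ∈ intLR := by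
  rw [quadCoeff]
  split_ifs
  · exact sub_mem qInv_mem_intLR q_mem_intLR
  · exact zero_mem _

theorem smul_mem_span_intLR {M : Type*} [AddCommGroup M] [Module LR M] {S : Set M} {r : LR}
    (hr : r ∈ intLR) {m : M} (hm : m ∈ Submodule.span intLR S) : r • m ∈ Submodule.span intLR S :=
  Submodule.smul_mem _ (⟨r, hr⟩ : intLR) hm

/-- `bar H_w` is `H_w` plus a combination of the `H_x` with `x < w` in the Bruhat order, with
coefficients in `ℤ[q, q⁻¹]`. -/
theorem bar_H_sub_mem (w : Weyl Φ d) : bar Φ d (H w) - H w ∈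
    Submodule.span intLR (H '' {x : Weyl Φ d | BruhatLE x w ∧ x ≠ w}) := by
  induction w using weyl_induction_right with
  | one => rw [H_one, map_one, sub_self]; exact zero_mem _
  | mul w i hi ih =>
    have hn : ¬ Inverts w (simple i) := by
      rw [← lt_len_mul_iff (isReflection_simple i)]
      omega
    have hc : q - qInv ∈ intLR := sub_mem q_mem_intLR qInv_mem_intLR
    set S := Submodule.span intLR
      (H '' {x : Weyl Φ d | BruhatLE x (w * simple i) ∧ x ≠ w * simple i}) with hS
    have hsub : ∀ x : Weyl Φ d, BruhatLE x w → H x ∈ S := fun x hx => by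
      refine Submodule.subset_span ⟨x, ⟨hx.trans
        (bruhatLE_mul_of_not_inverts (isReflection_simple i) hn), ?_⟩, rfl⟩
      rintro rfl
      rcases hx.eq_or_len_lt with h | h
      · rw [h] at hi
        omega
      · omega
    have hmul : ∀ h ∈ Submodule.span intLR (H '' {x : Weyl Φ d | BruhatLE x w ∧ x ≠ w}),
        h ∈ S ∧ h * H (simple i) ∈ S := by
      intro h hh
      induction hh using Submodule.span_induction with
      | mem y hy =>
        obtain ⟨x, ⟨hx, hne⟩, rfl⟩ := hy
        refine ⟨hsub x hx, ?_⟩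
        rw [H_mul_H_simple]
        refine add_mem (Submodule.subset_span ⟨_, ⟨hx.mul_simple i hn, ?_⟩, rfl⟩)
          (smul_mem_span_intLR (quadCoeff_mem x i) (hsub x hx))
        exact fun h => hne (mul_right_cancel h)
      | zero => simp
      | add x y _ _ hx hy =>
        refine ⟨add_mem hx.1 hy.1, ?_⟩
        rw [add_mul]; exact add_mem hx.2 hy.2
      | smul a x _ hx =>
        refine ⟨Submodule.smul_mem _ _ hx.1, ?_⟩
        rw [smul_mul_assoc]; exact Submodule.smul_mem _ _ hx.2
    obtain ⟨h1, h2⟩ := hmul _ ih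
    have e : bar Φ d (H (w * simple i)) - H (w * simple i) =
        (bar Φ d (H w) - H w) * H (simple i) + (q - qInv) • (bar Φ d (H w) - H w) +
          (q - qInv) • H w := by
      rw [H_eq_mul hi, map_mul, bar_H_simple, mul_add, mul_smul_comm, mul_one, sub_mul, smul_sub]
      abel
    rw [e]
    exact add_mem (add_mem h2 (smul_mem_span_intLR hc h1))
      (smul_mem_span_intLR hc (hsub w (BruhatLE.refl w)))

theorem barInd_mk (J : Set (Idx Φ d)) (h : Hecke Φ d) :
    barInd J (Submodule.Quotient.mk h) = Submodule.Quotient.mk (bar Φ d h) := rfl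

theorem barInd_smul (J : Set (Idx Φ d)) (r : LR) (m : Ind J) :
    barInd J (r • m) = barLR r • barInd J m := by
  obtain ⟨h, rfl⟩ := Submodule.Quotient.mk_surjective _ m
  rw [← Submodule.Quotient.mk_smul, barInd_mk, bar_smul, Submodule.Quotient.mk_smul, barInd_mk]

theorem barInd_barInd (J : Set (Idx Φ d)) (m : Ind J) : barInd J (barInd J m) = m := by
  obtain ⟨h, rfl⟩ := Submodule.Quotient.mk_surjective _ m
  rw [barInd_mk, barInd_mk, bar_bar]

/-- The bar involution of `M^J` is unitriangular on the standard basis, with coefficients in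
`ℤ[q, q⁻¹]`. -/
theorem barInd_stdElt_sub_mem (J : Set (Idx Φ d)) (w : minReps J) :
    barInd J (stdElt J w) - stdElt J w ∈ Submodule.span intLR
      (stdBasis J '' {x | BruhatLE (x : Weyl Φ d) (w : Weyl Φ d) ∧ x ≠ w}) := by
  have h := bar_H_sub_mem (w : Weyl Φ d)
  change Submodule.Quotient.mk (bar Φ d (H (w : Weyl Φ d)) - H (w : Weyl Φ d)) ∈ _
  generalize bar Φ d (H (w : Weyl Φ d)) - H (w : Weyl Φ d) = h' at h
  induction h using Submodule.span_induction with
  | mem y hy =>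
    obtain ⟨x, ⟨hx, hne⟩, rfl⟩ := hy
    obtain ⟨u, hu, g, hg, rfl⟩ := exists_parabolic_mul_minRep J x
    change stdElt J (u * g) ∈ _
    rw [qInv_pow_stdElt hu hg]
    have hgx := minRep_bruhatLE hu hg
    refine smul_mem_span_intLR (pow_mem qInv_mem_intLR _)
      (Submodule.subset_span ⟨⟨g, hg⟩, ⟨hgx.trans hx, ?_⟩, stdBasis_apply J _⟩)
    rintro rfl
    exact hne (hx.antisymm hgx)
  | zero => rw [Submodule.Quotient.mk_zero]; exact zero_mem _
  | add x y _ _ hx hy =>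
    rw [Submodule.Quotient.mk_add]
    exact add_mem hx hy
  | smul a x _ hx =>
    have : (Submodule.Quotient.mk (a • x) : Ind J) = (a : LR) • Submodule.Quotient.mk x := rfl
    rw [this]
    exact smul_mem_span_intLR a.2 hx

end Hecke

section KazhdanLusztig

/-! ### Laurent polynomials with integer coefficients -/

/-- The subgroup `v ℤ[v]` of `ℂ[q, q⁻¹]`. -/
def posPart (v : LR) : AddSubgroup LR where
  carrier := {p | ∃ f : ℤ[X], p = Polynomial.aeval v (Polynomial.X * f)}
  zero_mem' := ⟨0, by simp⟩
  add_mem' := by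
    rintro _ _ ⟨f, rfl⟩ ⟨g, rfl⟩
    exact ⟨f + g, by rw [mul_add, map_add]⟩
  neg_mem' := by
    rintro _ ⟨f, rfl⟩
    exact ⟨-f, by rw [mul_neg, map_neg]⟩

theorem mul_mem_posPart {v a b : LR} (ha : a ∈ posPart v) (hb : b ∈ posPart v) :
    a * b ∈ posPart v := by
  obtain ⟨f, rfl⟩ := ha
  obtain ⟨g, rfl⟩ := hb
  exact ⟨f * (Polynomial.X * g), by rw [← map_mul, mul_assoc]⟩

theorem coeff_eq_zero_of_mem_posPart {ε : ℤ} {p : LR}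
    (hp : p ∈ posPart (LaurentPolynomial.T ε)) {n : ℤ} (hn : n * ε ≤ 0) (hε : ε ≠ 0) :
    p.coeff n = 0 := by
  obtain ⟨f, rfl⟩ := hp
  induction f using Polynomial.induction_on' with
  | add f g hf hg => rw [mul_add, map_add, AddMonoidAlgebra.coeff_add, Finsupp.add_apply, hf, hg,
      add_zero]
  | monomial k a =>
    have e : Polynomial.aeval (LaurentPolynomial.T ε : LR)
        (Polynomial.X * Polynomial.monomial k a) = a • LaurentPolynomial.T (((k + 1 : ℕ) : ℤ) * ε) := by
      rw [Polynomial.X_mul_monomial, Polynomial.aeval_monomial, LaurentPolynomial.T_pow,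
        ← Algebra.smul_def]
    have hne : ((k + 1 : ℕ) : ℤ) * ε ≠ n := by
      rintro rfl
      have h1 : 0 < ε * ε := mul_self_pos.2 hε
      have h2 : (0 : ℤ) < ((k + 1 : ℕ) : ℤ) := by positivity
      nlinarith [mul_pos h2 h1]
    rw [e, AddMonoidAlgebra.coeff_smul_apply, LaurentPolynomial.T_apply, if_neg hne, smul_zero]

theorem exists_eq_T {v : LR} (hv : v = q ∨ v = qInv) :
    ∃ ε : ℤ, ε ≠ 0 ∧ v = LaurentPolynomial.T ε := by
  rcases hv with rfl | rfl
  · exact ⟨1, by norm_num, rfl⟩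
  · exact ⟨-1, by norm_num, rfl⟩

theorem coeff_barLR (p : LR) (n : ℤ) : (barLR p).coeff n = p.coeff (-n) :=
  LaurentPolynomial.invert_apply p n

/-- The sum `v ℤ[v] + ℤ + v⁻¹ ℤ[v⁻¹]` is direct, as its three terms have disjoint sets of
exponents. -/
theorem eq_zero_of_add_add_barLR {v : LR} (hv : v = q ∨ v = qInv) {p p' : LR}
    (hp : p ∈ posPart v) (hp' : p' ∈ posPart v) (c : ℤ) (h : p + (c : LR) + barLR p' = 0) :
    p = 0 ∧ (c : LR) = 0 := by
  obtain ⟨ε, hε, rfl⟩ := exists_eq_T hv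
  have hc : ∀ n : ℤ, ((c : LR)).coeff n = if n = 0 then (c : ℂ) else 0 := fun n => by
    rw [← LaurentPolynomial.C_apply, map_intCast]
  have h0 : ∀ n, p.coeff n + (if n = 0 then (c : ℂ) else 0) + p'.coeff (-n) = 0 := fun n => by
    have := congrArg (fun z : LR => z.coeff n) h
    simpa [AddMonoidAlgebra.coeff_add, hc, coeff_barLR] using this
  have hc0 : (c : ℂ) = 0 := by
    have := h0 0
    rwa [neg_zero, coeff_eq_zero_of_mem_posPart hp (by simp) hε,
      coeff_eq_zero_of_mem_posPart hp' (by simp) hε, if_pos rfl, zero_add, add_zero] at this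
  refine ⟨LaurentPolynomial.ext fun n => ?_, ?_⟩
  · by_cases hn : n * ε ≤ 0
    · rw [coeff_eq_zero_of_mem_posPart hp hn hε]; rfl
    · have := h0 n
      rw [coeff_eq_zero_of_mem_posPart hp' (by rw [neg_mul]; omega) hε, hc0, ite_self,
        add_zero, add_zero] at this
      rw [this]; rfl
  · rw [Int.cast_eq_zero.1 hc0, Int.cast_zero]

theorem eq_zero_of_barLR_eq {v : LR} (hv : v = q ∨ v = qInv) {p : LR} (hp : p ∈ posPart v)
    (h : barLR p = p) : p = 0 :=
  (eq_zero_of_add_add_barLR hv hp (neg_mem hp) 0 (by rw [map_neg, h]; simp)).1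

theorem barLR_intCast (n : ℤ) : barLR (n : LR) = n := map_intCast _ _

/-- `ℤ[q, q⁻¹] = v ℤ[v] + ℤ + v⁻¹ ℤ[v⁻¹]`. -/
theorem exists_posPart_add {v : LR} (hv : v = q ∨ v = qInv) {r : LR} (hr : r ∈ intLR) :
    ∃ p ∈ posPart v, ∃ c : ℤ, ∃ p' ∈ posPart v, r = p + c + barLR p' := by
  let P : LR → Prop := fun r => ∃ p ∈ posPart v, ∃ c : ℤ, ∃ p' ∈ posPart v, r = p + c + barLR p'
  have hvv : v * barLR v = 1 := by
    rcases hv with rfl | rfl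
    · rw [barLR_q, q_mul_qInv]
    · rw [barLR_qInv, qInv_mul_q]
  have hadd : ∀ r s, P r → P s → P (r + s) := by
    rintro _ _ ⟨p, hp, c, p', hp', rfl⟩ ⟨s, hs, d, s', hs', rfl⟩
    exact ⟨p + s, add_mem hp hs, c + d, p' + s', add_mem hp' hs', by
      rw [map_add]; push_cast; ring⟩
  have hneg : ∀ r, P r → P (-r) := by
    rintro _ ⟨p, hp, c, p', hp', rfl⟩
    exact ⟨-p, neg_mem hp, -c, -p', neg_mem hp', by rw [map_neg]; push_cast; ring⟩
  have hbar : ∀ r, P r → P (barLR r) := by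
    rintro _ ⟨p, hp, c, p', hp', rfl⟩
    exact ⟨p', hp', c, p, hp, by rw [map_add, map_add, barLR_barLR, barLR_intCast]; ring⟩
  have hvmul : ∀ r, P r → P (v * r) := by
    rintro _ ⟨_, ⟨f, rfl⟩, c, _, ⟨g, rfl⟩, rfl⟩
    refine ⟨_, ⟨Polynomial.X * f + Polynomial.C c, rfl⟩, g.coeff 0, _, ⟨g.divX, rfl⟩, ?_⟩
    have hg : Polynomial.aeval v g =
        v * Polynomial.aeval v g.divX + (g.coeff 0 : LR) := by
      conv_lhs => rw [← Polynomial.divX_mul_X_add g]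
      simp [mul_comm]
    simp only [map_mul, map_add, Polynomial.aeval_X, hg, eq_intCast,
      map_intCast]
    linear_combination (barLR v * barLR (Polynomial.aeval v g.divX) + (g.coeff 0 : LR)) * hvv
  have hvmul' : ∀ r, P r → P (barLR v * r) := fun r h => by
    have := hbar _ (hvmul _ (hbar _ h))
    rwa [map_mul, barLR_barLR] at this
  have hq : ∀ r, P r → P (q * r) ∧ P (qInv * r) := by
    intro r h
    rcases hv with rfl | rfl
    · have := hvmul' r h
      rw [barLR_q] at this
      exact ⟨hvmul r h, this⟩
    · have := hvmul' r h
      rw [barLR_qInv] at this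
      exact ⟨this, hvmul r h⟩
  have key : ∀ s, P s → P (r * s) := by
    refine Subring.closure_induction (p := fun r _ => ∀ s, P s → P (r * s)) ?_ ?_ ?_ ?_ ?_ ?_ hr
    · rintro x (rfl | rfl) s hs
      exacts [(hq s hs).1, (hq s hs).2]
    · intro s _
      rw [zero_mul]
      exact ⟨0, zero_mem _, 0, 0, zero_mem _, by simp⟩
    · intro s hs
      rwa [one_mul]
    · intro x y _ _ hx hy s hs
      rw [add_mul]
      exact hadd _ _ (hx s hs) (hy s hs)
    · intro x _ hx s hs
      rw [neg_mul]
      exact hneg _ (hx s hs)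
    · intro x y _ _ hx hy s hs
      rw [mul_assoc]
      exact hx _ (hy s hs)
  have := key 1 ⟨0, zero_mem _, 1, 0, zero_mem _, by simp⟩
  rwa [mul_one] at this

/-- An antisymmetric element of `ℤ[q, q⁻¹]` is `p - bar p` for some `p ∈ v ℤ[v]`. -/
theorem exists_sub_barLR {v : LR} (hv : v = q ∨ v = qInv) {r : LR} (hr : r ∈ intLR)
    (h : barLR r = -r) : ∃ p ∈ posPart v, p - barLR p = r := by
  obtain ⟨p, hp, c, p', hp', rfl⟩ := exists_posPart_add hv hr
  refine ⟨p, hp, ?_⟩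
  rw [map_add, map_add, barLR_barLR, barLR_intCast] at h
  obtain ⟨h1, h2⟩ := eq_zero_of_add_add_barLR hv (add_mem hp hp') (add_mem hp hp') (c + c) (by
    rw [map_add]; push_cast; linear_combination h)
  have h3 : p' = -p := by linear_combination h1
  have h4 : (c : LR) = 0 := by
    have h5 : (2 : ℂ) • (c : LR) = 0 := by
      rw [two_smul]
      push_cast at h2
      exact h2
    exact (smul_eq_zero.1 h5).resolve_left two_ne_zero
  rw [h3, h4, map_neg]
  ring

theorem posPart_le_intLR {v : LR} (hv : v = q ∨ v = qInv) {p : LR} (hp : p ∈ posPart v) :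
    p ∈ intLR := by
  have hv' : v ∈ intLR := by
    rcases hv with rfl | rfl
    exacts [q_mem_intLR, qInv_mem_intLR]
  obtain ⟨f, rfl⟩ := hp
  generalize Polynomial.X * f = g
  induction g using Polynomial.induction_on' with
  | add f g hf hg => rw [map_add]; exact add_mem hf hg
  | monomial k a =>
    rw [Polynomial.aeval_monomial]
    exact mul_mem (intCast_mem _ a) (pow_mem hv' k)

/-! ### Existence and uniqueness of Kazhdan–Lusztig bases -/

theorem repr_of_mem_span_intLR {ι : Type} {M : Type} [AddCommGroup M] [Module LR M]
    (b : Module.Basis ι LR M) {S : Set ι} {m : M} (hm : m ∈ Submodule.span intLR (b '' S))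
    (j : ι) : b.repr m j ∈ intLR ∧ (j ∉ S → b.repr m j = 0) := by
  classical
  induction hm using Submodule.span_induction with
  | mem x hx =>
    obtain ⟨i, hi, rfl⟩ := hx
    rw [b.repr_self_apply]
    refine ⟨?_, fun hj => if_neg fun h : i = j => hj (h ▸ hi)⟩
    split_ifs
    exacts [one_mem _, zero_mem _]
  | zero => simp
  | add x y _ _ hx hy =>
    rw [map_add, Finsupp.add_apply]
    exact ⟨add_mem hx.1 hy.1, fun hj => by rw [hx.2 hj, hy.2 hj, add_zero]⟩
  | smul a x _ hx =>
    have : b.repr (a • x) j = a * b.repr x j := by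
      change b.repr ((a : LR) • x) j = _
      rw [map_smul, Finsupp.smul_apply, smul_eq_mul]
    rw [this]
    exact ⟨mul_mem a.2 hx.1, fun hj => by rw [hx.2 hj, mul_zero]⟩

variable {ι : Type} [Fintype ι] [PartialOrder ι] {M : Type} [AddCommGroup M] [Module LR M]
  {b : Module.Basis ι LR M} {ψ : M →+ M}

/-- A semilinear involution that is unitriangular on `b` acts on a coefficient that is maximal in
the support of `m` by the involution of the scalars. -/
theorem repr_apply_of_maximal (hs : ∀ (r : LR) m, ψ (r • m) = barLR r • ψ m)
    (hb : ∀ i, ψ (b i) - b i ∈ Submodule.span intLR (b '' Set.Iio i)) {m : M} {j : ι}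
    (hj : ∀ k, j < k → b.repr m k = 0) : b.repr (ψ m) j = barLR (b.repr m j) := by
  classical
  have h1 : b.repr (ψ m) j = ∑ k, barLR (b.repr m k) * b.repr (ψ (b k)) j := by
    conv_lhs => rw [← b.sum_repr m]
    rw [map_sum, map_sum, Finsupp.finsetSum_apply]
    refine Finset.sum_congr rfl fun k _ => ?_
    rw [hs, map_smul, Finsupp.smul_apply, smul_eq_mul]
  have h2 : ∀ k, b.repr (ψ (b k)) j = b.repr (ψ (b k) - b k) j + if k = j then 1 else 0 := by
    intro k
    rw [map_sub, Finsupp.sub_apply, b.repr_self_apply, sub_add_cancel]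
  rw [h1, Finset.sum_eq_single j]
  · rw [h2, (repr_of_mem_span_intLR b (hb j) j).2 (lt_irrefl j), if_pos rfl, zero_add, mul_one]
  · intro k _ hk
    by_cases hjk : j < k
    · rw [hj k hjk, map_zero, zero_mul]
    · rw [h2, (repr_of_mem_span_intLR b (hb k) j).2 hjk, if_neg hk, zero_add, mul_zero]
  · simp

/-- Uniqueness of Kazhdan–Lusztig elements: a bar-invariant element with coefficients in `v ℤ[v]`
vanishes. -/
theorem eq_zero_of_bar_invariant {v : LR} (hv : v = q ∨ v = qInv)
    (hs : ∀ (r : LR) m, ψ (r • m) = barLR r • ψ m)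
    (hb : ∀ i, ψ (b i) - b i ∈ Submodule.span intLR (b '' Set.Iio i)) {m : M}
    (hm : ψ m = m) (hp : ∀ j, b.repr m j ∈ posPart v) : m = 0 := by
  by_contra hne
  have hsupp : (b.repr m).support.Nonempty := by
    rw [Finsupp.support_nonempty_iff]
    exact fun h => hne (b.repr.map_eq_zero_iff.1 h)
  obtain ⟨j, hj, hmax⟩ := (b.repr m).support.exists_maximal hsupp
  have h1 := repr_apply_of_maximal hs hb (m := m) (j := j) fun k hk => by
    by_contra h
    exact absurd (hmax (Finsupp.mem_support_iff.2 h) hk.le) hk.not_ge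
  rw [hm] at h1
  exact Finsupp.mem_support_iff.1 hj (eq_zero_of_barLR_eq hv (hp j) h1.symm)

variable (b ψ)

/-- `c` is a Kazhdan–Lusztig element for `b i`: it is bar invariant and differs from `b i` by a
`v ℤ[v]`-linear combination of basis elements below `b i`. -/
def IsKLElement (v : LR) (i : ι) (c : M) : Prop :=
  ψ c = c ∧ ∀ k, b.repr (c - b i) k ∈ posPart v ∧ (¬ k < i → b.repr (c - b i) k = 0)

variable {b ψ}

/-- Given Kazhdan–Lusztig elements for the indices in a lower set `S`, every antisymmetric element
supported on `S` is of the form `m' - bar m'` with `m'` having coefficients in `v ℤ[v]`. The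
coefficients are treated one at a time, beginning with a maximal index. -/
theorem exists_sub_bar {v : LR} (hv : v = q ∨ v = qInv)
    (hs : ∀ (r : LR) m, ψ (r • m) = barLR r • ψ m)
    (hb : ∀ i, ψ (b i) - b i ∈ Submodule.span intLR (b '' Set.Iio i)) (c : ι → M)
    (S : Finset ι) (hS : IsLowerSet (S : Set ι)) (hc : ∀ j ∈ S, IsKLElement b ψ v j (c j)) (m : M)
    (hm : ψ m = -m) (hmS : ∀ k, b.repr m k ∈ intLR ∧ (k ∉ S → b.repr m k = 0)) :
    ∃ m', m' - ψ m' = m ∧ ∀ k, b.repr m' k ∈ posPart v ∧ (k ∉ S → b.repr m' k = 0) := by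
  classical
  induction h : S.card generalizing S m with
  | zero =>
    have : m = 0 := b.ext_elem fun k => by
      rw [(hmS k).2 (by rw [Finset.card_eq_zero.1 h]; simp), map_zero, Finsupp.zero_apply]
    exact ⟨0, by rw [this, map_zero, sub_zero], fun k => by simp⟩
  | succ n ih =>
    obtain ⟨j, hjS, hmax⟩ := S.exists_maximal (Finset.card_pos.1 (by omega))
    have hmax' : ∀ k ∈ S, ¬ j < k := fun k hk hlt => absurd (hmax hk hlt.le) hlt.not_ge
    have h1 := repr_apply_of_maximal hs hb (m := m) (j := j) fun k hk =>
      (hmS k).2 fun h => hmax' k h hk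
    rw [hm, map_neg, Finsupp.neg_apply] at h1
    obtain ⟨p, hp, hpr⟩ := exists_sub_barLR hv (hmS j).1 h1.symm
    obtain ⟨hc1, hc2⟩ := hc j hjS
    have hcr : ∀ k, b.repr (c j) k = b.repr (c j - b j) k + if j = k then 1 else 0 := by
      intro k
      rw [map_sub, Finsupp.sub_apply, b.repr_self_apply, sub_add_cancel]
    have hcj : b.repr (c j) j = 1 := by
      rw [hcr, (hc2 j).2 (lt_irrefl j), if_pos rfl, zero_add]
    have hc0 : ∀ k, k ∉ S → b.repr (c j) k = 0 := fun k hk => by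
      rw [hcr, (hc2 k).2 fun h => hk (hS h.le hjS), if_neg fun h : j = k => hk (h ▸ hjS), zero_add]
    have hpm : ∀ k, p * b.repr (c j) k ∈ posPart v := fun k => by
      rw [hcr, mul_add]
      refine add_mem (mul_mem_posPart hp (hc2 k).1) ?_
      split_ifs
      · rwa [mul_one]
      · rw [mul_zero]; exact zero_mem _
    have hci : ∀ k, b.repr (c j) k ∈ intLR := fun k => by
      rw [hcr]
      refine add_mem (posPart_le_intLR hv (hc2 k).1) ?_
      split_ifs
      exacts [one_mem _, zero_mem _]
    have hlow : IsLowerSet ((S.erase j : Finset ι) : Set ι) := by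
      intro x y hyx hx
      simp only [Finset.coe_erase, Set.mem_sdiff, Finset.mem_coe, Set.mem_singleton_iff] at hx ⊢
      refine ⟨hS hyx hx.1, fun hy => ?_⟩
      rw [hy] at hyx
      rcases hyx.eq_or_lt with h | h
      · exact hx.2 h.symm
      · exact hmax' x hx.1 h
    obtain ⟨m1, hm1, hm1'⟩ := ih (S.erase j) hlow
      (fun k hk => hc k (Finset.mem_of_mem_erase hk)) (m - b.repr m j • c j)
      (by rw [map_sub, hs, hc1, hm, ← h1, neg_smul]; abel)
      (fun k => by
        rw [map_sub, map_smul, Finsupp.sub_apply, Finsupp.smul_apply, smul_eq_mul]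
        refine ⟨sub_mem (hmS k).1 (mul_mem (hmS j).1 (hci k)), fun hk => ?_⟩
        by_cases hkj : k = j
        · rw [hkj, hcj, mul_one, sub_self]
        · have hkS : k ∉ S := fun h => hk (Finset.mem_erase.2 ⟨hkj, h⟩)
          rw [(hmS k).2 hkS, hc0 k hkS, mul_zero, sub_zero])
      (by rw [Finset.card_erase_of_mem hjS, h]; rfl)
    refine ⟨m1 + p • c j, ?_, fun k => ?_⟩
    · rw [map_add, hs, hc1, add_sub_add_comm, hm1, ← sub_smul, hpr, sub_add_cancel]
    · rw [map_add, map_smul, Finsupp.add_apply, Finsupp.smul_apply, smul_eq_mul]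
      exact ⟨add_mem (hm1' k).1 (hpm k), fun hk => by
        rw [(hm1' k).2 fun h => hk (Finset.mem_of_mem_erase h), hc0 k hk, mul_zero, add_zero]⟩

theorem exists_isKLElement {v : LR} (hv : v = q ∨ v = qInv)
    (hs : ∀ (r : LR) m, ψ (r • m) = barLR r • ψ m) (hψ : ∀ m, ψ (ψ m) = m)
    (hb : ∀ i, ψ (b i) - b i ∈ Submodule.span intLR (b '' Set.Iio i)) (i : ι) :
    ∃ c, IsKLElement b ψ v i c := by
  classical
  induction i using WellFoundedLT.induction with
  | _ i ih =>
    let c : ι → M := fun j => if h : j < i then (ih j h).choose else 0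
    obtain ⟨m', h1, h2⟩ := exists_sub_bar hv hs hb c (Finset.univ.filter (· < i))
      (fun x y hyx hx => by
        simp only [Finset.coe_filter, Finset.mem_univ, true_and, Set.mem_ofPred_eq] at hx ⊢
        exact hyx.trans_lt hx)
      (fun j hj => by
        have hji : j < i := (Finset.mem_filter.1 hj).2
        simp only [c, dif_pos hji]
        exact (ih j hji).choose_spec)
      (ψ (b i) - b i) (by rw [map_sub, hψ, neg_sub])
      (fun k => by simpa using repr_of_mem_span_intLR b (hb i) k)
    refine ⟨b i + m', ?_, fun k => ?_⟩
    · have : ψ (b i) = b i + (m' - ψ m') := by rw [h1]; abel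
      rw [map_add, this]; abel
    · rw [add_sub_cancel_left]
      simpa using h2 k

/-! ### Unitriangular changes of basis -/

/-- A family that is unitriangular with respect to a basis is a basis, and the inverse change of
basis is unitriangular too. -/
theorem exists_basis_of_unitriangular (c : ι → M)
    (hc : ∀ i, c i - b i ∈ Submodule.span LR (b '' Set.Iio i)) :
    ∃ K : Module.Basis ι LR M, (K : ι → M) = c ∧
      ∀ (i : ι) (m : M), m - b i ∈ Submodule.span LR (b '' Set.Iio i) →
        K.repr m i = 1 ∧ ∀ j, ¬ j ≤ i → K.repr m j = 0 := by
  classical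
  have hbc : ∀ i, b i - c i ∈ Submodule.span LR (c '' Set.Iio i) := by
    intro i
    induction i using WellFoundedLT.induction with
    | _ i ih =>
      have hle : Submodule.span LR (b '' Set.Iio i) ≤ Submodule.span LR (c '' Set.Iio i) := by
        rw [Submodule.span_le]
        rintro _ ⟨j, hj, rfl⟩
        have h1 := Submodule.span_mono (R := LR)
          (Set.image_mono (f := c) (Set.Iio_subset_Iio hj.le)) (ih j hj)
        have h2 : c j ∈ Submodule.span LR (c '' Set.Iio i) := Submodule.subset_span ⟨j, hj, rfl⟩
        simpa using add_mem h1 h2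
      rw [← neg_sub]
      exact neg_mem (hle (hc i))
  have hle : ∀ i, Submodule.span LR (b '' Set.Iio i) ≤ Submodule.span LR (c '' Set.Iio i) := by
    intro i
    rw [Submodule.span_le]
    rintro _ ⟨j, hj, rfl⟩
    have h1 := Submodule.span_mono (R := LR)
      (Set.image_mono (f := c) (Set.Iio_subset_Iio hj.le)) (hbc j)
    have h2 : c j ∈ Submodule.span LR (c '' Set.Iio i) := Submodule.subset_span ⟨j, hj, rfl⟩
    simpa using add_mem h1 h2
  have hspan : ⊤ ≤ Submodule.span LR (Set.range c) := by
    rw [← b.span_eq, Submodule.span_le]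
    rintro _ ⟨i, rfl⟩
    have h1 := Submodule.span_mono (R := LR) (Set.image_subset_range c _) (hbc i)
    have h2 : c i ∈ Submodule.span LR (Set.range c) := Submodule.subset_span ⟨i, rfl⟩
    simpa using add_mem h1 h2
  have hcr : ∀ i k, b.repr (c i) k = b.repr (c i - b i) k + if i = k then 1 else 0 := by
    intro i k
    rw [map_sub, Finsupp.sub_apply, b.repr_self_apply, sub_add_cancel]
  have hc0 : ∀ i k, ¬ k < i → b.repr (c i - b i) k = 0 := by
    intro i k hk
    by_contra h
    exact hk ((b.mem_span_image.1 (hc i)) (Finsupp.mem_support_iff.2 h))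
  have hind : LinearIndependent LR c := by
    rw [Fintype.linearIndependent_iff]
    intro a ha
    by_contra! hne
    obtain ⟨j, hj, hmax⟩ := (Finset.univ.filter fun i => a i ≠ 0).exists_maximal
      (by obtain ⟨i, hi⟩ := hne; exact ⟨i, by simpa using hi⟩)
    have h1 := congrArg (fun m => b.repr m j) ha
    simp only [map_sum, map_smul, map_zero, Finsupp.finsetSum_apply, Finsupp.smul_apply,
      smul_eq_mul, Finsupp.zero_apply] at h1
    rw [Finset.sum_eq_single j] at h1
    · rw [hcr, hc0 j j (lt_irrefl j), if_pos rfl, zero_add, mul_one] at h1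
      exact (Finset.mem_filter.1 hj).2 h1
    · intro k _ hk
      by_cases hjk : j < k
      · have : a k = 0 := by
          by_contra h
          exact absurd (hmax (by simpa using h) hjk.le) hjk.not_ge
        rw [this, zero_mul]
      · rw [hcr, hc0 k j hjk, if_neg hk, zero_add, mul_zero]
    · simp
  let K := Module.Basis.mk hind hspan
  have hK : (K : ι → M) = c := Module.Basis.coe_mk _ _
  refine ⟨K, hK, fun i m hm => ?_⟩
  have h1 : m - K i ∈ Submodule.span LR (K '' Set.Iio i) := by
    rw [hK]
    have := add_mem (hle i hm) (hbc i)
    simpa using this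
  have h2 : ∀ j, ¬ j < i → K.repr (m - K i) j = 0 := by
    intro j hj
    by_contra h
    exact hj ((K.mem_span_image.1 h1) (Finsupp.mem_support_iff.2 h))
  have h3 : ∀ j, K.repr m j = K.repr (m - K i) j + if i = j then 1 else 0 := by
    intro j
    rw [map_sub, Finsupp.sub_apply, K.repr_self_apply, sub_add_cancel]
  refine ⟨by rw [h3, h2 i (lt_irrefl i), if_pos rfl, zero_add], fun j hj => ?_⟩
  rw [h3, h2 j fun h => hj h.le, if_neg fun h => hj h.ge, zero_add]

end KazhdanLusztig

section InducedModule

variable {Φ : CType} {d : ℕ}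

/-! ### The parabolic Kazhdan–Lusztig basis of the induced module -/

/-- The Bruhat order on the shortest coset representatives. -/
abbrev bruhatPartialOrder (J : Set (Idx Φ d)) : PartialOrder (minReps J) where
  le x y := BruhatLE (x : Weyl Φ d) (y : Weyl Φ d)
  le_refl x := BruhatLE.refl _
  le_trans _ _ _ h h' := h.trans h'
  le_antisymm _ _ h h' := Subtype.ext (h.antisymm h')

/-- The parabolic Kazhdan–Lusztig basis exists, is unique, is a basis, and elements that are
unitriangular with respect to the standard basis are unitriangular with respect to it. -/
theorem exists_isKLBasis (J : Set (Idx Φ d)) {v : LR} (hv : v = q ∨ v = qInv) :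
    ∃ K : Module.Basis (minReps J) LR (Ind J),
      (∀ m : minReps J → Ind J, IsKLBasis J v m ↔ m = K) ∧
      ∀ (x : minReps J) (m : Ind J),
        m - stdElt J x ∈ Submodule.span LR (stdBasis J ''
          {y : minReps J | BruhatLE (y : Weyl Φ d) (x : Weyl Φ d) ∧ y ≠ x}) →
        K.repr m x = 1 ∧ ∀ y : minReps J, ¬ BruhatLE (y : Weyl Φ d) (x : Weyl Φ d) →
          K.repr m y = 0 := by
  classical
  let _ := bruhatPartialOrder J
  have hIio : ∀ x : minReps J,
      Set.Iio x = {y : minReps J | BruhatLE (y : Weyl Φ d) (x : Weyl Φ d) ∧ y ≠ x} := fun x =>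
    Set.ext fun y => by rw [Set.mem_Iio, lt_iff_le_and_ne]; rfl
  let ψ : Ind J →+ Ind J := (barInd J).toAddMonoidHom
  have hs : ∀ (r : LR) m, ψ (r • m) = barLR r • ψ m := barInd_smul J
  have hψ : ∀ m, ψ (ψ m) = m := barInd_barInd J
  have hb : ∀ x, ψ (stdBasis J x) - stdBasis J x ∈
      Submodule.span intLR (stdBasis J '' Set.Iio x) := fun x => by
    rw [hIio, stdBasis_apply]
    exact barInd_stdElt_sub_mem J x
  choose c hc using exists_isKLElement hv hs hψ hb
  have hc' : ∀ x, c x - stdBasis J x ∈ Submodule.span LR (stdBasis J '' Set.Iio x) := fun x => by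
    rw [Module.Basis.mem_span_image]
    intro k hk
    by_contra h
    exact Finsupp.mem_support_iff.1 hk (((hc x).2 k).2 h)
  obtain ⟨K, hK, hKr⟩ := exists_basis_of_unitriangular c hc'
  -- The coefficient condition in the definition of the Kazhdan–Lusztig basis, in coordinates.
  have hiff : ∀ (x : minReps J) (m : Ind J), (∃ p : minReps J → ℤ[X], m = stdElt J x +
      ∑ y, Polynomial.aeval v (Polynomial.X * p y) • stdElt J (y : Weyl Φ d)) ↔
      ∀ y, (stdBasis J).repr (m - stdBasis J x) y ∈ posPart v := by
    intro x m
    constructor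
    · rintro ⟨p, rfl⟩ y
      refine ⟨p y, ?_⟩
      rw [stdBasis_apply, add_sub_cancel_left]
      simp only [← stdBasis_apply]
      rw [Module.Basis.repr_sum_self]
    · intro h
      choose p hp using h
      refine ⟨p, ?_⟩
      simp only [← hp, ← stdBasis_apply]
      rw [Module.Basis.sum_repr, add_sub_cancel]
  refine ⟨K, fun m => ⟨fun hm => ?_, ?_⟩, fun x m hm => ?_⟩
  · rw [hK]
    funext x
    rw [← sub_eq_zero]
    refine eq_zero_of_bar_invariant hv hs hb ?_ fun y => ?_
    · rw [map_sub, (hc x).1]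
      congr 1
      exact (hm x).1
    · have e : m x - c x = (m x - stdBasis J x) - (c x - stdBasis J x) := by abel
      rw [e, map_sub, Finsupp.sub_apply]
      exact sub_mem ((hiff x _).1 (hm x).2 y) ((hc x).2 y).1
  · rintro rfl x
    rw [hK]
    exact ⟨(hc x).1, (hiff x _).2 fun y => ((hc x).2 y).1⟩
  · exact hKr x m (by rwa [hIio, stdBasis_apply])

end InducedModule

section Reflections

variable {Φ : CType} {d : ℕ}

/-! ### Reflections exchanging two given letters -/

/-- There is a reflection exchanging `a` with `b` (hence `-a` with `-b`) and fixing all other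
letters. -/
def HasSwap (Φ : CType) (d : ℕ) (a b : ℤ) : Prop :=
  ∃ t : Weyl Φ d, IsReflection t ∧ (t : Equiv.Perm ℤ) a = b ∧
    ∀ k, k ≠ a → k ≠ b → k ≠ -a → k ≠ -b → (t : Equiv.Perm ℤ) k = k

theorem HasSwap.symm {a b : ℤ} (h : HasSwap Φ d a b) : HasSwap Φ d b a := by
  obtain ⟨t, ht, h1, h2⟩ := h
  exact ⟨t, ht, by rw [← h1, ht.apply_apply], fun k ha hb ha' hb' => h2 k hb ha hb' ha'⟩

theorem HasSwap.neg {a b : ℤ} (h : HasSwap Φ d a b) : HasSwap Φ d (-a) (-b) := by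
  obtain ⟨t, ht, h1, h2⟩ := h
  refine ⟨t, ht, by rw [Weyl.apply_neg, h1], fun k ha hb ha' hb' => h2 k ?_ ?_ ha hb⟩
  · rwa [neg_neg] at ha'
  · rwa [neg_neg] at hb'

theorem HasSwap.conj {a b : ℤ} (h : HasSwap Φ d a b) (w : Weyl Φ d) :
    HasSwap Φ d ((w : Equiv.Perm ℤ) a) ((w : Equiv.Perm ℤ) b) := by
  obtain ⟨t, ht, h1, h2⟩ := h
  refine ⟨w * t * w⁻¹, ht.conj w, ?_, fun k => ?_⟩
  · simp only [Weyl.mul_apply, Weyl.inv_apply_self, h1]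
  · obtain ⟨k, rfl⟩ := (w : Equiv.Perm ℤ).surjective k
    simp only [← Weyl.apply_neg, (w : Equiv.Perm ℤ).injective.ne_iff, Weyl.mul_apply,
      Weyl.inv_apply_self, (w : Equiv.Perm ℤ).injective.eq_iff]
    exact h2 k

theorem hasSwap_of_pos_lt {a b : ℕ} (ha : 1 ≤ a) (hab : a < b) (hb : b ≤ d) :
    HasSwap Φ d a b := by
  induction b, hab using Nat.le_induction with
  | base =>
    refine ⟨simple ⟨a, by omega, fun _ => ha⟩, isReflection_simple _, ?_,
      fun k h1 h2 h3 h4 => ?_⟩ <;>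
    · rw [simple_apply, simplePerm_apply]
      simp only [Nat.cast_add, Nat.cast_one, Nat.succ_eq_add_one] at *
      split_ifs <;> omega
  | succ b hab ih =>
    have h := (ih (by omega)).conj (simple ⟨b, by omega, fun _ => by omega⟩)
    rw [simple_apply, simple_apply, simplePerm_apply, simplePerm_apply] at h
    convert h using 1 <;> (push_cast; split_ifs <;> omega)

theorem hasSwap_neg_self {b : ℕ} (hb : 1 ≤ b) (hbd : b ≤ d) : HasSwap CType.B d (-b) b := by
  induction b, hb using Nat.le_induction with
  | base =>
    refine ⟨simple ⟨0, by omega, fun h => by cases h⟩, isReflection_simple _, ?_,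
      fun k h1 h2 h3 h4 => ?_⟩
    · simp [simple_apply, simplePerm_apply]
    · rw [simple_apply, simplePerm_apply]
      push_cast at *
      split_ifs <;> omega
  | succ b hb ih =>
    have h := (ih (by omega)).conj (simple ⟨b, by omega, fun _ => by omega⟩)
    rw [simple_apply, simple_apply, simplePerm_apply, simplePerm_apply] at h
    convert h using 1 <;> (push_cast; split_ifs <;> omega)

theorem hasSwap_of_pos {a b : ℤ} (ha : 0 < a) (hb : 0 < b) (hab : a ≠ b) (had : a ≤ d)
    (hbd : b ≤ d) : HasSwap Φ d a b := by
  lift a to ℕ using ha.le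
  lift b to ℕ using hb.le
  rcases lt_or_gt_of_ne hab with h | h
  · exact hasSwap_of_pos_lt (by omega) (by omega) (by omega)
  · exact (hasSwap_of_pos_lt (by omega) (by omega) (by omega)).symm

theorem hasSwap_of_pos_of_neg {a b : ℤ} (ha : 0 < a) (hb : b < 0) (had : a ≤ d) (hbd : -b ≤ d) :
    HasSwap CType.B d a b := by
  have hs : HasSwap CType.B d b (-b) := by
    have := hasSwap_neg_self (d := d) (b := (-b).toNat) (by omega) (by omega)
    rwa [show (((-b).toNat : ℕ) : ℤ) = -b by omega, neg_neg] at this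
  by_cases hab : a = -b
  · rw [hab]
    exact hs.symm
  · obtain ⟨t, ht, h1, h2⟩ := hs
    have h := (hasSwap_of_pos (Φ := CType.B) ha (b := -b) (by omega) hab had hbd).conj t
    rwa [h2 a (by omega) hab hab (by omega), Weyl.apply_neg, h1, neg_neg] at h

theorem hasSwap {a b : ℤ} (ha : a ≠ 0) (hb : b ≠ 0) (hab : a ≠ b) (had : |a| ≤ d) (hbd : |b| ≤ d)
    (hA : Φ = CType.A → 0 < a ∧ 0 < b) : HasSwap Φ d a b := by
  rw [abs_le] at had hbd
  cases Φ with
  | A =>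
    obtain ⟨h1, h2⟩ := hA rfl
    exact hasSwap_of_pos h1 h2 hab had.2 hbd.2
  | B =>
    rcases lt_or_gt_of_ne ha with h1 | h1 <;> rcases lt_or_gt_of_ne hb with h2 | h2
    · have := (hasSwap_of_pos (Φ := CType.B) (d := d) (a := -a) (b := -b) (by omega) (by omega)
        (by omega) (by omega) (by omega)).neg
      rwa [neg_neg, neg_neg] at this
    · exact (hasSwap_of_pos_of_neg h2 h1 (by omega) (by omega)).symm
    · exact hasSwap_of_pos_of_neg h1 h2 (by omega) (by omega)
    · exact hasSwap_of_pos h1 h2 hab had.2 hbd.2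

end Reflections

section Tableaux

variable {Φ : CType} {d : ℕ} {lam : Shape d Φ}

/-! ### Row-reading words -/

theorem apply_eq_self_of_strictMono {α : Type*} [LinearOrder α] [Finite α] {f : α → α}
    (hf : StrictMono f) (x : α) : f x = x := le_antisymm hf.apply_le hf.le_apply

theorem finite_letters (lam : Shape d Φ) : (letters lam).Finite :=
  (Set.finite_Icc (-(d : ℤ)) d).subset fun x hx => abs_le.1 (letters_abs_le x hx)

theorem mem_letters_of_pos {x : ℤ} (h1 : 1 ≤ x) (h2 : x ≤ d) : x ∈ letters lam := by
  cases lam with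
  | a parts pos sum => exact ⟨h1, h2⟩
  | bOdd m parts pos sum => exact ⟨by omega, h2⟩
  | bEven parts pos sum => exact ⟨⟨by omega, h2⟩, by simp; omega⟩

theorem Weyl.ext_letters {v w : Weyl Φ d}
    (h : ∀ x ∈ letters lam, (v : Equiv.Perm ℤ) x = (w : Equiv.Perm ℤ) x) : v = w := by
  refine Weyl.ext_apply fun k => ?_
  by_cases hk : |k| ≤ d
  · rw [_root_.abs_le] at hk
    rcases lt_trichotomy k 0 with h0 | h0 | h0
    · have := h (-k) (mem_letters_of_pos (by omega) (by omega))
      rw [Weyl.apply_neg, Weyl.apply_neg] at this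
      omega
    · rw [h0, Weyl.apply_zero, Weyl.apply_zero]
    · exact h k (mem_letters_of_pos (by omega) (by omega))
  · rw [Weyl.apply_of_lt v (not_le.1 hk), Weyl.apply_of_lt w (not_le.1 hk)]

theorem Tableau.entry_mem (T : Tableau lam) (b : diagram lam) : T.entry b ∈ letters lam :=
  T.range_eq ▸ Set.mem_range_self b

theorem Tableau.exists_entry (T : Tableau lam) {x : ℤ} (hx : x ∈ letters lam) :
    ∃ b, T.entry b = x := by
  rwa [← T.range_eq] at hx

theorem Tableau.ext_entry {T T' : Tableau lam} (h : ∀ b, T.entry b = T'.entry b) : T = T' := by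
  have := funext h
  cases T
  cases T'
  subst this
  rfl

theorem Tableau.word_lt (T : Tableau lam) {b b' : diagram lam} (h : ReadBefore b b') :
    (T.word : Equiv.Perm ℤ) (T.entry b) < (T.word : Equiv.Perm ℤ) (T.entry b') :=
  (exists_reading T).choose_spec b b' h

theorem readBefore_or (b b' : diagram lam) : ReadBefore b b' ∨ b = b' ∨ ReadBefore b' b := by
  have : b = b' ↔ b.1.1 = b'.1.1 ∧ b.1.2 = b'.1.2 := by rw [Subtype.ext_iff, Prod.ext_iff]
  rw [this]
  simp only [ReadBefore]
  omega

theorem Tableau.word_lt_iff (T : Tableau lam) {b b' : diagram lam} :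
    (T.word : Equiv.Perm ℤ) (T.entry b) < (T.word : Equiv.Perm ℤ) (T.entry b') ↔
      ReadBefore b b' := by
  refine ⟨fun h => ?_, T.word_lt⟩
  rcases readBefore_or b b' with h1 | rfl | h1
  · exact h1
  · exact absurd h (lt_irrefl _)
  · exact absurd h (T.word_lt h1).not_gt

/-- The position of a box in the reading order does not depend on the tableau. -/
theorem reading_unique (T T' : Tableau lam) (u u' : Weyl Φ d)
    (h : ∀ b b' : diagram lam, ReadBefore b b' →
      (u : Equiv.Perm ℤ) (T.entry b) < (u : Equiv.Perm ℤ) (T.entry b'))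
    (h' : ∀ b b' : diagram lam, ReadBefore b b' →
      (u' : Equiv.Perm ℤ) (T'.entry b) < (u' : Equiv.Perm ℤ) (T'.entry b')) (b : diagram lam) :
    (u : Equiv.Perm ℤ) (T.entry b) = (u' : Equiv.Perm ℤ) (T'.entry b) := by
  have : Finite (letters lam) := finite_letters lam
  have hsurj : ∀ x : letters lam, ∃ b, (u : Equiv.Perm ℤ) (T.entry b) = x := fun x => by
    obtain ⟨b, hb⟩ := T.exists_entry (apply_mem_letters u⁻¹ x.2)
    exact ⟨b, by rw [hb, Weyl.apply_inv_self]⟩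
  choose g hg using hsurj
  let f : letters lam → letters lam := fun x =>
    ⟨(u' : Equiv.Perm ℤ) (T'.entry (g x)), apply_mem_letters u' (T'.entry_mem _)⟩
  have hf : StrictMono f := by
    intro x y hxy
    refine h' _ _ ?_
    rcases readBefore_or (g x) (g y) with h1 | h1 | h1
    · exact h1
    · have := hg x
      rw [h1, hg y] at this
      exact absurd this (ne_of_gt hxy)
    · have := h _ _ h1
      rw [hg, hg] at this
      exact absurd hxy (not_lt.2 (le_of_lt this))
  have h1 := congrArg Subtype.val (apply_eq_self_of_strictMono hf
    ⟨(u : Equiv.Perm ℤ) (T.entry b), apply_mem_letters u (T.entry_mem b)⟩)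
  have h2 := hg ⟨(u : Equiv.Perm ℤ) (T.entry b), apply_mem_letters u (T.entry_mem b)⟩
  have h3 := T.injective ((u : Equiv.Perm ℤ).injective h2)
  simp only [f, h3] at h1
  exact h1.symm

theorem Tableau.word_act (T : Tableau lam) (w : Weyl Φ d) : (T.act w).word = T.word * w := by
  refine Weyl.ext_letters (lam := lam) fun x hx => ?_
  obtain ⟨b, rfl⟩ := (T.act w).exists_entry hx
  refine reading_unique (T.act w) (T.act w) _ _ (fun _ _ => (T.act w).word_lt) (fun b b' h => ?_) b
  have : ∀ b, ((T.word * w : Weyl Φ d) : Equiv.Perm ℤ) ((T.act w).entry b) =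
      (T.word : Equiv.Perm ℤ) (T.entry b) := fun b => by
    rw [Weyl.mul_apply]
    exact congrArg _ (Weyl.apply_inv_self w _)
  rw [this, this]
  exact T.word_lt h

theorem Tableau.word_injective : Function.Injective (Tableau.word : Tableau lam → Weyl Φ d) := by
  intro T R h
  refine Tableau.ext_entry fun b => ?_
  have := reading_unique T R T.word R.word (fun _ _ => T.word_lt) (fun _ _ => R.word_lt) b
  rw [h] at this
  exact (R.word : Equiv.Perm ℤ).injective this

theorem Tableau.neg_box (T : Tableau lam) (hB : Φ = CType.B) (b : diagram lam) :
    ∃ b' : diagram lam, (b' : ℤ × ℤ) = -b ∧ T.entry b' = -T.entry b :=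
  ⟨⟨-b, diagram_symm hB _ b.2⟩, rfl, T.symmetric hB _ _ rfl⟩

/-! ### Exchanging two entries of a row or of a column -/

/-- Two nonzero entries in the same row (`f` the row number) or in the same column (`f` the column
number) are exchanged by a reflection that preserves all rows or all columns, respectively.
Additivity of `f` serves to treat `-b` along with `b` in type `B`. -/
theorem Tableau.exists_reflection (T : Tableau lam) (f : ℤ × ℤ →+ ℤ) {c₁ c₂ : diagram lam}
    (hf : f c₁ = f c₂) (hne : c₁ ≠ c₂) (h1 : T.entry c₁ ≠ 0) (h2 : T.entry c₂ ≠ 0) :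
    ∃ t : Weyl Φ d, IsReflection t ∧ (t : Equiv.Perm ℤ) (T.entry c₁) = T.entry c₂ ∧
      ∀ b : diagram lam, ∃ b' : diagram lam, f b' = f b ∧
        (t : Equiv.Perm ℤ) (T.entry b) = T.entry b' := by
  have hpos : Φ = CType.A → ∀ b, 0 < T.entry b := fun hA b => by
    have := (letters_pos hA _).1 (T.entry_mem b)
    omega
  obtain ⟨t, ht, hab, hk⟩ := hasSwap (Φ := Φ) (d := d) h1 h2 (T.injective.ne hne)
    (letters_abs_le _ (T.entry_mem _)) (letters_abs_le _ (T.entry_mem _))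
    (fun hA => ⟨hpos hA _, hpos hA _⟩)
  have hba : (t : Equiv.Perm ℤ) (T.entry c₂) = T.entry c₁ := by rw [← hab, ht.apply_apply]
  -- In type `B` the images of `-c₁` and `-c₂` are found by symmetry.
  have hneg : ∀ (b c c' : diagram lam), T.entry b = -T.entry c → f c' = f c →
      (t : Equiv.Perm ℤ) (T.entry c) = T.entry c' → ∃ b' : diagram lam, f b' = f b ∧
        (t : Equiv.Perm ℤ) (T.entry b) = T.entry b' := by
    intro b c c' hbc hcc htc
    cases Φ with
    | A =>
      have := hpos rfl b
      have := hpos rfl c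
      omega
    | B =>
      obtain ⟨n, hn, hn'⟩ := T.neg_box rfl c
      obtain ⟨n', hm, hm'⟩ := T.neg_box rfl c'
      have hbn : b = n := T.injective (by rw [hbc, hn'])
      refine ⟨n', ?_, ?_⟩
      · rw [hm, hbn, hn, map_neg, map_neg, hcc]
      · rw [hbc, Weyl.apply_neg, htc, hm']
  refine ⟨t, ht, hab, fun b => ?_⟩
  by_cases e1 : T.entry b = T.entry c₁
  · exact ⟨c₂, by rw [T.injective e1, hf], by rw [e1, hab]⟩
  by_cases e2 : T.entry b = T.entry c₂
  · exact ⟨c₁, by rw [T.injective e2, hf], by rw [e2, hba]⟩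
  by_cases e3 : T.entry b = -T.entry c₁
  · exact hneg b c₁ c₂ e3 hf.symm hab
  by_cases e4 : T.entry b = -T.entry c₂
  · exact hneg b c₂ c₁ e4 hf hba
  exact ⟨b, rfl, hk _ e1 e2 e3 e4⟩

/-- If `w` reverses the order of two entries in the same row or column of `T`, then it inverts a
reflection that preserves the rows or columns of `T`. -/
theorem Tableau.exists_reflection_of_lt (T : Tableau lam) (f : ℤ × ℤ →+ ℤ) (w : Weyl Φ d)
    {b₁ b₂ : diagram lam} (hf : f b₁ = f b₂) (hlt : T.entry b₁ < T.entry b₂)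
    (hw : (w : Equiv.Perm ℤ) (T.entry b₂) < (w : Equiv.Perm ℤ) (T.entry b₁)) :
    ∃ t : Weyl Φ d, IsReflection t ∧
      (∀ b : diagram lam, ∃ b' : diagram lam, f b' = f b ∧
        (t : Equiv.Perm ℤ) (T.entry b) = T.entry b') ∧
      ∃ c₁ c₂ : diagram lam, f c₁ = f c₂ ∧ T.entry c₁ < T.entry c₂ ∧
        (t : Equiv.Perm ℤ) (T.entry c₁) = T.entry c₂ ∧
        (w : Equiv.Perm ℤ) (T.entry c₂) < (w : Equiv.Perm ℤ) (T.entry c₁) := by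
  -- The letter `0` is not moved by `W`; a pair `0`, `x` is replaced by the pair `-x`, `x`.
  have hzero : ∀ b : diagram lam, T.entry b = 0 → Φ = CType.B ∧ f b = 0 := by
    intro b hb
    have hB : Φ = CType.B := by
      cases Φ with
      | A =>
        have := (letters_pos rfl _).1 (T.entry_mem b)
        omega
      | B => rfl
    obtain ⟨n, hn, hn'⟩ := T.neg_box hB b
    have e : n = b := T.injective (by rw [hn', hb, neg_zero])
    have := congrArg f hn
    rw [e, map_neg] at this
    exact ⟨hB, by omega⟩
  obtain ⟨c₁, c₂, hc, hclt, hcw, h1, h2⟩ : ∃ c₁ c₂ : diagram lam, f c₁ = f c₂ ∧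
      T.entry c₁ < T.entry c₂ ∧ (w : Equiv.Perm ℤ) (T.entry c₂) < (w : Equiv.Perm ℤ) (T.entry c₁) ∧
      T.entry c₁ ≠ 0 ∧ T.entry c₂ ≠ 0 := by
    by_cases h1 : T.entry b₁ = 0
    · obtain ⟨hB, h0⟩ := hzero _ h1
      obtain ⟨n, hn, hn'⟩ := T.neg_box hB b₂
      rw [h1, Weyl.apply_zero] at hw
      refine ⟨n, b₂, ?_, by omega, ?_, by omega, by omega⟩
      · rw [hn, map_neg, ← hf, h0, neg_zero]
      · rw [hn', Weyl.apply_neg]; omega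
    · by_cases h2 : T.entry b₂ = 0
      · obtain ⟨hB, h0⟩ := hzero _ h2
        obtain ⟨n, hn, hn'⟩ := T.neg_box hB b₁
        rw [h2, Weyl.apply_zero] at hw
        refine ⟨b₁, n, ?_, by omega, ?_, by omega, by omega⟩
        · rw [hn, map_neg, hf, h0, neg_zero]
        · rw [hn', Weyl.apply_neg]; omega
      · exact ⟨b₁, b₂, hf, hlt, hw, h1, h2⟩
  obtain ⟨t, ht, htc, htb⟩ := T.exists_reflection f hc (fun h => by rw [h] at hclt; omega) h1 h2
  exact ⟨t, ht, htb, c₁, c₂, hc, hclt, htc, hcw⟩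

/-! ### Row standard tableaux are minimal in their row equivalence class -/

theorem Tableau.IsRowStd.eq_of_equiv {R R' : Tableau lam} (hR : R.IsRowStd) (hR' : R'.IsRowStd)
    (h : R ≈ R') : R = R' := by
  refine Tableau.ext_entry fun b => ?_
  let α : Type := {j : ℤ // (b.1.1, j) ∈ diagram lam}
  let box : α → diagram lam := fun j => ⟨(b.1.1, j.1), j.2⟩
  have hbox : Function.Injective box := fun j k h =>
    Subtype.ext (congrArg (fun z => z.1.2) h)
  have : Finite α := by
    have : Finite (letters lam) := finite_letters lam
    refine Finite.of_injective (fun j : α => (⟨R.entry (box j), R.entry_mem _⟩ : letters lam)) ?_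
    intro j k h
    exact hbox (R.injective (congrArg Subtype.val h))
  have hex : ∀ j : α, ∃ k : α, R'.entry (box k) = R.entry (box j) := by
    intro j
    obtain ⟨c, hc⟩ := R'.exists_entry (R.entry_mem (box j))
    have h1 : b.1.1 = c.1.1 := h (box j) c hc.symm
    refine ⟨⟨c.1.2, ?_⟩, ?_⟩
    · rw [h1]; exact c.2
    · rw [← hc]
      congr 1
      exact Subtype.ext (Prod.ext h1 rfl)
  choose g hg using hex
  have hmono : StrictMono g := by
    intro j k hjk
    have h1 := hR (box j) (box k) rfl hjk
    rw [← hg, ← hg] at h1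
    by_contra hn
    rcases (not_lt.1 hn).eq_or_lt with h2 | h2
    · rw [h2] at h1; exact lt_irrefl _ h1
    · exact lt_asymm h1 (hR' (box (g k)) (box (g j)) rfl h2)
  have := hg ⟨b.1.2, b.2⟩
  rw [apply_eq_self_of_strictMono hmono] at this
  exact this.symm

/-- Sorting the rows of a tableau decreases its word in the Bruhat order. -/
theorem Tableau.IsRowStd.word_bruhatLE {R : Tableau lam} (hR : R.IsRowStd) (T : Tableau lam)
    (h : R ≈ T) : BruhatLE R.word T.word := by
  induction hn : len T.word using Nat.strong_induction_on generalizing T with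
  | _ n ih =>
    by_cases hT : T.IsRowStd
    · rw [hR.eq_of_equiv hT h]
      exact BruhatLE.refl _
    · simp only [Tableau.IsRowStd, not_forall, not_lt] at hT
      obtain ⟨b, b', hrow, hcol, hle⟩ := hT
      have hlt : T.entry b' < T.entry b := lt_of_le_of_ne hle fun e => by
        rw [T.injective e] at hcol
        omega
      obtain ⟨t, ht, htb, c₁, c₂, _, hc, htc, hw⟩ := T.exists_reflection_of_lt
        (AddMonoidHom.fst ℤ ℤ) T.word hrow.symm hlt (T.word_lt (Or.inr ⟨hrow, hcol⟩))
      have hinv : Inverts T.word t := ⟨T.entry c₁, by rwa [htc], by rwa [htc]⟩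
      have hequiv : T.act t ≈ T := by
        intro x y hxy
        change (t⁻¹ : Weyl Φ d).1 (T.entry x) = T.entry y at hxy
        rw [ht.inv_eq] at hxy
        obtain ⟨x', hx', e⟩ := htb x
        rw [e] at hxy
        rw [← T.injective hxy]
        exact hx'.symm
      have h1 := ih _ (by rw [← hn]; exact len_mul_lt_of_inverts ht hinv) (T.act t)
        (Setoid.trans h (Setoid.symm hequiv)) (by rw [Tableau.word_act])
      rw [Tableau.word_act] at h1
      exact h1.trans (mul_bruhatLE_of_inverts ht hinv)

/-! ### Column permutations of standard tableaux -/

/-- A nontrivial column permutation reverses the order of two entries of some column, since only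
the identity is increasing on every column. -/
theorem Tableau.exists_column_inversion (T : Tableau lam) {w : Weyl Φ d} (hw : w ∈ T.col)
    (hne : w ≠ 1) : ∃ b₁ b₂ : diagram lam, b₁.1.2 = b₂.1.2 ∧ T.entry b₁ < T.entry b₂ ∧
      (w : Equiv.Perm ℤ) (T.entry b₂) < (w : Equiv.Perm ℤ) (T.entry b₁) := by
  by_contra! hno
  refine hne (Weyl.ext_letters (lam := lam) fun x hx => ?_)
  obtain ⟨b, rfl⟩ := T.exists_entry hx
  let S : Set ℤ := {x | ∃ c : diagram lam, c.1.2 = b.1.2 ∧ T.entry c = x}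
  have : Finite S := ((finite_letters lam).subset (by
    rintro _ ⟨c, _, rfl⟩
    exact T.entry_mem c)).to_subtype
  let g : S → S := fun x => ⟨(w : Equiv.Perm ℤ) x, by
    obtain ⟨x, c, hc, rfl⟩ := x
    obtain ⟨c', hc', e⟩ := hw c
    exact ⟨c', hc'.trans hc, e.symm⟩⟩
  have hg : StrictMono g := by
    rintro ⟨_, c, hc, rfl⟩ ⟨_, c', hc', rfl⟩ hlt
    refine lt_of_le_of_ne (hno c c' (hc.trans hc'.symm) hlt) fun e => ?_
    exact (ne_of_lt hlt) (Subtype.ext ((w : Equiv.Perm ℤ).injective (congrArg Subtype.val e)))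
  exact congrArg Subtype.val (apply_eq_self_of_strictMono hg ⟨T.entry b, b, rfl, rfl⟩)

/-- Permuting the entries within the columns of a standard tableau decreases its word in the Bruhat
order: each column of `T`, read from bottom to top, is decreasing, so every reflection in `col(T)`
is inverted by `w_T`. -/
theorem Tableau.IsStd.word_mul_bruhatLE {T : Tableau lam} (hT : T.IsStd) {w : Weyl Φ d}
    (hw : w ∈ T.col) : BruhatLE (T.word * w) T.word := by
  induction hn : len w using Nat.strong_induction_on generalizing w with
  | _ n ih =>
    by_cases hne : w = 1
    · rw [hne, mul_one]
      exact BruhatLE.refl _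
    · obtain ⟨b₁, b₂, hcol, hlt, hwlt⟩ := T.exists_column_inversion hw hne
      obtain ⟨t, ht, htb, c₁, c₂, hcc, hc, htc, hwc⟩ := T.exists_reflection_of_lt
        (AddMonoidHom.snd ℤ ℤ) w hcol hlt hwlt
      have hinv : Inverts w t := ⟨T.entry c₁, by rwa [htc], by rwa [htc]⟩
      have hwt : w * t ∈ T.col := by
        intro b
        obtain ⟨b', hb', e⟩ := htb b
        obtain ⟨b'', hb'', e'⟩ := hw b'
        exact ⟨b'', hb''.trans hb', by rw [Weyl.mul_apply, e, e']⟩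
      have h1 := ih _ (by rw [← hn]; exact len_mul_lt_of_inverts ht hinv) hwt rfl
      refine BruhatLE.trans ?_ h1
      rw [← mul_assoc]
      refine bruhatLE_mul_of_not_inverts ht ?_
      rw [ht.inverts_iff (T.word * w) (a := T.entry c₁) (by rwa [htc]), htc, Weyl.mul_apply,
        Weyl.mul_apply, not_lt]
      obtain ⟨e₁, he₁, h₁⟩ := hw c₁
      obtain ⟨e₂, he₂, h₂⟩ := hw c₂
      rw [h₁, h₂] at hwc ⊢
      have hee : e₁.1.2 = e₂.1.2 := he₁.trans (hcc.trans he₂.symm)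
      refine (T.word_lt (Or.inl ?_)).le
      rcases lt_trichotomy e₁.1.1 e₂.1.1 with h | h | h
      · exact absurd hwc (hT.2 e₁ e₂ hee h).not_gt
      · rw [show e₁ = e₂ from Subtype.ext (Prod.ext h hee)] at hwc
        exact absurd hwc (lt_irrefl _)
      · exact h

end Tableaux

section RowStandard

variable {Φ : CType} {d : ℕ}

/-! ### Words of row standard tableaux are shortest coset representatives -/

theorem rowsFrom_eq_image (c : ℤ) (parts : List ℕ) : rowsFrom c parts =
    ((Finset.univ.sigma fun k : Fin parts.length => Finset.Ico c (c + (parts[k] : ℤ))).image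
      (fun x => ((x.1 : ℤ) + 1, x.2)) : Finset (ℤ × ℤ)) := by
  ext ⟨i, j⟩
  simp only [rowsFrom, Set.mem_ofPred_eq, Finset.coe_image, Set.mem_image, Finset.mem_coe,
    Finset.mem_sigma, Finset.mem_univ, true_and, Finset.mem_Ico, Sigma.exists, Prod.mk.injEq]
  constructor
  · rintro ⟨k, hk, rfl, h1, h2⟩
    exact ⟨⟨k, hk⟩, j, ⟨h1, h2⟩, rfl, rfl⟩
  · rintro ⟨k, j', ⟨h1, h2⟩, rfl, rfl⟩
    exact ⟨k, k.2, rfl, h1, h2⟩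

theorem ncard_rowsFrom (c : ℤ) (parts : List ℕ) : (rowsFrom c parts).ncard = parts.sum := by
  rw [rowsFrom_eq_image, Set.ncard_coe_finset, Finset.card_image_of_injective, Finset.card_sigma]
  · simp only [Int.card_Ico, add_sub_cancel_left, Int.toNat_natCast]
    exact Fin.sum_univ_getElem parts
  · rintro ⟨k, j⟩ ⟨k', j'⟩ h
    simp only [Prod.mk.injEq, add_left_inj, Nat.cast_inj] at h
    obtain ⟨h1, rfl⟩ := h
    obtain rfl := Fin.ext h1
    rfl

theorem finite_rowsFrom (c : ℤ) (parts : List ℕ) : (rowsFrom c parts).Finite := by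
  rw [rowsFrom_eq_image]
  exact Finset.finite_toSet _

theorem mem_rowsFrom_take (c : ℤ) (parts : List ℕ) (i : ℕ) (b : ℤ × ℤ) :
    b ∈ rowsFrom c (parts.take i) ↔ b ∈ rowsFrom c parts ∧ b.1 ≤ i := by
  constructor
  · rintro ⟨k, hk, h1, h2, h3⟩
    rw [List.length_take] at hk
    rw [List.getElem_take] at h3
    exact ⟨⟨k, by omega, h1, h2, h3⟩, by omega⟩
  · rintro ⟨⟨k, hk, h1, h2, h3⟩, h4⟩
    exact ⟨k, by rw [List.length_take]; omega, h1, h2, by rwa [List.getElem_take]⟩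

theorem one_le_of_mem_rowsFrom {c : ℤ} {parts : List ℕ} {b : ℤ × ℤ} (h : b ∈ rowsFrom c parts) :
    1 ≤ b.1 := by
  obtain ⟨k, _, h1, _⟩ := h
  omega

variable {lam : Shape d Φ}

/-- The position of a box in the reading order. -/
def Tableau.pos (T : Tableau lam) (b : diagram lam) : ℤ := (T.word : Equiv.Perm ℤ) (T.entry b)

theorem Tableau.pos_lt_iff (T : Tableau lam) {b b' : diagram lam} :
    T.pos b < T.pos b' ↔ ReadBefore b b' := T.word_lt_iff

theorem Tableau.pos_injective (T : Tableau lam) : Function.Injective T.pos :=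
  (T.word : Equiv.Perm ℤ).injective.comp T.injective

theorem Tableau.pos_mem (T : Tableau lam) (b : diagram lam) : T.pos b ∈ letters lam :=
  apply_mem_letters _ (T.entry_mem b)

theorem Tableau.exists_pos (T : Tableau lam) {x : ℤ} (hx : x ∈ letters lam) :
    ∃ b, T.pos b = x := by
  obtain ⟨b, hb⟩ := T.exists_entry (apply_mem_letters T.word⁻¹ hx)
  exact ⟨b, by rw [Tableau.pos, hb, Weyl.apply_inv_self]⟩

theorem Tableau.pos_neg (T : Tableau lam) (hB : Φ = CType.B) {b b' : diagram lam}
    (h : (b' : ℤ × ℤ) = -b) : T.pos b' = -T.pos b := by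
  rw [Tableau.pos, T.symmetric hB b b' h, Weyl.apply_neg, Tableau.pos]

theorem Tableau.pos_pos_iff (T : Tableau lam) (hB : Φ = CType.B) (b : diagram lam) :
    0 < T.pos b ↔ b.1.1 < 0 ∨ b.1.1 = 0 ∧ 0 < b.1.2 := by
  have h1 := T.pos_neg hB (b := b) (b' := ⟨-b, diagram_symm hB _ b.2⟩) rfl
  have h2 := T.pos_lt_iff (b := ⟨-b, diagram_symm hB _ b.2⟩) (b' := b)
  rw [h1] at h2
  simp only [ReadBefore, Prod.fst_neg, Prod.snd_neg] at h2
  rw [show 0 < T.pos b ↔ -T.pos b < T.pos b by omega, h2]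
  omega

/-- Counting the boxes whose positions fill an interval. -/
theorem Tableau.ncard_eq_of_pos (T : Tableau lam) {x y : ℤ} (hx : 0 ≤ x) (hy : y ≤ d)
    {B : Set (ℤ × ℤ)} (hBd : B ⊆ diagram lam)
    (hB : ∀ b : diagram lam, (b : ℤ × ℤ) ∈ B ↔ x < T.pos b ∧ T.pos b ≤ y) :
    B.ncard = (y - x).toNat := by
  have h1 : T.pos '' (Subtype.val ⁻¹' B) = Set.Ioc x y := by
    ext z
    constructor
    · rintro ⟨b, hb, rfl⟩
      exact (hB b).1 hb
    · intro hz
      obtain ⟨b, rfl⟩ := T.exists_pos (mem_letters_of_pos (lam := lam) (x := z)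
        (by have := hz.1; omega) (hz.2.trans hy))
      exact ⟨b, (hB b).2 hz, rfl⟩
  have h2 : ((Subtype.val : diagram lam → ℤ × ℤ) '' (Subtype.val ⁻¹' B)) = B := by
    rw [Subtype.image_preimage_coe, Set.inter_eq_right.2 hBd]
  rw [← h2, Set.ncard_image_of_injective _ Subtype.val_injective,
    ← Set.ncard_image_of_injective _ T.pos_injective, h1, ← Finset.coe_Ioc,
    Set.ncard_coe_finset, Int.card_Ioc]

/-- In type `A`, the last position of a row is a partial sum of the reversed composition. -/
theorem sum_take_reverse_of_row_lt {parts : List ℕ} {hpos : ∀ p ∈ parts, 0 < p}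
    {hsum : parts.sum = d} (T : Tableau (Shape.a parts hpos hsum))
    {b₁ b₂ : diagram (Shape.a parts hpos hsum)} (h : T.pos b₂ = T.pos b₁ + 1)
    (hrow : b₂.1.1 < b₁.1.1) : ∃ k, T.pos b₁ = (parts.reverse.take k).sum := by
  obtain ⟨i, hi⟩ : ∃ i : ℕ, (i : ℤ) = b₂.1.1 :=
    ⟨b₂.1.1.toNat, by have := one_le_of_mem_rowsFrom b₂.2; omega⟩
  have hp1 := (letters_pos rfl _).1 (T.pos_mem b₁)
  have h1 : (rowsFrom 1 (parts.take i)).ncard = ((d : ℤ) - T.pos b₁).toNat := by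
    refine T.ncard_eq_of_pos (by omega) le_rfl
      (fun b hb => ((mem_rowsFrom_take _ _ _ _).1 hb).1) fun b => ?_
    have hd := (letters_pos rfl _).1 (T.pos_mem b)
    have hb : (b : ℤ × ℤ) ∈ rowsFrom 1 parts := b.2
    rw [mem_rowsFrom_take]
    have h3 := T.pos_lt_iff (b := b₁) (b' := b)
    have h4 := T.pos_lt_iff (b := b) (b' := b₂)
    simp only [hb, true_and, hi, hd.2, and_true]
    simp only [ReadBefore] at h3 h4
    omega
  rw [ncard_rowsFrom] at h1
  refine ⟨parts.length - i, ?_⟩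
  have h2 := parts.sum_take_add_sum_drop i
  rw [List.take_reverse, List.sum_reverse]
  have h3 : (parts.drop (parts.length - (parts.length - i))).sum = (parts.drop i).sum := by
    by_cases hle : i ≤ parts.length
    · congr 2; omega
    · rw [List.drop_of_length_le (by omega), List.drop_of_length_le (by omega)]
  rw [h3]
  omega

/-- In type `B`, the last positive position `j` in a row is a partial sum of the composition. The
box `b₂` is the next one, and `b₁` is the box with position `j`, except that for `j = 0` it may be
any box in a lower row, as there need not be a box with position `0`. The boxes of row `0` with positive
position form the set `Z`. -/
theorem Tableau.sum_take_of_row_lt {Z : Set (ℤ × ℤ)} {m : ℕ} {c : ℤ} {parts : List ℕ}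
    {lam : Shape d CType.B} (T : Tableau lam) (hZ : Z.ncard = m) (hZf : Z.Finite)
    (hdiag : ∀ b, b ∈ diagram lam ∧ (b.1 < 0 ∨ b.1 = 0 ∧ 0 < b.2) ↔
      b ∈ Z ∨ -b ∈ rowsFrom c parts)
    (hZ0 : ∀ b ∈ Z, b.1 = 0) {b₁ b₂ : diagram lam} {j : ℕ} (h1 : T.pos b₁ = j ∨ j = 0)
    (h2 : T.pos b₂ = j + 1) (hrow : b₂.1.1 < b₁.1.1) (hneg : b₂.1.1 < 0) :
    ∃ k, j = m + (parts.take k).sum := by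
  obtain ⟨i, hi⟩ : ∃ i : ℕ, (i : ℤ) = -b₂.1.1 - 1 := ⟨(-b₂.1.1 - 1).toNat, by omega⟩
  refine ⟨i, ?_⟩
  have hjd : (j : ℤ) + 1 ≤ d := by
    have := (_root_.abs_le.1 (letters_abs_le _ (T.pos_mem b₂))).2
    omega
  have hdisj : Disjoint Z (Neg.neg '' rowsFrom c (parts.take i)) := by
    rw [Set.disjoint_left]
    rintro _ hb ⟨b, hb', rfl⟩
    have := hZ0 _ hb
    have := one_le_of_mem_rowsFrom hb'
    simp only [Prod.fst_neg] at *
    omega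
  have hB : ∀ b : ℤ × ℤ, b ∈ Z ∪ Neg.neg '' rowsFrom c (parts.take i) ↔
      (b ∈ Z ∨ -b ∈ rowsFrom c parts) ∧ b₂.1.1 < b.1 := by
    intro b
    rw [Set.mem_union, Set.image_neg_eq_neg, Set.mem_neg, mem_rowsFrom_take, Prod.fst_neg]
    constructor
    · rintro (h | ⟨h, h'⟩)
      · exact ⟨Or.inl h, by rw [hZ0 b h]; exact hneg⟩
      · exact ⟨Or.inr h, by omega⟩
    · rintro ⟨h | h, h'⟩
      · exact Or.inl h
      · exact Or.inr ⟨h, by omega⟩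
  have hcount := T.ncard_eq_of_pos (x := 0) (y := j) le_rfl (by omega)
    (B := Z ∪ Neg.neg '' rowsFrom c (parts.take i))
    (fun b hb => ((hdiag b).2 ((hB b).1 hb).1).1) fun b => by
      rw [hB, ← hdiag, T.pos_pos_iff rfl, and_iff_right b.2]
      refine and_congr_right fun hb => ?_
      have h0 := (T.pos_pos_iff rfl b).2 hb
      have h3 := T.pos_lt_iff (b := b₁) (b' := b)
      have h4 := T.pos_lt_iff (b := b) (b' := b₂)
      simp only [ReadBefore] at h3 h4
      omega
  rw [Set.ncard_union_eq hdisj hZf ((finite_rowsFrom _ _).image _), hZ,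
    Set.ncard_image_of_injective _ neg_injective, ncard_rowsFrom] at hcount
  omega

/-- Positions exchanged by a simple reflection in `J` belong to boxes in the same row. -/
theorem Tableau.same_row_of_mem_shapeJ (T : Tableau lam) {j : Idx Φ d} (hj : j ∈ shapeJ lam)
    {b₁ b₂ : diagram lam} (h1 : T.pos b₁ = if (j : ℕ) = 0 then -1 else ((j : ℕ) : ℤ))
    (h2 : T.pos b₂ = (j : ℕ) + 1) : b₁.1.1 = b₂.1.1 := by
  have hlt : T.pos b₁ < T.pos b₂ := by
    rw [h1, h2]
    split_ifs <;> omega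
  have hread := T.pos_lt_iff.1 hlt
  simp only [ReadBefore] at hread
  rcases hread with hrow | ⟨h, _⟩
  · exfalso
    cases lam with
    | a parts hpos hsum =>
      have hj0 : (j : ℕ) ≠ 0 := by
        have := j.2.2 rfl
        omega
      rw [if_neg hj0] at h1
      obtain ⟨k, hk⟩ := sum_take_reverse_of_row_lt T (by rw [h1, h2]) hrow
      exact hj k (by omega)
    | bOdd m parts hpos hsum =>
      have hneg : b₂.1.1 < 0 := by
        by_cases hj0 : (j : ℕ) = 0
        · rw [if_pos hj0] at h1
          have h3 := T.pos_neg rfl (b := b₁) (b' := ⟨-b₁, diagram_symm rfl _ b₁.2⟩) rfl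
          have h4 : b₂ = ⟨-b₁, diagram_symm rfl _ b₁.2⟩ := T.pos_injective (by
            rw [h3, h1, h2, hj0]; rfl)
          rw [h4] at hrow ⊢
          simp only [Prod.fst_neg] at *
          omega
        · rw [if_neg hj0] at h1
          have := (T.pos_pos_iff rfl b₁).1 (by omega)
          omega
      obtain ⟨k, hk⟩ := T.sum_take_of_row_lt (m := m) (c := 0) (parts := parts) (j := j)
        (Z := (fun x : ℤ => ((0 : ℤ), x)) '' Set.Icc 1 m)
        (by
          rw [Set.ncard_image_of_injective _ (Prod.mk_right_injective 0), ← Finset.coe_Icc,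
            Set.ncard_coe_finset, Int.card_Icc]
          omega)
        ((Set.finite_Icc _ _).image _)
        (by
          rintro ⟨x, y⟩
          have e1 : (x, y) ∈ rowsFrom 0 parts → 1 ≤ x := one_le_of_mem_rowsFrom
          have e2 : -(x, y) ∈ rowsFrom 0 parts → 1 ≤ -x := one_le_of_mem_rowsFrom
          change ((x = 0 ∧ |y| ≤ (m : ℤ)) ∨ ((x, y) ∈ rowsFrom 0 parts ∨
            -(x, y) ∈ rowsFrom 0 parts)) ∧ (x < 0 ∨ x = 0 ∧ 0 < y) ↔ _
          simp only [Set.mem_image, Set.mem_Icc, Prod.mk.injEq, exists_eq_right_right]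
          rw [_root_.abs_le]
          constructor
          · rintro ⟨⟨hx, hy⟩ | h | h, h'⟩
            · exact Or.inl ⟨by omega, hx.symm⟩
            · have := e1 h; omega
            · exact Or.inr h
          · rintro (⟨⟨h, h'⟩, h''⟩ | h)
            · exact ⟨Or.inl ⟨by omega, by omega, by omega⟩, by omega⟩
            · have := e2 h
              exact ⟨Or.inr (Or.inr h), by omega⟩)
        (by rintro _ ⟨x, _, rfl⟩; rfl)
        (by rw [h1]; split_ifs with h0 <;> simp [h0]) h2 hrow hneg
      exact hj k hk
    | bEven parts hpos hsum =>
      have hneg : b₂.1.1 < 0 := by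
        have h3 := (T.pos_pos_iff rfl b₂).1 (by omega)
        rcases b₂.2 with h | h
        · have := one_le_of_mem_rowsFrom h; omega
        · have := one_le_of_mem_rowsFrom h
          simp only [Prod.fst_neg] at this
          omega
      obtain ⟨k, hk⟩ := T.sum_take_of_row_lt (m := 0) (c := 1) (parts := parts) (j := j)
        (Z := ∅) (by simp) Set.finite_empty
        (by
          rintro ⟨x, y⟩
          have e1 : (x, y) ∈ rowsFrom 1 parts → 1 ≤ x := one_le_of_mem_rowsFrom
          have e2 : -(x, y) ∈ rowsFrom 1 parts → 1 ≤ -x := one_le_of_mem_rowsFrom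
          change ((x, y) ∈ rowsFrom 1 parts ∨ -(x, y) ∈ rowsFrom 1 parts) ∧
            (x < 0 ∨ x = 0 ∧ 0 < y) ↔ _
          simp only [Set.mem_empty_iff_false, false_or]
          constructor
          · rintro ⟨h | h, h'⟩
            · have := e1 h; omega
            · exact h
          · intro h
            have := e2 h
            exact ⟨Or.inr h, by omega⟩)
        (by simp) (by rw [h1]; split_ifs with h0 <;> simp [h0]) h2 hrow hneg
      exact hj k (by omega)
  · exact h

theorem Tableau.IsRowStd.word_mem_minReps {R : Tableau lam} (hR : R.IsRowStd) :
    R.word ∈ minReps (shapeJ lam) := by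
  refine mem_minReps_of_forall_lt fun j hj => ?_
  rcases len_simple_mul R.word j with ⟨h, _⟩ | ⟨_, h⟩
  · exfalso
    -- The positions `a`, `b` exchanged by `s_j` belong to the same row of `R`.
    obtain ⟨a, b, ha, hb, hab, hsb, hal, hbl⟩ : ∃ a b : ℤ,
        (a = if (j : ℕ) = 0 then -1 else ((j : ℕ) : ℤ)) ∧ b = (j : ℕ) + 1 ∧ a < b ∧
        (simple j : Equiv.Perm ℤ) a = b ∧ a ∈ letters lam ∧ b ∈ letters lam := by
      have hjd := j.2.1
      have hbl : (((j : ℕ) : ℤ) + 1) ∈ letters lam := mem_letters_of_pos (by omega) (by omega)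
      by_cases hj0 : (j : ℕ) = 0
      · have hB : Φ = CType.B := by
          cases Φ with
          | A =>
            have := j.2.2 rfl
            omega
          | B => rfl
        refine ⟨-1, 1, by rw [if_pos hj0], by omega, by omega, ?_, ?_, ?_⟩
        · simp [simple_apply, simplePerm_apply, hj0]
        · exact letters_symm hB 1 (mem_letters_of_pos le_rfl (by omega))
        · exact mem_letters_of_pos le_rfl (by omega)
      · refine ⟨(j : ℕ), (j : ℕ) + 1, by rw [if_neg hj0], rfl, by omega, ?_,
          mem_letters_of_pos (by omega) (by omega), hbl⟩
        rw [simple_apply, simplePerm_apply, if_neg hj0, if_pos rfl]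
    obtain ⟨b₁, h1⟩ := R.exists_pos hal
    obtain ⟨b₂, h2⟩ := R.exists_pos hbl
    have hrow := R.same_row_of_mem_shapeJ hj (h1.trans ha) (h2.trans hb)
    have hread := R.pos_lt_iff.1 (show R.pos b₁ < R.pos b₂ by omega)
    rw [(isReflection_simple j).inverts_iff _ (a := a) (by omega), hsb, ← h1, ← h2, Tableau.pos,
      Tableau.pos, Weyl.inv_apply_self, Weyl.inv_apply_self] at h
    refine absurd h (hR b₁ b₂ hrow ?_).not_gt
    simp only [ReadBefore] at hread
    omega
  · omega

/-! ### Specht vectors in the standard basis -/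

instance finite_tableau (lam : Shape d Φ) : Finite (Tableau lam) :=
  Finite.of_injective _ Tableau.word_injective

/-- A tabloid that occurs in the Specht vector of a standard tableau `T` has a word below `w_T`. -/
theorem Tableau.IsStd.word_bruhatLE_of_specht_ne_zero {T R : Tableau lam} (hT : T.IsStd)
    (hR : R.IsRowStd) (h : T.specht ⟦R⟧ ≠ 0) : BruhatLE R.word T.word := by
  classical
  rw [Tableau.specht, Finsupp.finsetSum_apply] at h
  obtain ⟨w, -, hw⟩ := Finset.exists_ne_zero_of_sum_ne_zero h
  split_ifs at hw with hcol
  · have he : (⟦T.act w⟧ : Tabloid lam) = ⟦R⟧ := by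
      by_contra hne
      exact hw (Finsupp.single_eq_of_ne (Ne.symm hne))
    have h1 := hR.word_bruhatLE (T.act w) (Setoid.symm (Quotient.exact he))
    rw [Tableau.word_act] at h1
    exact h1.trans (hT.word_mul_bruhatLE hcol)
  · exact absurd rfl hw

theorem Tableau.IsStd.specht_self {T : Tableau lam} (hT : T.IsStd) : T.specht ⟦T⟧ = 1 := by
  classical
  rw [Tableau.specht, Finsupp.finsetSum_apply, Finset.sum_eq_single 1]
  · have h1 : (1 : Weyl Φ d) ∈ T.col := fun b => ⟨b, rfl, rfl⟩
    have h2 : T.act 1 = T := Tableau.word_injective (by rw [Tableau.word_act, mul_one])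
    rw [if_pos h1, h2, Finsupp.single_eq_same, len_one, pow_zero]
  · intro w _ hw
    split_ifs with hcol
    · refine Finsupp.single_eq_of_ne fun he => hw ?_
      have h1 := hT.1.word_bruhatLE (T.act w) (Quotient.exact he)
      rw [Tableau.word_act] at h1
      have h2 := (hT.word_mul_bruhatLE hcol).antisymm h1
      exact mul_eq_left.1 h2
    · rfl
  · simp

/-- The Specht vector of a standard tableau `T` is `M_{w_T}` plus a combination of the `M_x` with
`x < w_T`. -/
theorem Tableau.IsStd.embed_specht_sub_mem {T : Tableau lam} (hT : T.IsStd) :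
    embed T.specht - stdElt (shapeJ lam) T.word ∈ Submodule.span LR (stdBasis (shapeJ lam) ''
      {y : minReps (shapeJ lam) | BruhatLE (y : Weyl Φ d) T.word ∧
        y ≠ ⟨T.word, hT.1.word_mem_minReps⟩}) := by
  classical
  let _ : Fintype {R : Tableau lam // R.IsRowStd} := Fintype.ofFinite _
  rw [embed, finsum_eq_sum_of_fintype,
    ← Finset.add_sum_erase _ _ (Finset.mem_univ (⟨T, hT.1⟩ : {R : Tableau lam // R.IsRowStd}))]
  rw [hT.specht_self, map_one, one_smul, add_sub_cancel_left]
  refine Submodule.sum_mem _ fun R hR => ?_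
  by_cases h0 : T.specht ⟦R.1⟧ = 0
  · rw [h0, map_zero, zero_smul]
    exact zero_mem _
  · refine Submodule.smul_mem _ _ (Submodule.subset_span ⟨⟨R.1.word, R.2.word_mem_minReps⟩,
      ⟨hT.word_bruhatLE_of_specht_ne_zero R.2 h0, fun h => ?_⟩, stdBasis_apply _ _⟩)
    exact (Finset.mem_erase.1 hR).1
      (Subtype.ext (Tableau.word_injective (congrArg Subtype.val h)))

theorem isUpperUnitriangular_of_bruhatLE {S : Type} [Zero S] [One S]
    (a : minReps (shapeJ lam) → {T : Tableau lam // T.IsStd} → S)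
    (h1 : ∀ T, a ⟨T.1.word, T.2.1.word_mem_minReps⟩ T = 1)
    (h0 : ∀ x T, ¬ BruhatLE x.1 T.1.word → a x T = 0) : IsUpperUnitriangular lam a :=
  ⟨fun _ hR => hR.word_mem_minReps,
    fun _ _ _ _ hD hR => ⟨h1, fun x T hx => h0 x T fun h => hx (hD _ _ h),
      fun R T hx => h0 _ T fun h => hx (hR R ⟨T.1, T.2.1⟩ h)⟩, h1, h0⟩

end RowStandard

end ParabolicKL

end

open ParabolicKL in
theorem theorem3p1 (Φ : CType) (d : ℕ) (lam : Shape d Φ) (v : LR) (hv : v = q ∨ v = qInv) :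
    ∃ K : Module.Basis (minReps (shapeJ lam)) LR (Ind (shapeJ lam)),
      (∀ m : minReps (shapeJ lam) → Ind (shapeJ lam), IsKLBasis (shapeJ lam) v m ↔ m = K) ∧
      IsUpperUnitriangular lam (fun x T => K.repr (embed T.1.specht) x) ∧
      letI : Algebra LR ℂ := specOne
      IsUpperUnitriangular lam
        (fun x T => (K.baseChange ℂ).repr ((1 : ℂ) ⊗ₜ[LR] embed T.1.specht) x) := by
  obtain ⟨K, hK, hrepr⟩ := exists_isKLBasis (shapeJ lam) hv
  have hT := fun T : {T : Tableau lam // T.IsStd} =>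
    hrepr ⟨T.1.word, T.2.1.word_mem_minReps⟩ (embed T.1.specht) T.2.embed_specht_sub_mem
  refine ⟨K, hK, isUpperUnitriangular_of_bruhatLE _ (fun T => (hT T).1) fun x T => (hT T).2 x, ?_⟩
  let _ : Algebra LR ℂ := specOne
  refine isUpperUnitriangular_of_bruhatLE _ (fun T => ?_) fun x T hx => ?_
  · rw [Module.Basis.baseChange_repr_tmul, (hT T).1, one_smul]
  · rw [Module.Basis.baseChange_repr_tmul, (hT T).2 x hx, zero_smul]
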